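/- Let $\mathbb K=\mathbb R$ or $\mathbb C$, $d=\dim_{\mathbb R}\mathbb K$ and $\kappa=\frac{3d}4+\frac12$. Let $\mathcal D_{n,\mathbb K}$ be the set of positive definite $n\times n$ matrices over $\mathbb K$ of trace one. Write $\rho\in\mathcal D_{4,\mathbb K}$ in $2\times2$ blocks as $\rho=\begin{pmatrix}D_1&C\\C^*&D_2\end{pmatrix}$ and put $\operatorname{Tr}_2\rho=D_1+D_2$, $X(\rho)=D_1^{-1/2}CD_2^{-1/2}$ and $T(\rho)=\begin{pmatrix}D_1&C^*\\C&D_2\end{pmatrix}$. By the Peres–Horodecki criterion the set of separable states is $\mathcal D^s_{4,\mathbb K}=\mathcal D_{4,\mathbb K}\cap T(\mathcal D_{4,\mathbb K})$. For $D\in\mathcal D_{2,\mathbb K}$ let $\mathcal D_{4,\mathbb K}(D)=\{\rho\in\mathcal D_{4,\mathbb K}:\operatorname{Tr}_2\rho=D\}$ and $\mathcal D^s_{4,\mathbb K}(D)=\mathcal D^s_{4,\mathbb K}\cap\mathcal D_{4,\mathbb K}(D)$. Let $g$ be the monotone metric of $f(x)=\sqrt x$, that is $g(\rho)(A,B)=\operatorname{Tr}\big(A\,(R_\rho^{1/2}f(L_\rho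 R_\rho^{-1})R_\rho^{1/2})^{-1}(B)\big)$ for traceless self-adjoint $A,B$, where $L_\rho,R_\rho$ are left and right multiplication by $\rho$. For $0<r<1$, $0<\delta\le1$ and $S\subseteq\mathcal D_{4,\mathbb K}(D)$ put $$\mathrm{Vol}_{\delta,r}(S)=\int_{\{\rho\in S:\ \|X(\rho)\|<r\}}\sqrt{\det g(\rho)}\;\det\big(I-X(\rho)X(\rho)^*\big)^{\kappa(1-\delta)}\,d\lambda(D_1,C),$$ so that $\delta=1$ gives the metric volume, and put $$\mathcal P_\delta(D)=\lim_{r\to1-0}\frac{\mathrm{Vol}_{\delta,r}(\mathcal D^s_{4,\mathbb K}(D))}{\mathrm{Vol}_{\delta,r}(\mathcal D_{4,\mathbb K}(D))},\qquad \mathcal P_{sep,\sqrt x}(D)=\lim_{\delta\to1-0}\mathcal P_\delta(D).$$ With $V_\varepsilon=\mathrm{diag}(1,\varepsilon)$ and the operator norm on $\mathbb K^{2\times2}$, put, for $\varepsilon>0$, $$\eta_{d,\delta,r}(\varepsilon)=\int_{\|X\|<r,\ \|V_\varepsilon^{-1}XV_\varepsilon\|<1}\det(I-XX^*)^{-\kappa\delta}\,d\lambda_{4d}(X),\qquad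 \eta_d(\varepsilon)=\eta_{d,1,1}(\varepsilon),$$ $$\tilde\eta_{d,\delta}(\varepsilon)=\lim_{r\to1-0}\frac{\eta_{d,\delta,r}(\varepsilon)}{\eta_{d,\delta,r}(1)},\qquad \tilde\eta_d(\varepsilon)=\lim_{\delta\to1-0}\tilde\eta_{d,\delta}(\varepsilon).$$ For a $2\times2$ matrix $A$ with singular values $\sigma_1\ge\sigma_2$, $\sigma_1>0$, let $\sigma(A)=\sigma_2/\sigma_1$. Let $\mathcal E_{2,\mathbb K}=\{Y=Y^*\in\mathbb K^{2\times2}:-I<Y<I\}$ and $$d\nu_{d+2}(Y)=\frac{\det(I-Y^2)^{\frac{d-2}4}}{\int_{\mathcal E_{2,\mathbb K}}\det(I-Z^2)^{\frac{d-2}4}\,d\lambda_{d+2}(Z)}\,d\lambda_{d+2}(Y)\quad\text{on }\mathcal E_{2,\mathbb K}.$$ Then $\eta_d(1)=\infty$; the limits that define $\tilde\eta_{d,\delta}(\varepsilon)$, $\tilde\eta_d(\varepsilon)$, $\mathcal P_\delta(D)$ and $\mathcal P_{sep,\sqrt x}(D)$ exist for all $\varepsilon>0$, $\delta\in(0,1]$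 and $D\in\mathcal D_{2,\mathbb K}$; $\nu_{d+2}$ is a probability measure; and for every $D\in\mathcal D_{2,\mathbb K}$ $$\mathcal P_{sep,\sqrt x}(D)=\mathcal P_1(D)=\int_{\mathcal E_{2,\mathbb K}}\tilde\eta_d\Big(\sigma\Big(\sqrt{\tfrac{I-Y}{I+Y}}\Big)\Big)\,d\nu_{d+2}(Y).$$ In particular $\mathcal P_{sep,\sqrt x}(D)$ does not depend on $D$, which is the Milz–Strunz conjecture in this setting. -/

import Mathlib

open Filter Topology MeasureTheory
open scoped ComplexOrder Kronecker Matrix ENNReal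

namespace SqrtSep

noncomputable section

section Geometry

variable {𝕜 : Type*} [RCLike 𝕜]
variable {n : Type*} [Fintype n] [DecidableEq n]

/-- The faithful states: positive definite matrices of trace one. -/
def states (𝕜 : Type*) [RCLike 𝕜] (n : Type*) [Fintype n] [DecidableEq n] :
    Set (Matrix n n 𝕜) :=
  {D | D.PosDef ∧ D.trace = 1}

/-- The tangent space of the state space: traceless self-adjoint matrices. -/
def tangent (𝕜 : Type*) [RCLike 𝕜] (n : Type*) [Fintype n] [DecidableEq n] :
    Submodule ℝ (Matrix n n 𝕜) where
  carrier := {A | A.IsHermitian ∧ A.trace = 0}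
  zero_mem' := ⟨Matrix.isHermitian_zero, Matrix.trace_zero n 𝕜⟩
  add_mem' := by
    rintro A B ⟨hA, hA'⟩ ⟨hB, hB'⟩
    exact ⟨hA.add hB, by rw [Matrix.trace_add, hA', hB', add_zero]⟩
  smul_mem' := by
    rintro c A ⟨hA, hA'⟩
    refine ⟨?_, by rw [Matrix.trace_smul, hA', smul_zero]⟩
    unfold Matrix.IsHermitian at hA ⊢
    rw [Matrix.conjTranspose_smul, hA, star_trivial]

/-- `A ↦ D A` as a matrix acting on the vectorizations `Matrix.vec A`. -/
def leftMul (D : Matrix n n 𝕜) : Matrix (n × n) (n × n) 𝕜 :=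
  (1 : Matrix n n 𝕜) ⊗ₖ D

/-- `A ↦ A D` as a matrix acting on the vectorizations `Matrix.vec A`. -/
def rightMul (D : Matrix n n 𝕜) : Matrix (n × n) (n × n) 𝕜 :=
  Dᵀ ⊗ₖ (1 : Matrix n n 𝕜)

/-- The operator `R_D^{1/2} f(L_D R_D⁻¹) R_D^{1/2}` on matrices. -/
def petzOp (f : ℝ → ℝ) (D : Matrix n n 𝕜) : Matrix (n × n) (n × n) 𝕜 :=
  cfc Real.sqrt (rightMul D) * cfc f (leftMul D * (rightMul D)⁻¹) * cfc Real.sqrt (rightMul D)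

/-- The monotone metric `g_f(D)(X, Y) = Tr (X (R_D^{1/2} f(L_D R_D⁻¹) R_D^{1/2})⁻¹ (Y))`.
The dot product of `vec Xᵀ` and `vec Z` is `Tr (X Z)`. -/
def petzMetric (f : ℝ → ℝ) (D X Y : Matrix n n 𝕜) : ℝ :=
  RCLike.re (Matrix.vec Xᵀ ⬝ᵥ ((petzOp f D)⁻¹ *ᵥ Matrix.vec Y))

/-- The density `√det g_f(D)` of the Riemannian volume of `g_f` with respect to the Lebesgue
measure of the Hilbert-Schmidt metric: a quotient of two Gram determinants in one (arbitrary)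
basis of the tangent space. -/
def volDensity (f : ℝ → ℝ) (D : Matrix n n 𝕜) : ℝ :=
  let b := Module.finBasis ℝ (tangent 𝕜 n)
  √((Matrix.of fun i j => petzMetric f D (b i) (b j)).det /
    (Matrix.of fun i j => RCLike.re ((b i : Matrix n n 𝕜) * (b j : Matrix n n 𝕜)).trace).det)

end Geometry

section Matrices

variable {𝕜 : Type*} [RCLike 𝕜]

/-- The operator norm with respect to the Euclidean norm of `𝕜²`. -/
def opNorm (X : Matrix (Fin 2) (Fin 2) 𝕜) : ℝ :=
  ‖Matrix.toEuclideanCLM (𝕜 := 𝕜) X‖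

/-- The square root of a positive matrix. -/
def msqrt (A : Matrix (Fin 2) (Fin 2) 𝕜) : Matrix (Fin 2) (Fin 2) 𝕜 :=
  cfc Real.sqrt A

/-- The ratio of the smaller to the larger singular value of a `2 × 2` matrix; the singular values
are the square roots of the eigenvalues of `Aᴴ A`. -/
def svRatio (A : Matrix (Fin 2) (Fin 2) 𝕜) : ℝ :=
  let e := (Matrix.isHermitian_conjTranspose_mul_self A).eigenvalues
  √(min (e 0) (e 1)) / √(max (e 0) (e 1))

/-- `det (I - X X*)`, which is real. -/
def defect (X : Matrix (Fin 2) (Fin 2) 𝕜) : ℝ :=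
  RCLike.re (1 - X * Xᴴ).det

/-- The matrix `V_ε = diag (1, ε)`. -/
def diagV (𝕜 : Type*) [RCLike 𝕜] (ε : ℝ) : Matrix (Fin 2) (Fin 2) 𝕜 :=
  !![1, 0; 0, (ε : 𝕜)]

/-- `d = dim_ℝ 𝕜`, that is `1` or `2`. -/
def dimK (𝕜 : Type*) [RCLike 𝕜] : ℝ := (Module.finrank ℝ 𝕜 : ℝ)

/-- The exponent `3d/4 + 1/2`. -/
def kap (𝕜 : Type*) [RCLike 𝕜] : ℝ := 3 * dimK 𝕜 / 4 + 1 / 2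

/-- The operator interval `{Y = Y* : -I < Y < I}`. -/
def opInterval (𝕜 : Type*) [RCLike 𝕜] : Set (Matrix (Fin 2) (Fin 2) 𝕜) :=
  {Y | Y.IsHermitian ∧ (1 + Y).PosDef ∧ (1 - Y).PosDef}

/-- `σ(√((I - Y)/(I + Y)))`. -/
def sigmaY (Y : Matrix (Fin 2) (Fin 2) 𝕜) : ℝ :=
  svRatio (msqrt ((1 - Y) * (1 + Y)⁻¹))

/-- Two-qubit (or two-rebit) matrices, in blocks `D₁, C, C*, D₂`. -/
abbrev Mat4 (𝕜 : Type*) := Matrix (Fin 2 ⊕ Fin 2) (Fin 2 ⊕ Fin 2) 𝕜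

/-- The partial trace `Tr₂ ρ = D₁ + D₂`. -/
def ptrace (ρ : Mat4 𝕜) : Matrix (Fin 2) (Fin 2) 𝕜 :=
  ρ.toBlocks₁₁ + ρ.toBlocks₂₂

/-- The states `ρ` with reduced state `Tr₂ ρ = D`. -/
def fibre (D : Matrix (Fin 2) (Fin 2) 𝕜) : Set (Mat4 𝕜) :=
  {ρ | ρ ∈ states 𝕜 (Fin 2 ⊕ Fin 2) ∧ ptrace ρ = D}

/-- The involution `ρ(D₁, D₂, C) ↦ ρ(D₁, D₂, C*)`, which is the partial transposition followed by
entrywise conjugation. -/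
def blockFlip (ρ : Mat4 𝕜) : Mat4 𝕜 :=
  Matrix.fromBlocks ρ.toBlocks₁₁ ρ.toBlocks₁₂ᴴ ρ.toBlocks₁₂ ρ.toBlocks₂₂

/-- The separable states, through the Peres-Horodecki criterion. -/
def sepStates (𝕜 : Type*) [RCLike 𝕜] : Set (Mat4 𝕜) :=
  blockFlip '' states 𝕜 (Fin 2 ⊕ Fin 2) ∩ states 𝕜 (Fin 2 ⊕ Fin 2)

/-- The contraction `X = D₁^{-1/2} C D₂^{-1/2}` belonging to `ρ(D₁, D₂, C)`. -/
def contr (ρ : Mat4 𝕜) : Matrix (Fin 2) (Fin 2) 𝕜 :=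
  (msqrt ρ.toBlocks₁₁)⁻¹ * ρ.toBlocks₁₂ * (msqrt ρ.toBlocks₂₂)⁻¹

end Matrices

section Measures

/-- Lebesgue measure on matrices, entry by entry. -/
instance matrixMeasureSpace {m n 𝕜 : Type*} [Fintype m] [Fintype n] [MeasureSpace 𝕜] :
    MeasureSpace (Matrix m n 𝕜) :=
  inferInstanceAs (MeasureSpace (m → n → 𝕜))

variable {𝕜 : Type*} [RCLike 𝕜] [MeasureSpace 𝕜]

/-- The self-adjoint matrix with diagonal `a, b` and upper right entry `z`. -/
def hermMk (p : ℝ × ℝ × 𝕜) : Matrix (Fin 2) (Fin 2) 𝕜 :=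
  !![(p.1 : 𝕜), p.2.2; star p.2.2, (p.2.1 : 𝕜)]

/-- Lebesgue measure `λ_{d+2}` on the self-adjoint `2 × 2` matrices (as a measure on all `2 × 2`
matrices); the factor `2^{d/2}` makes it the one of the Hilbert-Schmidt metric. -/
def hermVol (𝕜 : Type*) [RCLike 𝕜] [MeasureSpace 𝕜] : Measure (Matrix (Fin 2) (Fin 2) 𝕜) :=
  ENNReal.ofReal (2 ^ (dimK 𝕜 / 2)) • (volume : Measure (ℝ × ℝ × 𝕜)).map hermMk

/-- The measure with density `det (I - Y²)^{(d-2)/4}` on the operator interval. -/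
def nuRaw (𝕜 : Type*) [RCLike 𝕜] [MeasureSpace 𝕜] : Measure (Matrix (Fin 2) (Fin 2) 𝕜) :=
  ((hermVol 𝕜).restrict (opInterval 𝕜)).withDensity
    fun Y => ENNReal.ofReal (RCLike.re (1 - Y * Y).det ^ ((dimK 𝕜 - 2) / 4))

/-- `ν_{d+2}`: the normalization of `nuRaw`. -/
def nu (𝕜 : Type*) [RCLike 𝕜] [MeasureSpace 𝕜] : Measure (Matrix (Fin 2) (Fin 2) 𝕜) :=
  (nuRaw 𝕜 Set.univ)⁻¹ • nuRaw 𝕜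

/-- The function `η_d`, with values in `[0, ∞]`. -/
def eta (𝕜 : Type*) [RCLike 𝕜] [MeasureSpace 𝕜] (ε : ℝ) : ℝ≥0∞ :=
  ∫⁻ X in {X : Matrix (Fin 2) (Fin 2) 𝕜 |
      opNorm X < 1 ∧ opNorm ((diagV 𝕜 ε)⁻¹ * X * diagV 𝕜 ε) < 1},
    ENNReal.ofReal (defect X ^ (-kap 𝕜))

/-- The integral `η_d(ε)` with the exponent multiplied by `δ`, over the ball of radius `r`. -/
def etaReg (𝕜 : Type*) [RCLike 𝕜] [MeasureSpace 𝕜] (δ r ε : ℝ) : ℝ≥0∞ :=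
  ∫⁻ X in {X : Matrix (Fin 2) (Fin 2) 𝕜 |
      opNorm X < r ∧ opNorm ((diagV 𝕜 ε)⁻¹ * X * diagV 𝕜 ε) < 1},
    ENNReal.ofReal (defect X ^ (-(kap 𝕜 * δ)))

/-- The normalized integral with exponent multiplied by `δ`. Numerator and denominator can both be
infinite over the whole unit ball, so the quotient is taken over balls of radius `r → 1-0`. -/
def etaQuot (𝕜 : Type*) [RCLike 𝕜] [MeasureSpace 𝕜] (δ ε : ℝ) : ℝ≥0∞ :=
  limUnder (𝓝[<] (1 : ℝ)) fun r => etaReg 𝕜 δ r ε / etaReg 𝕜 δ r 1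

/-- The normalized function `η̃_d`, the limit of `etaQuot` as `δ → 1-0`. -/
def etaNorm (𝕜 : Type*) [RCLike 𝕜] [MeasureSpace 𝕜] (ε : ℝ) : ℝ≥0∞ :=
  limUnder (𝓝[<] (1 : ℝ)) fun δ => etaQuot 𝕜 δ ε

/-- Lebesgue measure `dλ(D₁) dλ(C)` on the affine space of the self-adjoint `ρ` with
`Tr₂ ρ = D`. -/
def fibreVol (D : Matrix (Fin 2) (Fin 2) 𝕜) : Measure (Mat4 𝕜) :=
  ((hermVol 𝕜).prod (volume : Measure (Matrix (Fin 2) (Fin 2) 𝕜))).map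
    fun p => Matrix.fromBlocks p.1 p.2 p.2ᴴ (D - p.1)

/-- The `√x` monotone-metric volume of `S ∩ {‖X‖ < r}` in the fibre over `D`, where
`X = D₁^{-1/2} C D₂^{-1/2}`; the power `-(3d/4 + 1/2)` of the factor `det (I - X X*)` of `det ρ` in
the volume form is multiplied by `δ`. For `δ = 1` this is the metric volume itself. -/
def volReg (δ r : ℝ) (D : Matrix (Fin 2) (Fin 2) 𝕜) (S : Set (Mat4 𝕜)) : ℝ≥0∞ :=
  ∫⁻ ρ in {ρ | ρ ∈ S ∧ opNorm (contr ρ) < r},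
    ENNReal.ofReal (volDensity Real.sqrt ρ * defect (contr ρ) ^ (kap 𝕜 * (1 - δ))) ∂(fibreVol D)

/-- The fraction of the regularized volume of the fibre over `D` which is occupied by the
separable states. -/
def sepFrac (δ r : ℝ) (D : Matrix (Fin 2) (Fin 2) 𝕜) : ℝ≥0∞ :=
  volReg δ r D (sepStates 𝕜 ∩ fibre D) / volReg δ r D (fibre D)

/-- The fraction for the exponent multiplied by `δ`, the limit of `sepFrac` as `r → 1-0`. -/
def sepQuot (δ : ℝ) (D : Matrix (Fin 2) (Fin 2) 𝕜) : ℝ≥0∞ :=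
  limUnder (𝓝[<] (1 : ℝ)) fun r => sepFrac δ r D

/-- The separability probability with fixed reduced state `D` for the `√x` monotone-metric volume,
with the same limiting normalization as in `etaNorm`. -/
def sepProb (D : Matrix (Fin 2) (Fin 2) 𝕜) : ℝ≥0∞ :=
  limUnder (𝓝[<] (1 : ℝ)) fun δ => sepQuot δ D

end Measures

end

end SqrtSep

/-! Geometry. Put D₂ = D - D₁ and C = D₁^{1/2} X D₂^{1/2}. A state of the fibre over D is then a
pair (D₁, X) with 0 < D₁ < D and ‖X‖ < 1. For f = √x the metric is Tr(A ρ^{-1/2} B ρ^{-1/2}), and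
its volume density is ½ (det ρ)^{-κ} (`volDensity_four`). Since det ρ = det D₁ det D₂ det(I - XX*)
and the substitution C ↦ X has Jacobian (det D₁ det D₂)^d, the regularized volume form splits into
(det D₁ det D₂)^{(d-2)/4} dD₁ and det(I - XX*)^{-κδ} dX, up to a constant (`volReg_eq_lintegral`).

The flipped matrix is positive iff ‖(V*)⁻¹ X V‖ < 1 with V = D₂^{1/2} D₁^{-1/2}. A singular value
decomposition of V and unitary invariance turn the X-integral into η_{d,δ,r}(σ(V))
(`lintegral_conjRegion`). With D₁ = ½ D^{1/2}(I + Y)D^{1/2}, the matrix V*V has the eigenvalues of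
(I - Y)(I + Y)⁻¹, and D survives only in a constant factor, which cancels. Hence the fraction at
level r is the ν-integral of η_{d,δ,r}(σ)/η_{d,δ,r}(1) (`sepFrac_eq_lintegral`), independent of D
even before any limit.

Limits. The quotients are at most 1 and ν is a probability measure, so dominated convergence reduces
everything to the pointwise limits of η_{d,δ,r}(ε)/η_{d,δ,r}(1). Conjugation by V_ε keeps the
determinant, so inside the unit ball the second norm bound becomes one inequality between `tilt` and
`defect`. In polar coordinates for the operator norm, η_{d,δ,r}(ε) is the integral over (0, r) of a
radial weight, singular like (1 - s)^{-κδ}, times an angular integral that converges as s → 1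
(`tendsto_angular`). If the weight has infinite mass, the quotient tends to the ratio of the
limiting angular integrals (`tendsto_weighted_average`); otherwise monotone convergence applies. As
κ > 1, the first case covers a left neighbourhood of δ = 1 and δ = 1 itself. The ratio is continuous
there, so the limit δ → 1 agrees with the value at δ = 1.

Two estimates carry the analysis: integrability of (1 - |det X|²)^{-κ} over the unit sphere of the
operator norm (`lintegral_coneMeasure_lt_top`), and finiteness of the unnormalized ν
(`nuRaw_univ_ne_top`). -/

set_option linter.unusedSectionVars false

namespace SqrtSep

/-! ### Singular values, defect and conjugation for 2 × 2 matrices -/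

section TwoByTwo

variable {𝕜 : Type*} [RCLike 𝕜]

/-- The squared Frobenius norm of a `2 × 2` matrix. -/
noncomputable def frobSq (X : Matrix (Fin 2) (Fin 2) 𝕜) : ℝ :=
  ‖X 0 0‖ ^ 2 + ‖X 0 1‖ ^ 2 + ‖X 1 0‖ ^ 2 + ‖X 1 1‖ ^ 2

theorem ofReal_normSq (z : 𝕜) : (((‖z‖ ^ 2 : ℝ)) : 𝕜) = z * star z := by
  have := RCLike.mul_conj z
  simp only [RCLike.star_def]
  rw [this]; push_cast; rfl

theorem trace_conjTranspose_mul_self (X : Matrix (Fin 2) (Fin 2) 𝕜) :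
    (Xᴴ * X).trace = (frobSq X : 𝕜) := by
  simp only [frobSq, RCLike.ofReal_add, ofReal_normSq, Matrix.trace_fin_two, Matrix.mul_apply,
    Fin.sum_univ_two, Matrix.conjTranspose_apply]
  ring

theorem det_conjTranspose_mul_self (X : Matrix (Fin 2) (Fin 2) 𝕜) :
    (Xᴴ * X).det = ((‖X.det‖ ^ 2 : ℝ) : 𝕜) := by
  rw [ofReal_normSq, Matrix.det_mul, Matrix.det_conjTranspose, mul_comm]

theorem det_one_sub_mul_conjTranspose (X : Matrix (Fin 2) (Fin 2) 𝕜) :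
    (1 - X * Xᴴ).det = ((1 - frobSq X + ‖X.det‖ ^ 2 : ℝ) : 𝕜) := by
  simp only [frobSq, RCLike.ofReal_add, RCLike.ofReal_sub, RCLike.ofReal_one, ofReal_normSq,
    Matrix.det_fin_two, Matrix.mul_apply, Fin.sum_univ_two, Matrix.conjTranspose_apply,
    Matrix.sub_apply, Matrix.one_apply, star_sub, star_mul']
  norm_num
  ring

theorem det_one_sub_conjTranspose_mul (X : Matrix (Fin 2) (Fin 2) 𝕜) :
    (1 - Xᴴ * X).det = ((1 - frobSq X + ‖X.det‖ ^ 2 : ℝ) : 𝕜) := by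
  simp only [frobSq, RCLike.ofReal_add, RCLike.ofReal_sub, RCLike.ofReal_one, ofReal_normSq,
    Matrix.det_fin_two, Matrix.mul_apply, Fin.sum_univ_two, Matrix.conjTranspose_apply,
    Matrix.sub_apply, Matrix.one_apply, star_sub, star_mul']
  norm_num
  ring

theorem defect_eq (X : Matrix (Fin 2) (Fin 2) 𝕜) :
    defect X = 1 - frobSq X + ‖X.det‖ ^ 2 := by
  rw [defect, det_one_sub_mul_conjTranspose, RCLike.ofReal_re]

open scoped Matrix.Norms.L2Operator in
theorem opNorm_eq_norm (X : Matrix (Fin 2) (Fin 2) 𝕜) : opNorm X = ‖X‖ :=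
  Matrix.l2_opNorm_toEuclideanCLM X

theorem IsHermitian.trace_eq_add {H : Matrix (Fin 2) (Fin 2) 𝕜} (hH : H.IsHermitian) :
    H.trace = ((hH.eigenvalues 0 + hH.eigenvalues 1 : ℝ) : 𝕜) := by
  rw [hH.trace_eq_sum_eigenvalues]; simp [Fin.sum_univ_two]

theorem IsHermitian.det_eq_mul {H : Matrix (Fin 2) (Fin 2) 𝕜} (hH : H.IsHermitian) :
    H.det = ((hH.eigenvalues 0 * hH.eigenvalues 1 : ℝ) : 𝕜) := by
  rw [hH.det_eq_prod_eigenvalues]; simp [Fin.prod_univ_two]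

open scoped Matrix.Norms.L2Operator in
theorem norm_eq_max_eigenvalues {H : Matrix (Fin 2) (Fin 2) 𝕜} (hH : H.IsHermitian) :
    ‖H‖ = max |hH.eigenvalues 0| |hH.eigenvalues 1| := by
  conv_lhs => rw [hH.spectral_theorem]
  rw [Unitary.conjStarAlgAut_apply, CStarRing.norm_mul_mem_unitary _ (by simp),
    CStarRing.norm_coe_unitary_mul, Matrix.l2_opNorm_diagonal]
  apply le_antisymm
  · rw [pi_norm_le_iff_of_nonneg (by positivity)]
    intro i; fin_cases i <;> simp
  · have h0 := norm_le_pi_norm ((fun x : ℝ => (x : 𝕜)) ∘ hH.eigenvalues) 0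
    have h1 := norm_le_pi_norm ((fun x : ℝ => (x : 𝕜)) ∘ hH.eigenvalues) 1
    simp only [Function.comp, RCLike.norm_ofReal] at h0 h1
    exact max_le h0 h1

/-- The squares of the two singular values. -/
theorem exists_singularValues (X : Matrix (Fin 2) (Fin 2) 𝕜) :
    ∃ l m : ℝ, 0 ≤ m ∧ m ≤ l ∧ opNorm X ^ 2 = l ∧ frobSq X = l + m ∧ ‖X.det‖ ^ 2 = l * m := by
  have hH := Matrix.isHermitian_conjTranspose_mul_self X
  have hn := (Matrix.posSemidef_conjTranspose_mul_self X).eigenvalues_nonneg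
  have ht := (trace_conjTranspose_mul_self X).symm.trans (IsHermitian.trace_eq_add hH)
  have hd := (det_conjTranspose_mul_self X).symm.trans (IsHermitian.det_eq_mul hH)
  have hN := norm_eq_max_eigenvalues hH
  rw [abs_of_nonneg (hn 0), abs_of_nonneg (hn 1), Matrix.l2_opNorm_conjTranspose_mul_self,
    ← sq, ← opNorm_eq_norm] at hN
  norm_cast at ht hd
  rcases le_total (hH.eigenvalues 0) (hH.eigenvalues 1) with h | h
  · rw [max_eq_right h] at hN
    exact ⟨_, _, hn 0, h, hN, by linarith, by linarith⟩
  · rw [max_eq_left h] at hN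
    exact ⟨_, _, hn 1, h, hN, ht, hd⟩

theorem opNorm_nonneg (X : Matrix (Fin 2) (Fin 2) 𝕜) : 0 ≤ opNorm X := norm_nonneg _

/-- With squared singular values l ≥ m the defect is (1 - l)(1 - m), which is also positive when
both exceed 1; l m < 1 excludes that case. The determinant is used because conjugation by `diagV`
preserves it. -/
theorem opNorm_lt_one_iff (X : Matrix (Fin 2) (Fin 2) 𝕜) :
    opNorm X < 1 ↔ ‖X.det‖ ^ 2 < 1 ∧ 0 < defect X := by
  obtain ⟨l, m, hm, hml, hl, hf, hd⟩ := exists_singularValues X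
  have h1 : opNorm X < 1 ↔ l < 1 := by
    rw [← hl, sq_lt_one_iff_abs_lt_one, abs_of_nonneg (opNorm_nonneg X)]
  rw [h1, defect_eq, hf, hd]
  constructor
  · intro h
    exact ⟨by nlinarith, by nlinarith⟩
  · rintro ⟨h2, h3⟩
    by_contra hc
    push Not at hc
    nlinarith

theorem opNorm_lt_one_iff_trace (X : Matrix (Fin 2) (Fin 2) 𝕜) :
    opNorm X < 1 ↔ frobSq X < 2 ∧ 0 < defect X := by
  obtain ⟨l, m, hm, hml, hl, hf, hd⟩ := exists_singularValues X
  have h1 : opNorm X < 1 ↔ l < 1 := by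
    rw [← hl, sq_lt_one_iff_abs_lt_one, abs_of_nonneg (opNorm_nonneg X)]
  rw [h1, defect_eq, hf, hd]
  constructor
  · intro h
    exact ⟨by nlinarith, by nlinarith⟩
  · rintro ⟨h2, h3⟩
    by_contra hc
    push Not at hc
    nlinarith

theorem frobSq_of_opNorm_eq_one {X : Matrix (Fin 2) (Fin 2) 𝕜} (h : opNorm X = 1) :
    frobSq X = 1 + ‖X.det‖ ^ 2 ∧ ‖X.det‖ ^ 2 ≤ 1 := by
  obtain ⟨l, m, hm, hml, hl, hf, hd⟩ := exists_singularValues X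
  rw [h] at hl
  rw [hf, hd]
  constructor <;> nlinarith

theorem frobSq_smul (s : ℝ) (X : Matrix (Fin 2) (Fin 2) 𝕜) : frobSq (s • X) = s ^ 2 * frobSq X := by
  simp only [frobSq, Matrix.smul_apply, norm_smul, Real.norm_eq_abs, mul_pow, sq_abs]; ring

theorem norm_det_smul (s : ℝ) (X : Matrix (Fin 2) (Fin 2) 𝕜) :
    ‖(s • X).det‖ ^ 2 = s ^ 4 * ‖X.det‖ ^ 2 := by
  have : (s • X).det = ((s ^ 2 : ℝ) : 𝕜) * X.det := by
    simp only [Matrix.det_fin_two, Matrix.smul_apply, RCLike.real_smul_eq_coe_mul]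
    push_cast; ring
  rw [this, norm_mul, RCLike.norm_ofReal, mul_pow, sq_abs]; ring

/-- On the unit sphere the squared singular values are 1 and |det X|², so the radial and the angular
singularity of the integrand separate. -/
theorem defect_smul {s : ℝ} {X : Matrix (Fin 2) (Fin 2) 𝕜} (h : opNorm X = 1) :
    defect (s • X) = (1 - s ^ 2) * (1 - s ^ 2 * ‖X.det‖ ^ 2) := by
  rw [defect_eq, frobSq_smul, norm_det_smul, (frobSq_of_opNorm_eq_one h).1]; ring

/-- The amount by which the defect changes under conjugation by `diagV ε`. -/
noncomputable def tilt (ε : ℝ) (X : Matrix (Fin 2) (Fin 2) 𝕜) : ℝ :=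
  (1 - ε ^ 2) * (‖X 1 0‖ ^ 2 / ε ^ 2 - ‖X 0 1‖ ^ 2)

theorem diagV_inv {ε : ℝ} (hε : ε ≠ 0) : (diagV 𝕜 ε)⁻¹ = diagV 𝕜 ε⁻¹ := by
  apply Matrix.inv_eq_right_inv
  have : (ε : 𝕜) ≠ 0 := by exact_mod_cast hε
  ext i j
  fin_cases i <;> fin_cases j <;> simp [diagV, Matrix.mul_apply, Fin.sum_univ_two, this]

theorem diagV_conj {ε : ℝ} (hε : ε ≠ 0) (X : Matrix (Fin 2) (Fin 2) 𝕜) :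
    (diagV 𝕜 ε)⁻¹ * X * diagV 𝕜 ε =
      !![X 0 0, (ε : 𝕜) * X 0 1; ((ε⁻¹ : ℝ) : 𝕜) * X 1 0, X 1 1] := by
  rw [diagV_inv hε]
  have : (ε : 𝕜) ≠ 0 := by exact_mod_cast hε
  ext i j
  fin_cases i <;> fin_cases j <;>
    simp [diagV, Matrix.mul_apply, Fin.sum_univ_two, Matrix.vecMul, Matrix.vecHead, Matrix.vecTail]
    <;> field_simp

theorem det_diagV_conj {ε : ℝ} (hε : ε ≠ 0) (X : Matrix (Fin 2) (Fin 2) 𝕜) :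
    ((diagV 𝕜 ε)⁻¹ * X * diagV 𝕜 ε).det = X.det := by
  have : (ε : 𝕜) ≠ 0 := by exact_mod_cast hε
  rw [diagV_conj hε]
  simp [Matrix.det_fin_two]
  field_simp

theorem defect_diagV_conj {ε : ℝ} (hε : ε ≠ 0) (X : Matrix (Fin 2) (Fin 2) 𝕜) :
    defect ((diagV 𝕜 ε)⁻¹ * X * diagV 𝕜 ε) = defect X - tilt ε X := by
  rw [defect_eq, det_diagV_conj hε, diagV_conj hε, defect_eq]
  simp only [frobSq, tilt, Matrix.of_apply, Matrix.cons_val', Matrix.cons_val_zero,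
    Matrix.cons_val_one, norm_mul, RCLike.norm_ofReal, mul_pow, sq_abs]
  field_simp
  ring

theorem tilt_one (X : Matrix (Fin 2) (Fin 2) 𝕜) : tilt 1 X = 0 := by simp [tilt]

theorem tilt_smul (ε s : ℝ) (X : Matrix (Fin 2) (Fin 2) 𝕜) : tilt ε (s • X) = s ^ 2 * tilt ε X := by
  simp only [tilt, Matrix.smul_apply, norm_smul, Real.norm_eq_abs, mul_pow, sq_abs]; ring

/-- In `opNorm_lt_one_iff` the determinant bound is inherited from X, and only the condition on the
defect remains. -/
theorem opNorm_diagV_conj_lt_one_iff {ε : ℝ} (hε : ε ≠ 0) {X : Matrix (Fin 2) (Fin 2) 𝕜}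
    (hX : opNorm X < 1) :
    opNorm ((diagV 𝕜 ε)⁻¹ * X * diagV 𝕜 ε) < 1 ↔ tilt ε X < defect X := by
  rw [opNorm_lt_one_iff, det_diagV_conj hε, defect_diagV_conj hε, sub_pos]
  exact ⟨fun h => h.2, fun h => ⟨((opNorm_lt_one_iff X).1 hX).1, h⟩⟩

theorem posDef_iff_trace_det {H : Matrix (Fin 2) (Fin 2) 𝕜} :
    H.PosDef ↔ H.IsHermitian ∧ 0 < RCLike.re H.trace ∧ 0 < RCLike.re H.det := by
  constructor
  · intro h
    refine ⟨h.1, ?_, ?_⟩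
    · rw [IsHermitian.trace_eq_add h.1, RCLike.ofReal_re]
      exact add_pos (h.eigenvalues_pos 0) (h.eigenvalues_pos 1)
    · rw [IsHermitian.det_eq_mul h.1, RCLike.ofReal_re]
      exact mul_pos (h.eigenvalues_pos 0) (h.eigenvalues_pos 1)
  · rintro ⟨hH, h1, h2⟩
    rw [IsHermitian.trace_eq_add hH, RCLike.ofReal_re] at h1
    rw [IsHermitian.det_eq_mul hH, RCLike.ofReal_re] at h2
    rw [hH.posDef_iff_eigenvalues_pos]
    have h3 : 0 < hH.eigenvalues 0 ∧ 0 < hH.eigenvalues 1 := by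
      rcases pos_and_pos_or_neg_and_neg_of_mul_pos h2 with h | h
      · exact h
      · linarith [h.1, h.2]
    intro i; fin_cases i
    · exact h3.1
    · exact h3.2

theorem opNorm_lt_one_iff_posDef (X : Matrix (Fin 2) (Fin 2) 𝕜) :
    opNorm X < 1 ↔ (1 - Xᴴ * X).PosDef := by
  rw [opNorm_lt_one_iff_trace, posDef_iff_trace_det, det_one_sub_conjTranspose_mul,
    Matrix.trace_sub, trace_conjTranspose_mul_self, Matrix.trace_one, defect_eq, RCLike.ofReal_re]
  simp only [Fintype.card_fin, Nat.cast_ofNat, map_sub, RCLike.ofReal_re, sub_pos]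
  have h2 : RCLike.re (2 : 𝕜) = 2 := RCLike.ofNat_re 2
  rw [h2]
  constructor
  · rintro ⟨a, b⟩
    exact ⟨Matrix.isHermitian_one.sub (Matrix.isHermitian_conjTranspose_mul_self X), a, b⟩
  · rintro ⟨-, a, b⟩
    exact ⟨a, b⟩

/-- Trace and determinant of A*A fix the unordered pair of its eigenvalues, and the ratio is
symmetric in the pair. -/
theorem svRatio_eq_of_trace_det {A B : Matrix (Fin 2) (Fin 2) 𝕜}
    (ht : (Aᴴ * A).trace = (Bᴴ * B).trace) (hd : (Aᴴ * A).det = (Bᴴ * B).det) :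
    svRatio A = svRatio B := by
  have hA := Matrix.isHermitian_conjTranspose_mul_self A
  have hB := Matrix.isHermitian_conjTranspose_mul_self B
  rw [IsHermitian.trace_eq_add hA, IsHermitian.trace_eq_add hB] at ht
  rw [IsHermitian.det_eq_mul hA, IsHermitian.det_eq_mul hB] at hd
  norm_cast at ht hd
  have h : (hA.eigenvalues 0 - hB.eigenvalues 0) * (hA.eigenvalues 0 - hB.eigenvalues 1) = 0 := by
    have : hA.eigenvalues 1 = hB.eigenvalues 0 + hB.eigenvalues 1 - hA.eigenvalues 0 := by linarith
    rw [this] at hd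
    linarith
  rcases mul_eq_zero.1 h with h | h
  · have h0 : hA.eigenvalues 0 = hB.eigenvalues 0 := by linarith
    have h1 : hA.eigenvalues 1 = hB.eigenvalues 1 := by linarith
    simp only [svRatio, h0, h1]
  · have h0 : hA.eigenvalues 0 = hB.eigenvalues 1 := by linarith
    have h1 : hA.eigenvalues 1 = hB.eigenvalues 0 := by linarith
    simp only [svRatio, h0, h1, min_comm, max_comm]

/-- The roots of the characteristic polynomial of A*A; the explicit form serves to prove
measurability of σ. -/
theorem svRatio_eq_formula (A : Matrix (Fin 2) (Fin 2) 𝕜) :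
    svRatio A = √((frobSq A - √(frobSq A ^ 2 - 4 * ‖A.det‖ ^ 2)) / 2) /
      √((frobSq A + √(frobSq A ^ 2 - 4 * ‖A.det‖ ^ 2)) / 2) := by
  have hA := Matrix.isHermitian_conjTranspose_mul_self A
  have ht := (trace_conjTranspose_mul_self A).symm.trans (IsHermitian.trace_eq_add hA)
  have hd := (det_conjTranspose_mul_self A).symm.trans (IsHermitian.det_eq_mul hA)
  norm_cast at ht hd
  have hs : √(frobSq A ^ 2 - 4 * ‖A.det‖ ^ 2) = |hA.eigenvalues 0 - hA.eigenvalues 1| := by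
    rw [ht, hd, ← Real.sqrt_sq_eq_abs]; congr 1; ring
  rw [hs, ht, svRatio]
  rcases le_total (hA.eigenvalues 0) (hA.eigenvalues 1) with h | h
  · rw [abs_of_nonpos (by linarith)]
    simp only [min_eq_left h, max_eq_right h]
    congr 2 <;> ring
  · rw [abs_of_nonneg (by linarith)]
    simp only [min_eq_right h, max_eq_left h]
    congr 2 <;> ring

end TwoByTwo

/-! ### Polar coordinates for an arbitrary norm -/

section Polar

variable {E : Type*} [NormedAddCommGroup E] [NormedSpace ℝ E] [FiniteDimensional ℝ E]
  [Nontrivial E] [MeasurableSpace E] [BorelSpace E]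

/-- The norm is left arbitrary, since both the operator norm and the sup norm of pairs are used
below; `toSphere` is the cone measure of the given norm. -/
theorem lintegral_polar (μ : Measure E) [μ.IsAddHaarMeasure] {f : E → ℝ≥0∞} (hf : Measurable f) :
    ∫⁻ x, f x ∂μ = ∫⁻ s in Set.Ioi (0 : ℝ),
      ENNReal.ofReal (s ^ (Module.finrank ℝ E - 1)) *
        ∫⁻ ω, f (s • (ω : E)) ∂μ.toSphere := by
  have h1 : ∫⁻ x, f x ∂μ = ∫⁻ x : ({(0)}ᶜ : Set E), f x ∂(μ.comap (↑)) := by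
    rw [lintegral_subtype_comap (measurableSet_singleton _).compl f, restrict_compl_singleton]
  have h2 := (μ.measurePreserving_homeomorphUnitSphereProd.symm
    (homeomorphUnitSphereProd E).toMeasurableEquiv).lintegral_comp
      (f := fun x : ({(0)}ᶜ : Set E) => f x) (hf.comp measurable_subtype_coe)
  have hm : Measurable fun p : Metric.sphere (0 : E) 1 × Set.Ioi (0 : ℝ) =>
      f ((p.2 : ℝ) • (p.1 : E)) := by
    apply hf.comp; fun_prop
  have hm2 : Measurable fun s : ℝ => ∫⁻ ω, f (s • (ω : E)) ∂μ.toSphere := by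
    apply Measurable.lintegral_prod_right' (f := fun p : ℝ × Metric.sphere (0 : E) 1 =>
      f (p.1 • (p.2 : E)))
    apply hf.comp; fun_prop
  rw [h1, ← h2]
  have h3 : ∀ p : Metric.sphere (0 : E) 1 × Set.Ioi (0 : ℝ),
      f (((homeomorphUnitSphereProd E).toMeasurableEquiv.symm p : ({(0)}ᶜ : Set E)) : E)
        = f ((p.2 : ℝ) • (p.1 : E)) := fun p => rfl
  simp_rw [h3]
  rw [lintegral_prod_symm _ hm.aemeasurable, Measure.volumeIoiPow]
  refine (lintegral_withDensity_eq_lintegral_mul _ (by fun_prop)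
    (hm2.comp measurable_subtype_coe)).trans ?_
  simp only [Pi.mul_apply, Function.comp]
  rw [lintegral_subtype_comap measurableSet_Ioi (fun s : ℝ =>
    ENNReal.ofReal (s ^ (Module.finrank ℝ E - 1)) * ∫⁻ ω, f (s • (ω : E)) ∂μ.toSphere)]

theorem setLIntegral_ball_norm (μ : Measure E) [μ.IsAddHaarMeasure] {g : ℝ → ℝ≥0∞}
    (hg : Measurable g) (R : ℝ) :
    ∫⁻ x in Metric.ball (0 : E) R, g ‖x‖ ∂μ = μ.toSphere Set.univ *
      ∫⁻ s in Set.Ioo (0 : ℝ) R, ENNReal.ofReal (s ^ (Module.finrank ℝ E - 1)) * g s := by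
  have hm : Measurable ((Set.Iio R).indicator g) := hg.indicator measurableSet_Iio
  have h1 : ∫⁻ x in Metric.ball (0 : E) R, g ‖x‖ ∂μ = ∫⁻ x, (Set.Iio R).indicator g ‖x‖ ∂μ := by
    rw [← lintegral_indicator measurableSet_ball]
    apply lintegral_congr; intro x; simp [Set.indicator]
  rw [h1, lintegral_polar μ (f := fun x => (Set.Iio R).indicator g ‖x‖)
      (hm.comp measurable_norm), ← lintegral_const_mul _ (by fun_prop),
    ← lintegral_indicator measurableSet_Ioi, ← lintegral_indicator measurableSet_Ioo]
  apply lintegral_congr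
  intro s
  by_cases hs : 0 < s
  · by_cases hr : s < R
    · simp [hs, hr, norm_smul, abs_of_pos hs]
      ring
    · simp [hs, hr, norm_smul, abs_of_pos hs]
  · simp [hs]

theorem setLIntegral_ball_norm_lt_top (μ : Measure E) [μ.IsAddHaarMeasure] {g : ℝ → ℝ≥0∞}
    (hg : Measurable g) (R : ℝ)
    (h : ∫⁻ s in Set.Ioo (0 : ℝ) R, ENNReal.ofReal (s ^ (Module.finrank ℝ E - 1)) * g s < ∞) :
    ∫⁻ x in Metric.ball (0 : E) R, g ‖x‖ ∂μ < ∞ := by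
  rw [setLIntegral_ball_norm μ hg R]
  exact ENNReal.mul_lt_top (measure_lt_top _ _) h

end Polar

/-! ### Averages against a weight of infinite mass -/

section Cesaro

theorem tendsto_setLIntegral_Ioo (w : ℝ → ℝ≥0∞) :
    Tendsto (fun r => ∫⁻ s in Set.Ioo 0 r, w s) (𝓝[<] 1) (𝓝 (∫⁻ s in Set.Ioo (0 : ℝ) 1, w s)) := by
  set G : ℝ → ℝ≥0∞ := fun r => ∫⁻ s in Set.Ioo 0 r, w s with hG
  have hGmono : Monotone G := fun a b hab =>
    lintegral_mono_set (Set.Ioo_subset_Ioo_right hab)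
  have h1 : Tendsto (fun n : ℕ => G (1 - 1 / ((n : ℝ) + 1))) atTop (𝓝 (G 1)) := by
    have hU : (⋃ n : ℕ, Set.Ioo (0 : ℝ) (1 - 1 / ((n : ℝ) + 1))) = Set.Ioo 0 1 := by
      ext s
      simp only [Set.mem_iUnion, Set.mem_Ioo]
      constructor
      · rintro ⟨n, h, h'⟩
        have : (0 : ℝ) < 1 / ((n : ℝ) + 1) := by positivity
        exact ⟨h, by linarith⟩
      · rintro ⟨h, h'⟩
        obtain ⟨n, hn⟩ := exists_nat_one_div_lt (sub_pos.2 h')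
        exact ⟨n, h, by linarith⟩
    have hmono : Monotone fun n : ℕ => Set.Ioo (0 : ℝ) (1 - 1 / ((n : ℝ) + 1)) := by
      intro a b hab
      apply Set.Ioo_subset_Ioo_right
      have : 1 / ((b : ℝ) + 1) ≤ 1 / ((a : ℝ) + 1) := by
        apply one_div_le_one_div_of_le (by positivity)
        have : (a : ℝ) ≤ b := by exact_mod_cast hab
        linarith
      linarith
    have h2 := setLIntegral_iUnion_of_directed (μ := volume) w (directed_of_isDirected_le hmono)
    rw [hU] at h2
    rw [hG]; dsimp only
    rw [h2]
    exact tendsto_atTop_iSup fun a b hab => lintegral_mono_set (hmono hab)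
  rw [tendsto_order]
  constructor
  · intro x hx
    obtain ⟨n, hn⟩ := (h1.eventually (lt_mem_nhds hx)).exists
    have : (0 : ℝ) < 1 / ((n : ℝ) + 1) := by positivity
    filter_upwards [Ioo_mem_nhdsLT (show 1 - 1 / ((n : ℝ) + 1) < 1 by linarith)] with r hr
    exact hn.trans_le (hGmono hr.1.le)
  · intro x hx
    filter_upwards [self_mem_nhdsWithin] with r hr
    exact (hGmono (le_of_lt hr)).trans_lt hx

/-- The piece (0, s0] contributes a bounded amount and disappears after division by the mass G r →
∞, while beyond s0 the function φ is already close to l. The two one-sided estimates are separate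
because subtraction in ℝ≥0∞ is truncated. -/
theorem tendsto_weighted_average {w φ : ℝ → ℝ≥0∞} (hw : Measurable w)
    (hfin : ∀ r < 1, ∫⁻ s in Set.Ioo 0 r, w s ≠ ∞) (hinf : ∫⁻ s in Set.Ioo (0 : ℝ) 1, w s = ∞)
    {M : ℝ≥0∞} (hM : M ≠ ∞) (hφM : ∀ s ∈ Set.Ioo (0 : ℝ) 1, φ s ≤ M) {l : ℝ≥0∞} (hl : Tendsto φ (𝓝[<] 1) (𝓝 l)) :
    Tendsto (fun r => (∫⁻ s in Set.Ioo 0 r, w s * φ s) / ∫⁻ s in Set.Ioo 0 r, w s)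
      (𝓝[<] 1) (𝓝 l) := by
  set G : ℝ → ℝ≥0∞ := fun r => ∫⁻ s in Set.Ioo 0 r, w s with hG
  have hGtop : Tendsto G (𝓝[<] 1) (𝓝 ∞) := hinf ▸ tendsto_setLIntegral_Ioo w
  have hinv : Tendsto (fun r => (G r)⁻¹) (𝓝[<] 1) (𝓝 0) := by
    simpa [Function.comp_def] using ((continuous_inv (G := ℝ≥0∞)).tendsto ∞).comp hGtop
  have hGpos : ∀ᶠ r in 𝓝[<] 1, G r ≠ 0 :=
    (hGtop.eventually (lt_mem_nhds ENNReal.zero_lt_top)).mono fun r h => h.ne'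
  have hGfin : ∀ᶠ r in 𝓝[<] (1 : ℝ), G r ≠ ∞ :=
    eventually_nhdsWithin_of_forall fun r hr => hfin r hr
  have split : ∀ s0 r : ℝ, 0 < s0 → s0 < r → ∀ h : ℝ → ℝ≥0∞, ∫⁻ s in Set.Ioo 0 r, h s =
      (∫⁻ s in Set.Ioc 0 s0, h s) + ∫⁻ s in Set.Ioo s0 r, h s := by
    intro s0 r h0 hr h
    rw [← lintegral_union measurableSet_Ioo (Set.disjoint_left.2 fun x hx hx' => by
      exact absurd hx.2 (not_le.2 hx'.1)), Set.Ioc_union_Ioo_eq_Ioo h0.le hr]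
  have hIoc : ∀ s0 : ℝ, s0 < 1 → ∫⁻ s in Set.Ioc 0 s0, w s ≠ ∞ := by
    intro s0 h
    refine ne_top_of_le_ne_top (hfin ((s0 + 1) / 2) (by linarith)) (lintegral_mono_set ?_)
    intro x hx
    exact ⟨hx.1, by linarith [hx.2]⟩
  rw [tendsto_order]
  constructor
  · intro a ha
    obtain ⟨c, hac, hcl⟩ := exists_between ha
    have hc : c ≠ ∞ := hcl.ne_top
    obtain ⟨s1, hs1, hs1'⟩ := mem_nhdsLT_iff_exists_Ioo_subset.1 (hl.eventually (lt_mem_nhds hcl))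
    -- The maximum with 1/2 keeps the cut strictly positive when s1 is not.
    set s0 := max s1 (1 / 2) with hs0
    have hs01 : s0 < 1 := max_lt hs1 (by norm_num)
    have h0 : 0 < s0 := lt_of_lt_of_le (by norm_num) (le_max_right _ _)
    set K := ∫⁻ s in Set.Ioc 0 s0, w s with hK
    -- Comes from c * G r ≤ c * K + ∫ w φ, divided by G r.
    have hlim : Tendsto (fun r => c - c * K * (G r)⁻¹) (𝓝[<] 1) (𝓝 (c - c * K * 0)) :=
      ENNReal.Tendsto.sub tendsto_const_nhds
        (ENNReal.Tendsto.const_mul hinv (Or.inr (ENNReal.mul_ne_top hc (hIoc s0 hs01))))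
        (Or.inl hc)
    rw [mul_zero, tsub_zero] at hlim
    filter_upwards [hlim.eventually (lt_mem_nhds hac), Ioo_mem_nhdsLT hs01, hGpos, hGfin] with
      r hr hr2 hp hf
    refine hr.trans_le ?_
    have e1 : G r = K + ∫⁻ s in Set.Ioo s0 r, w s := split s0 r h0 hr2.1 w
    have e2 : c * ∫⁻ s in Set.Ioo s0 r, w s ≤ ∫⁻ s in Set.Ioo 0 r, w s * φ s := by
      rw [split s0 r h0 hr2.1, ← lintegral_const_mul _ hw]
      refine le_trans (setLIntegral_mono_ae' measurableSet_Ioo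
        (ae_of_all _ fun s hs => ?_)) le_add_self
      rw [mul_comm]
      refine mul_le_mul_right (le_of_lt (hs1' ⟨lt_of_le_of_lt (le_max_left _ _) hs.1,
        hs.2.trans hr2.2⟩)) _
    rw [tsub_le_iff_right, ENNReal.div_eq_inv_mul, mul_comm (c * K), ← mul_add]
    calc c = (G r)⁻¹ * (c * G r) := by
          rw [mul_comm c, ← mul_assoc, ENNReal.inv_mul_cancel hp hf, one_mul]
      _ ≤ _ := by
          refine mul_le_mul_right ?_ _
          rw [e1, mul_add, add_comm]
          exact add_le_add e2 le_rfl
  · intro b hb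
    obtain ⟨c, hlc, hcb⟩ := exists_between hb
    have hc : c ≠ ∞ := hcb.ne_top
    obtain ⟨s1, hs1, hs1'⟩ := mem_nhdsLT_iff_exists_Ioo_subset.1 (hl.eventually (gt_mem_nhds hlc))
    set s0 := max s1 (1 / 2) with hs0
    have hs01 : s0 < 1 := max_lt hs1 (by norm_num)
    have h0 : 0 < s0 := lt_of_lt_of_le (by norm_num) (le_max_right _ _)
    set K := ∫⁻ s in Set.Ioc 0 s0, w s with hK
    -- The initial piece costs at most M * K, the rest at most c * G r.
    have hlim : Tendsto (fun r => c + M * K * (G r)⁻¹) (𝓝[<] 1) (𝓝 (c + M * K * 0)) :=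
      tendsto_const_nhds.add
        (ENNReal.Tendsto.const_mul hinv (Or.inr (ENNReal.mul_ne_top hM (hIoc s0 hs01))))
    rw [mul_zero, add_zero] at hlim
    filter_upwards [hlim.eventually (gt_mem_nhds hcb), Ioo_mem_nhdsLT hs01, hGpos, hGfin] with
      r hr hr2 hp hf
    refine lt_of_le_of_lt ?_ hr
    have e1 : G r = K + ∫⁻ s in Set.Ioo s0 r, w s := split s0 r h0 hr2.1 w
    have e2 : ∫⁻ s in Set.Ioo 0 r, w s * φ s ≤ M * K + c * G r := by
      rw [split s0 r h0 hr2.1, hK, ← lintegral_const_mul _ hw]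
      refine add_le_add (setLIntegral_mono_ae' measurableSet_Ioc (ae_of_all _ fun s hs => ?_)) ?_
      · rw [mul_comm]; exact mul_le_mul_left (hφM s ⟨hs.1, hs.2.trans_lt hs01⟩) _
      · refine le_trans ?_ (mul_le_mul_right (e1 ▸ le_add_self : _ ≤ G r) c)
        rw [← lintegral_const_mul _ hw]
        refine setLIntegral_mono_ae' measurableSet_Ioo (ae_of_all _ fun s hs => ?_)
        rw [mul_comm]
        refine mul_le_mul_left (le_of_lt (hs1' ⟨lt_of_le_of_lt (le_max_left _ _) hs.1,
          hs.2.trans hr2.2⟩)) _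
    calc _ ≤ (M * K + c * G r) / G r := ENNReal.div_le_div_right e2 _
      _ = c + M * K * (G r)⁻¹ := by
          rw [ENNReal.div_eq_inv_mul, mul_add, mul_comm _ (c * G r), mul_assoc c,
            ENNReal.mul_inv_cancel hp hf, mul_one, add_comm, mul_comm (G r)⁻¹]

end Cesaro

/-! ### Lebesgue measure on matrices as a Haar measure -/

section MatrixMeasure

variable {𝕜 : Type*} [RCLike 𝕜] [MeasureSpace 𝕜]

instance matrixBorelSpace {m n : Type*} [Fintype m] [Fintype n] [BorelSpace 𝕜] :
    BorelSpace (Matrix m n 𝕜) :=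
  inferInstanceAs (BorelSpace (m → n → 𝕜))

variable [(volume : Measure 𝕜).IsAddHaarMeasure]

instance vectorVolumeIsAddHaar {n : Type*} [Fintype n] [BorelSpace 𝕜] :
    (volume : Measure (n → 𝕜)).IsAddHaarMeasure :=
  Measure.pi.isAddHaarMeasure _

instance matrixVolumeIsAddHaar {m n : Type*} [Fintype m] [Fintype n] [BorelSpace 𝕜] :
    (volume : Measure (Matrix m n 𝕜)).IsAddHaarMeasure :=
  Measure.pi.isAddHaarMeasure (fun _ : m => (volume : Measure (n → 𝕜)))

instance matrixVolumeSigmaFinite {m n : Type*} [Fintype m] [Fintype n] [BorelSpace 𝕜] :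
    SigmaFinite (volume : Measure (Matrix m n 𝕜)) :=
  Measure.pi.sigmaFinite (fun _ : m => (volume : Measure (n → 𝕜)))

end MatrixMeasure

/-! ### Polar coordinates for the operator norm -/

section OpPolar

variable (𝕜 : Type*) [RCLike 𝕜]

open scoped Matrix.Norms.L2Operator in
/-- The operator norm makes the `2 × 2` matrices a real normed space. -/
@[reducible]
noncomputable def opNormedSpace : NormedSpace ℝ (Matrix (Fin 2) (Fin 2) 𝕜) where
  norm_smul_le c X := by
    have h : c • X = (c : 𝕜) • X := by
      ext i j; simp [RCLike.real_smul_eq_coe_mul]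
    rw [h, norm_smul, RCLike.norm_ofReal, Real.norm_eq_abs]

variable {𝕜}

open scoped Matrix.Norms.L2Operator in
theorem continuous_opNorm : Continuous (opNorm : Matrix (Fin 2) (Fin 2) 𝕜 → ℝ) := by
  have : (opNorm : Matrix (Fin 2) (Fin 2) 𝕜 → ℝ) = fun X => ‖X‖ := funext opNorm_eq_norm
  rw [this]
  exact continuous_norm

variable [MeasureSpace 𝕜] [BorelSpace 𝕜]

variable (𝕜) in
open scoped Matrix.Norms.L2Operator in
/-- The cone measure on the unit sphere of the operator norm, as a measure on all matrices. -/
noncomputable def coneMeasure : Measure (Matrix (Fin 2) (Fin 2) 𝕜) :=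
  letI := opNormedSpace 𝕜
  ((volume : Measure (Matrix (Fin 2) (Fin 2) 𝕜)).toSphere).map Subtype.val

open scoped Matrix.Norms.L2Operator in
theorem ae_coneMeasure : ∀ᵐ X ∂coneMeasure 𝕜, opNorm X = 1 := by
  let := opNormedSpace 𝕜
  rw [coneMeasure, ae_map_iff measurable_subtype_coe.aemeasurable
    (measurableSet_eq_fun continuous_opNorm.measurable measurable_const)]
  refine ae_of_all _ fun ω => ?_
  rw [opNorm_eq_norm]
  exact mem_sphere_zero_iff_norm.1 ω.2

variable [(volume : Measure 𝕜).IsAddHaarMeasure]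

open scoped Matrix.Norms.L2Operator in
theorem coneMeasure_univ_ne_zero : coneMeasure 𝕜 Set.univ ≠ 0 := by
  let := opNormedSpace 𝕜
  rw [coneMeasure, Measure.map_apply measurable_subtype_coe MeasurableSet.univ, Set.preimage_univ,
    Measure.measure_univ_ne_zero]
  exact Measure.toSphere_ne_zero _

open scoped Matrix.Norms.L2Operator in
theorem lintegral_eq_coneMeasure {f : Matrix (Fin 2) (Fin 2) 𝕜 → ℝ≥0∞} (hf : Measurable f) :
    ∫⁻ X, f X = ∫⁻ s in Set.Ioi (0 : ℝ),
      ENNReal.ofReal (s ^ (Module.finrank ℝ (Matrix (Fin 2) (Fin 2) 𝕜) - 1)) *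
        ∫⁻ X, f (s • X) ∂coneMeasure 𝕜 := by
  let := opNormedSpace 𝕜
  rw [lintegral_polar volume hf, coneMeasure]
  congr 1
  ext s
  rw [lintegral_map (by fun_prop) measurable_subtype_coe]

end OpPolar

/-! ### Radial and angular parts of the η-integrals -/

section EtaLimit

variable {𝕜 : Type*} [RCLike 𝕜]

theorem dimK_pos : 0 < dimK 𝕜 := by
  rw [dimK]; exact_mod_cast Module.finrank_pos

theorem kap_pos : 0 < kap 𝕜 := by
  have := dimK_pos (𝕜 := 𝕜); unfold kap; linarith

theorem one_le_dimK : 1 ≤ dimK 𝕜 := by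
  rw [dimK]; exact_mod_cast Module.finrank_pos

theorem one_lt_kap : 1 < kap 𝕜 := by
  have := one_le_dimK (𝕜 := 𝕜); unfold kap; linarith

theorem opNorm_smul (s : ℝ) (X : Matrix (Fin 2) (Fin 2) 𝕜) : opNorm (s • X) = |s| * opNorm X := by
  have h : s • X = (s : 𝕜) • X := by
    ext i j; simp [RCLike.real_smul_eq_coe_mul]
  rw [opNorm, opNorm, h, map_smul, norm_smul, RCLike.norm_ofReal]

theorem continuous_frobSq : Continuous (frobSq : Matrix (Fin 2) (Fin 2) 𝕜 → ℝ) := by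
  unfold frobSq; fun_prop

theorem continuous_norm_det_sq :
    Continuous fun X : Matrix (Fin 2) (Fin 2) 𝕜 => ‖X.det‖ ^ 2 := by fun_prop

theorem continuous_defect : Continuous (defect : Matrix (Fin 2) (Fin 2) 𝕜 → ℝ) := by
  have : (defect : Matrix (Fin 2) (Fin 2) 𝕜 → ℝ) = fun X => 1 - frobSq X + ‖X.det‖ ^ 2 :=
    funext defect_eq
  rw [this]
  exact (continuous_const.sub continuous_frobSq).add continuous_norm_det_sq

variable [MeasureSpace 𝕜] [BorelSpace 𝕜]

theorem measurable_tilt :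
    Measurable fun p : ℝ × Matrix (Fin 2) (Fin 2) 𝕜 => tilt p.1 p.2 := by
  unfold tilt
  have h (i j : Fin 2) : Measurable fun p : ℝ × Matrix (Fin 2) (Fin 2) 𝕜 => ‖p.2 i j‖ ^ 2 :=
    Continuous.measurable (by fun_prop)
  exact (measurable_const.sub (measurable_fst.pow_const 2)).mul
    (((h 1 0).div (measurable_fst.pow_const 2)).sub (h 0 1))

theorem measurable_defect_rpow (a : ℝ) :
    Measurable fun X : Matrix (Fin 2) (Fin 2) 𝕜 => ENNReal.ofReal (defect X ^ a) :=
  (continuous_defect.measurable.pow_const a).ennreal_ofReal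

/-- The region of integration of `etaReg`. -/
def etaRegion (𝕜 : Type*) [RCLike 𝕜] (r ε : ℝ) : Set (Matrix (Fin 2) (Fin 2) 𝕜) :=
  {X | opNorm X < r ∧ tilt ε X < defect X}

theorem etaReg_eq {δ r ε : ℝ} (hr : r ≤ 1) (hε : ε ≠ 0) :
    etaReg 𝕜 δ r ε = ∫⁻ X in etaRegion 𝕜 r ε, ENNReal.ofReal (defect X ^ (-(kap 𝕜 * δ))) := by
  unfold etaReg etaRegion
  congr 2
  ext X
  simp only [Set.mem_ofPred_eq]
  exact and_congr_right fun h => opNorm_diagV_conj_lt_one_iff hε (h.trans_le hr)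

theorem measurableSet_etaRegion_prod (r : ℝ) :
    MeasurableSet {p : ℝ × Matrix (Fin 2) (Fin 2) 𝕜 | p.2 ∈ etaRegion 𝕜 r p.1} :=
  (measurableSet_lt (continuous_opNorm.measurable.comp measurable_snd) measurable_const).inter
    (measurableSet_lt measurable_tilt (continuous_defect.measurable.comp measurable_snd))

theorem measurableSet_etaRegion (r ε : ℝ) : MeasurableSet (etaRegion 𝕜 r ε) :=
  measurable_prodMk_left (measurableSet_etaRegion_prod r)

variable [(volume : Measure 𝕜).IsAddHaarMeasure]

/-- `etaReg` agrees on the positive half line with a measurable function. -/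
theorem exists_measurable_etaReg (δ : ℝ) {r : ℝ} (hr : r ≤ 1) :
    ∃ F : ℝ → ℝ≥0∞, Measurable F ∧ ∀ ε, 0 < ε → etaReg 𝕜 δ r ε = F ε := by
  refine ⟨fun ε => ∫⁻ X, {p : ℝ × Matrix (Fin 2) (Fin 2) 𝕜 | p.2 ∈ etaRegion 𝕜 r p.1}.indicator
    (fun p => ENNReal.ofReal (defect p.2 ^ (-(kap 𝕜 * δ)))) (ε, X), ?_, ?_⟩
  · apply Measurable.lintegral_prod_right'
    exact ((measurable_defect_rpow _).comp measurable_snd).indicator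
      (measurableSet_etaRegion_prod r)
  · intro ε hε
    rw [etaReg_eq hr hε.ne', ← lintegral_indicator (measurableSet_etaRegion r ε)]
    rfl

/-- The radial weight in polar coordinates for the operator norm. -/
noncomputable def radialWeight (𝕜 : Type*) [RCLike 𝕜] (a s : ℝ) : ℝ≥0∞ :=
  ENNReal.ofReal (s ^ (Module.finrank ℝ (Matrix (Fin 2) (Fin 2) 𝕜) - 1)) *
    ENNReal.ofReal (1 - s ^ 2) ^ (-a)

/-- The angular integral in polar coordinates for the operator norm. -/
noncomputable def angular (𝕜 : Type*) [RCLike 𝕜] [MeasureSpace 𝕜] [BorelSpace 𝕜]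
    (a ε s : ℝ) : ℝ≥0∞ :=
  ∫⁻ X, {X : Matrix (Fin 2) (Fin 2) 𝕜 |
      s ^ 2 * tilt ε X < (1 - s ^ 2) * (1 - s ^ 2 * ‖X.det‖ ^ 2)}.indicator
    (fun X => ENNReal.ofReal (1 - s ^ 2 * ‖X.det‖ ^ 2) ^ (-a)) X ∂coneMeasure 𝕜

/-- The limit of `angular` on the unit sphere. -/
noncomputable def angularLim (𝕜 : Type*) [RCLike 𝕜] [MeasureSpace 𝕜] [BorelSpace 𝕜]
    (a ε : ℝ) : ℝ≥0∞ :=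
  ∫⁻ X, {X : Matrix (Fin 2) (Fin 2) 𝕜 | tilt ε X ≤ 0}.indicator
    (fun X => ENNReal.ofReal (1 - ‖X.det‖ ^ 2) ^ (-a)) X ∂coneMeasure 𝕜

theorem measurable_radialWeight (a : ℝ) : Measurable (radialWeight 𝕜 a) := by
  unfold radialWeight; fun_prop

theorem measurable_tilt_right (ε : ℝ) :
    Measurable fun X : Matrix (Fin 2) (Fin 2) 𝕜 => tilt ε X :=
  measurable_tilt.comp measurable_prodMk_left

theorem measurable_angular (a ε s : ℝ) : Measurable ({X : Matrix (Fin 2) (Fin 2) 𝕜 |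
      s ^ 2 * tilt ε X < (1 - s ^ 2) * (1 - s ^ 2 * ‖X.det‖ ^ 2)}.indicator
    (fun X => ENNReal.ofReal (1 - s ^ 2 * ‖X.det‖ ^ 2) ^ (-a))) := by
  have hmd : Measurable fun X : Matrix (Fin 2) (Fin 2) 𝕜 => ‖X.det‖ ^ 2 :=
    continuous_norm_det_sq.measurable
  have h1 : Measurable fun X : Matrix (Fin 2) (Fin 2) 𝕜 => 1 - s ^ 2 * ‖X.det‖ ^ 2 :=
    measurable_const.sub (hmd.const_mul _)
  exact (h1.ennreal_ofReal.pow_const _).indicator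
    (measurableSet_lt ((measurable_tilt_right ε).const_mul _) (h1.const_mul _))

/-- For ‖X‖ = 1 the defect of s • X is (1 - s²)(1 - s²|det X|²); its first factor goes into the
radial weight, its second stays on the sphere. -/
theorem etaReg_eq_lintegral {δ r ε : ℝ} (hr : r ≤ 1) (hε : ε ≠ 0) :
    etaReg 𝕜 δ r ε =
      ∫⁻ s in Set.Ioo 0 r, radialWeight 𝕜 (kap 𝕜 * δ) s * angular 𝕜 (kap 𝕜 * δ) ε s := by
  rw [etaReg_eq hr hε, ← lintegral_indicator (measurableSet_etaRegion r ε),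
    lintegral_eq_coneMeasure ((measurable_defect_rpow _).indicator (measurableSet_etaRegion r ε)),
    ← lintegral_indicator measurableSet_Ioi, ← lintegral_indicator measurableSet_Ioo]
  congr 1
  ext s
  by_cases hs : 0 < s
  swap
  · simp [hs]
  by_cases hsr : s < r
  · have hs1 : s < 1 := hsr.trans_le hr
    rw [Set.indicator_of_mem (Set.mem_Ioi.2 hs), Set.indicator_of_mem (Set.mem_Ioo.2 ⟨hs, hsr⟩),
      radialWeight, mul_assoc, angular, ← lintegral_const_mul _ (measurable_angular _ ε s)]
    congr 1
    apply lintegral_congr_ae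
    filter_upwards [ae_coneMeasure] with X hX
    have hd := (frobSq_of_opNorm_eq_one hX).2
    have h1 : 0 < 1 - s ^ 2 := by nlinarith
    have h2 : 0 < 1 - s ^ 2 * ‖X.det‖ ^ 2 := by nlinarith [sq_nonneg s]
    have hmem : s • X ∈ etaRegion 𝕜 r ε ↔ X ∈ {X : Matrix (Fin 2) (Fin 2) 𝕜 |
        s ^ 2 * tilt ε X < (1 - s ^ 2) * (1 - s ^ 2 * ‖X.det‖ ^ 2)} := by
      simp [etaRegion, opNorm_smul, hX, abs_of_pos hs, hsr, tilt_smul, defect_smul hX]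
    by_cases hm : s • X ∈ etaRegion 𝕜 r ε
    · rw [Set.indicator_of_mem hm, Set.indicator_of_mem (hmem.1 hm), defect_smul hX,
        ENNReal.ofReal_rpow_of_pos h1, ENNReal.ofReal_rpow_of_pos h2,
        ← ENNReal.ofReal_mul (by positivity), Real.mul_rpow h1.le h2.le]
    · rw [Set.indicator_of_notMem hm, Set.indicator_of_notMem (fun h => hm (hmem.2 h)), mul_zero]
  · have : s ∉ Set.Ioo 0 r := fun h => hsr h.2
    rw [Set.indicator_of_notMem this, Set.indicator_of_mem (Set.mem_Ioi.2 hs)]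
    have h0 : ∫⁻ X, (etaRegion 𝕜 r ε).indicator
        (fun X => ENNReal.ofReal (defect X ^ (-(kap 𝕜 * δ)))) (s • X) ∂coneMeasure 𝕜 = 0 := by
      rw [← lintegral_zero (μ := coneMeasure 𝕜)]
      apply lintegral_congr_ae
      filter_upwards [ae_coneMeasure] with X hX
      apply Set.indicator_of_notMem
      simp [etaRegion, opNorm_smul, hX, abs_of_pos hs, hsr]
    rw [h0, mul_zero]

theorem rpow_neg_le_rpow_neg {a : ℝ} (ha : 0 ≤ a) {x y : ℝ≥0∞} (h : x ≤ y) :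
    y ^ (-a) ≤ x ^ (-a) := by
  rw [ENNReal.rpow_neg, ENNReal.rpow_neg]
  exact ENNReal.inv_le_inv.2 (ENNReal.rpow_le_rpow h ha)

theorem angular_le {a : ℝ} (ha : 0 ≤ a) (ε s : ℝ) (hs : s ∈ Set.Ioo (0 : ℝ) 1) :
    angular 𝕜 a ε s ≤ ∫⁻ X, ENNReal.ofReal (1 - ‖X.det‖ ^ 2) ^ (-a) ∂coneMeasure 𝕜 := by
  apply lintegral_mono_ae
  filter_upwards [ae_coneMeasure] with X hX
  refine (Set.indicator_le_self _ _ _).trans ?_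
  apply rpow_neg_le_rpow_neg ha
  apply ENNReal.ofReal_le_ofReal
  have h1 : 0 ≤ 1 - s ^ 2 := by nlinarith [hs.1, hs.2]
  nlinarith [mul_nonneg h1 (sq_nonneg ‖X.det‖)]

theorem radialWeight_le {a : ℝ} (ha : 0 ≤ a) {r s : ℝ} (hr : r < 1) (hs : s ∈ Set.Ioo 0 r) :
    radialWeight 𝕜 a s ≤ ENNReal.ofReal (1 - r ^ 2) ^ (-a) := by
  unfold radialWeight
  have h1 : ENNReal.ofReal (s ^ (Module.finrank ℝ (Matrix (Fin 2) (Fin 2) 𝕜) - 1)) ≤ 1 :=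
    ENNReal.ofReal_le_one.2 (pow_le_one₀ hs.1.le (hs.2.trans hr).le)
  refine (mul_le_mul' h1 (rpow_neg_le_rpow_neg ha
    (ENNReal.ofReal_le_ofReal ?_))).trans (one_mul _).le
  nlinarith [hs.1, hs.2]

theorem lintegral_radialWeight_ne_top {a : ℝ} (ha : 0 ≤ a) {r : ℝ} (hr : r < 1) :
    ∫⁻ s in Set.Ioo 0 r, radialWeight 𝕜 a s ≠ ∞ := by
  rcases le_or_gt r 0 with h0 | h0
  · simp [Set.Ioo_eq_empty (not_lt.2 h0)]
  refine ne_top_of_le_ne_top ?_ (setLIntegral_mono_ae' measurableSet_Ioo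
    (ae_of_all _ fun s hs => radialWeight_le ha hr hs))
  rw [setLIntegral_const]
  refine ENNReal.mul_ne_top (ENNReal.rpow_ne_top_of_ne_zero ?_ ENNReal.ofReal_ne_top) (by simp)
  rw [Ne, ENNReal.ofReal_eq_zero]
  nlinarith

/-- On (1/2, 1) the weight dominates a multiple of 1/(1 - s): there 1 - s² ≤ 2(1 - s), a ≥ 1, and
the power of s is bounded below. -/
theorem lintegral_radialWeight_eq_top {a : ℝ} (ha : 1 ≤ a) :
    ∫⁻ s in Set.Ioo (0 : ℝ) 1, radialWeight 𝕜 a s = ∞ := by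
  set n := Module.finrank ℝ (Matrix (Fin 2) (Fin 2) 𝕜) - 1
  have h0 : ¬ IntegrableOn (fun s : ℝ => (s - 1)⁻¹) (Set.Ioo (1 / 2) 1) := by
    intro h
    have : IntervalIntegrable (fun s : ℝ => (s - 1)⁻¹) volume (1 / 2) 1 := by
      rw [intervalIntegrable_iff_integrableOn_Ioo_of_le (by norm_num)]
      exact h
    rw [intervalIntegrable_sub_inv_iff] at this
    rcases this with h | h
    · norm_num at h
    · exact h (Set.right_mem_uIcc)
  have h1 : ∫⁻ s in Set.Ioo (1 / 2 : ℝ) 1, ENNReal.ofReal (1 - s)⁻¹ = ∞ := by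
    by_contra hc
    apply h0
    have hm : AEStronglyMeasurable (fun s : ℝ => (s - 1)⁻¹)
        (volume.restrict (Set.Ioo (1 / 2) 1)) := by
      apply Measurable.aestronglyMeasurable; fun_prop
    refine ⟨hm, ?_⟩
    rw [hasFiniteIntegral_iff_norm]
    refine lt_of_le_of_lt (le_of_eq ?_) (lt_top_iff_ne_top.2 hc)
    apply setLIntegral_congr_fun measurableSet_Ioo
    intro s hs
    dsimp only
    rw [Real.norm_eq_abs, abs_inv, abs_sub_comm, abs_of_pos (by linarith [hs.2])]
  have h2 : ∀ s ∈ Set.Ioo (1 / 2 : ℝ) 1,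
      ENNReal.ofReal ((1 / 2) ^ n / 2) * ENNReal.ofReal (1 - s)⁻¹ ≤ radialWeight 𝕜 a s := by
    intro s hs
    have hp : 0 < 1 - s ^ 2 := by nlinarith [hs.1, hs.2]
    have hp' : 0 < 1 - s := by linarith [hs.2]
    rw [radialWeight, ENNReal.ofReal_rpow_of_pos hp, ← ENNReal.ofReal_mul (by positivity),
      ← ENNReal.ofReal_mul (by have := hs.1; positivity)]
    apply ENNReal.ofReal_le_ofReal
    have e1 : (1 - s ^ 2)⁻¹ ≤ (1 - s ^ 2) ^ (-a) := by
      rw [← Real.rpow_neg_one]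
      exact Real.rpow_le_rpow_of_exponent_ge hp (by nlinarith [hs.1]) (by linarith)
    have e2 : (1 - s)⁻¹ / 2 ≤ (1 - s ^ 2)⁻¹ := by
      rw [div_eq_mul_inv, ← mul_inv]
      apply inv_anti₀ hp
      nlinarith [hs.1, hs.2]
    have e3 : (1 / 2 : ℝ) ^ n ≤ s ^ n := pow_le_pow_left₀ (by norm_num) hs.1.le n
    calc (1 / 2) ^ n / 2 * (1 - s)⁻¹ = (1 / 2) ^ n * ((1 - s)⁻¹ / 2) := by ring
      _ ≤ s ^ n * (1 - s ^ 2) ^ (-a) :=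
        mul_le_mul e3 (e2.trans e1) (by positivity) (by have := hs.1; positivity)
  rw [eq_top_iff]
  calc ∞ = ENNReal.ofReal ((1 / 2) ^ n / 2) * ∫⁻ s in Set.Ioo (1 / 2 : ℝ) 1,
          ENNReal.ofReal (1 - s)⁻¹ := by
        rw [h1, ENNReal.mul_top]
        rw [Ne, ENNReal.ofReal_eq_zero, not_le]; positivity
    _ = ∫⁻ s in Set.Ioo (1 / 2 : ℝ) 1,
          ENNReal.ofReal ((1 / 2) ^ n / 2) * ENNReal.ofReal (1 - s)⁻¹ := by
        rw [lintegral_const_mul]; fun_prop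
    _ ≤ ∫⁻ s in Set.Ioo (1 / 2 : ℝ) 1, radialWeight 𝕜 a s :=
        setLIntegral_mono_ae' measurableSet_Ioo (ae_of_all _ h2)
    _ ≤ _ := lintegral_mono_set (Set.Ioo_subset_Ioo_left (by norm_num))

end EtaLimit

/-! ### Jacobians of 𝕜-linear maps and of X ↦ A X B -/

section Jacobian

variable {𝕜 : Type*} [RCLike 𝕜]

/-- Conjugation is an automorphism over ℝ, so N(z)² = N(z z*) = |z|^{2d}. This treats the real and
the complex case together. -/
theorem abs_algebraNorm (z : 𝕜) : |Algebra.norm ℝ z| = ‖z‖ ^ Module.finrank ℝ 𝕜 := by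
  have h1 : Algebra.norm ℝ (star z) = Algebra.norm ℝ z :=
    (Algebra.norm_eq_of_algEquiv (RCLike.conjAe (K := 𝕜)) z)
  have h2 : Algebra.norm ℝ z * Algebra.norm ℝ z = (‖z‖ ^ 2) ^ Module.finrank ℝ 𝕜 := by
    calc Algebra.norm ℝ z * Algebra.norm ℝ z = Algebra.norm ℝ (z * star z) := by
          rw [map_mul, h1]
      _ = _ := by
          rw [← ofReal_normSq]
          exact Algebra.norm_algebraMap (S := 𝕜) (‖z‖ ^ 2)
  rw [← abs_mul_abs_self, ← pow_mul, mul_comm 2, pow_mul, ← sq] at h2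
  exact (sq_eq_sq₀ (abs_nonneg _) (by positivity)).1 h2

/-- Restriction of scalars replaces the determinant by its norm to ℝ, hence the d-th power of |det
f|. -/
theorem lintegral_comp_linearMap {E : Type*} [NormedAddCommGroup E] [NormedSpace ℝ E] [Module 𝕜 E]
    [IsScalarTower ℝ 𝕜 E] [MeasurableSpace E] [BorelSpace E] [FiniteDimensional ℝ E]
    (μ : Measure E) [μ.IsAddHaarMeasure] (f : E →ₗ[𝕜] E) (hf : LinearMap.det f ≠ 0)
    (g : E → ℝ≥0∞) :
    ∫⁻ x, g x ∂μ =
      ENNReal.ofReal (‖LinearMap.det f‖ ^ Module.finrank ℝ 𝕜) * ∫⁻ x, g (f x) ∂μ := by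
  set F : E →ₗ[ℝ] E := f.restrictScalars ℝ with hF
  have hFdet : |LinearMap.det F| = ‖LinearMap.det f‖ ^ Module.finrank ℝ 𝕜 := by
    rw [hF, LinearMap.det_restrictScalars, abs_algebraNorm]
  have hpos : 0 < |LinearMap.det F| := by rw [hFdet]; positivity
  have hF0 : LinearMap.det F ≠ 0 := abs_pos.1 hpos
  have hemb : MeasurableEmbedding F :=
    ((F.equivOfDetNeZero hF0).toContinuousLinearEquiv.toHomeomorph).measurableEmbedding
  have h := Measure.map_linearMap_addHaar_eq_smul_addHaar μ hF0
  have h2 : ∫⁻ x, g (F x) ∂μ = ENNReal.ofReal |(LinearMap.det F)⁻¹| * ∫⁻ x, g x ∂μ := by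
    rw [← hemb.lintegral_map, h, lintegral_smul_measure, smul_eq_mul]
  change _ = _ * ∫⁻ x, g (F x) ∂μ
  rw [h2, ← mul_assoc, ← hFdet, ← ENNReal.ofReal_mul (abs_nonneg _), ← abs_mul,
    mul_inv_cancel₀ hF0, abs_one, ENNReal.ofReal_one, one_mul]

/-- The linear map `X ↦ A X B`. -/
def conjMap (A B : Matrix (Fin 2) (Fin 2) 𝕜) :
    Matrix (Fin 2) (Fin 2) 𝕜 →ₗ[𝕜] Matrix (Fin 2) (Fin 2) 𝕜 where
  toFun X := A * X * B
  map_add' X Y := by rw [mul_add, add_mul]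
  map_smul' c X := by simp

/-- Vectorization as a linear equivalence. -/
def vecEquiv (𝕜 : Type*) [RCLike 𝕜] :
    Matrix (Fin 2) (Fin 2) 𝕜 ≃ₗ[𝕜] (Fin 2 × Fin 2 → 𝕜) where
  toFun := Matrix.vec
  invFun v := Matrix.of fun i j => v (j, i)
  map_add' _ _ := rfl
  map_smul' _ _ := rfl
  left_inv _ := rfl
  right_inv _ := rfl

theorem det_conjMap (A B : Matrix (Fin 2) (Fin 2) 𝕜) :
    LinearMap.det (conjMap A B) = A.det ^ 2 * B.det ^ 2 := by
  have h : Matrix.toLin' (Bᵀ ⊗ₖ A) =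
      (vecEquiv 𝕜).toLinearMap ∘ₗ conjMap A B ∘ₗ (vecEquiv 𝕜).symm.toLinearMap := by
    apply LinearMap.ext
    intro v
    obtain ⟨X, rfl⟩ := (vecEquiv 𝕜).surjective v
    simp only [LinearMap.comp_apply, LinearEquiv.coe_coe, LinearEquiv.symm_apply_apply,
      Matrix.toLin'_apply]
    exact (Matrix.kronecker_mulVec_vec A X Bᵀ).trans (by rw [Matrix.transpose_transpose]; rfl)
  rw [← LinearMap.det_conj (conjMap A B) (vecEquiv 𝕜)]
  change LinearMap.det ((vecEquiv 𝕜).toLinearMap ∘ₗ conjMap A B ∘ₗ (vecEquiv 𝕜).symm.toLinearMap)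
    = _
  rw [← h, LinearMap.det_toLin', Matrix.det_kronecker]
  simp [mul_comm]

variable [MeasureSpace 𝕜] [BorelSpace 𝕜] [(volume : Measure 𝕜).IsAddHaarMeasure]

open scoped Matrix.Norms.L2Operator in
theorem lintegral_conj {A B : Matrix (Fin 2) (Fin 2) 𝕜} (hA : A.det ≠ 0) (hB : B.det ≠ 0)
    (g : Matrix (Fin 2) (Fin 2) 𝕜 → ℝ≥0∞) :
    ∫⁻ X, g X = ENNReal.ofReal ((‖A.det‖ * ‖B.det‖) ^ (2 * Module.finrank ℝ 𝕜)) *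
      ∫⁻ X, g (A * X * B) := by
  let := opNormedSpace 𝕜
  have hdet := det_conjMap A B
  have := lintegral_comp_linearMap (𝕜 := 𝕜) (volume : Measure (Matrix (Fin 2) (Fin 2) 𝕜))
    (conjMap A B) (by rw [hdet]; positivity) g
  rw [this, hdet, norm_mul, norm_pow, norm_pow, ← mul_pow, ← pow_mul]
  rfl

theorem lintegral_comp_mulVec {Q : Matrix (Fin 2) (Fin 2) 𝕜} (hQ : ‖Q.det‖ = 1)
    (g : (Fin 2 → 𝕜) → ℝ≥0∞) : ∫⁻ v, g (Q *ᵥ v) = ∫⁻ v, g v := by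
  have h0 : Q.det ≠ 0 := by intro h; rw [h, norm_zero] at hQ; exact zero_ne_one hQ
  have := lintegral_comp_linearMap (𝕜 := 𝕜) (volume : Measure (Fin 2 → 𝕜)) (Matrix.toLin' Q)
    (by rwa [LinearMap.det_toLin']) g
  rw [this, LinearMap.det_toLin', hQ]
  simp

end Jacobian

/-! ### Integrable negative powers near a point and near a sphere -/

section PowerIntegrals

theorem setLIntegral_Ioo_rpow_lt_top {p : ℝ} (hp : p < 1) (R : ℝ) :
    ∫⁻ s in Set.Ioo 0 R, ENNReal.ofReal s ^ (-p) < ∞ := by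
  rcases le_or_gt R 0 with h | h
  · simp [Set.Ioo_eq_empty (not_lt.2 h)]
  have h1 : IntegrableOn (fun s : ℝ => s ^ (-p)) (Set.Ioo 0 R) := by
    rw [← intervalIntegrable_iff_integrableOn_Ioo_of_le h.le]
    exact intervalIntegral.intervalIntegrable_rpow' (by linarith)
  refine lt_of_eq_of_lt (setLIntegral_congr_fun measurableSet_Ioo fun s hs => ?_)
    h1.setLIntegral_lt_top
  exact ENNReal.ofReal_rpow_of_pos hs.1

variable {E : Type*} [NormedAddCommGroup E] [NormedSpace ℝ E] [FiniteDimensional ℝ E]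
  [Nontrivial E] [MeasurableSpace E] [BorelSpace E]

theorem setLIntegral_ball_rpow_lt_top (μ : Measure E) [μ.IsAddHaarMeasure] {p : ℝ}
    (hp : p < Module.finrank ℝ E) (R : ℝ) :
    ∫⁻ x in Metric.ball (0 : E) R, ENNReal.ofReal ‖x‖ ^ (-p) ∂μ < ∞ := by
  have hn : 0 < Module.finrank ℝ E := Module.finrank_pos
  refine setLIntegral_ball_norm_lt_top μ (g := fun s => ENNReal.ofReal s ^ (-p)) (by fun_prop) R ?_
  refine lt_of_eq_of_lt (setLIntegral_congr_fun measurableSet_Ioo fun s hs => ?_)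
    (setLIntegral_Ioo_rpow_lt_top (p := p - (Module.finrank ℝ E - 1)) (by linarith) R)
  have h0 : ENNReal.ofReal s ≠ 0 := by simpa using hs.1
  rw [ENNReal.ofReal_pow hs.1.le, ← ENNReal.rpow_natCast, ← ENNReal.rpow_add _ _ h0
    ENNReal.ofReal_ne_top, Nat.cast_pred hn]
  congr 1; ring

/-- Near any sphere a small negative power of the distance to it is integrable, uniformly in the
radius of the sphere. -/
theorem exists_setLIntegral_ball_sub_rpow_le (μ : Measure E) [μ.IsAddHaarMeasure] {p : ℝ}
    (hp : p < 1) (R : ℝ) :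
    ∃ B : ℝ≥0∞, B < ∞ ∧ ∀ c ∈ Set.Ioo 0 R,
      ∫⁻ x in Metric.ball (0 : E) R, ENNReal.ofReal |c - ‖x‖| ^ (-p) ∂μ ≤ B := by
  refine ⟨μ.toSphere Set.univ * (ENNReal.ofReal (R ^ (Module.finrank ℝ E - 1)) *
    ∫⁻ t in Metric.ball (0 : ℝ) R, ENNReal.ofReal ‖t‖ ^ (-p)), ?_, ?_⟩
  · refine ENNReal.mul_lt_top (measure_lt_top _ _) (ENNReal.mul_lt_top ENNReal.ofReal_lt_top ?_)
    exact setLIntegral_ball_rpow_lt_top volume (by simpa using hp) R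
  · intro c hc
    rw [setLIntegral_ball_norm μ (g := fun s => ENNReal.ofReal |c - s| ^ (-p)) (by fun_prop) R]
    gcongr
    -- The reflected variable c - s stays in (-R, R), so enlarging the domain to that interval
    -- removes c from the bound.
    have h1 : ∫⁻ s in Set.Ioo 0 R, ENNReal.ofReal |c - s| ^ (-p) ≤
        ∫⁻ t in Metric.ball (0 : ℝ) R, ENNReal.ofReal ‖t‖ ^ (-p) := by
      rw [← lintegral_indicator measurableSet_Ioo, ← lintegral_indicator measurableSet_ball,
        ← lintegral_sub_left_eq_self _ c]
      apply lintegral_mono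
      intro s
      dsimp only
      by_cases hs : c - s ∈ Set.Ioo 0 R
      · rw [Set.indicator_of_mem hs, Set.indicator_of_mem]
        · simp
        · rw [mem_ball_zero_iff, Real.norm_eq_abs, abs_lt]
          constructor <;> linarith [hs.1, hs.2, hc.1, hc.2]
      · rw [Set.indicator_of_notMem hs]; exact zero_le
    refine le_trans ?_ (mul_le_mul_right h1 _)
    rw [← lintegral_const_mul _ (by fun_prop)]
    refine setLIntegral_mono_ae' measurableSet_Ioo (ae_of_all _ fun s hs => ?_)
    gcongr
    · exact hs.1.le
    · exact hs.2.le

end PowerIntegrals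

/-! ### Integrability of the angular singularity -/

section ConeFinite

variable {𝕜 : Type*} [RCLike 𝕜]

/-- The Euclidean norm of a pair. -/
noncomputable def euclid (u : Fin 2 → 𝕜) : ℝ := √(‖u 0‖ ^ 2 + ‖u 1‖ ^ 2)

theorem euclid_nonneg (u : Fin 2 → 𝕜) : 0 ≤ euclid u := Real.sqrt_nonneg _

theorem euclid_sq (u : Fin 2 → 𝕜) : euclid u ^ 2 = ‖u 0‖ ^ 2 + ‖u 1‖ ^ 2 :=
  Real.sq_sqrt (by positivity)

theorem norm_le_euclid (u : Fin 2 → 𝕜) : ‖u‖ ≤ euclid u := by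
  rw [pi_norm_le_iff_of_nonneg (euclid_nonneg _)]
  intro i
  apply Real.le_sqrt_of_sq_le
  fin_cases i
  · simp only [Fin.zero_eta]; nlinarith [sq_nonneg ‖u 1‖]
  · simp only [Fin.mk_one]; nlinarith [sq_nonneg ‖u 0‖]

/-- A unitary matrix whose first row is proportional to the conjugate of `u`. -/
noncomputable def frame (u : Fin 2 → 𝕜) : Matrix (Fin 2) (Fin 2) 𝕜 :=
  ((euclid u)⁻¹ : 𝕜) • !![star (u 0), star (u 1); -u 1, u 0]

theorem det_frame {u : Fin 2 → 𝕜} (hu : euclid u ≠ 0) : (frame u).det = 1 := by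
  have h : ((euclid u : ℝ) : 𝕜) ≠ 0 := by exact_mod_cast hu
  have h2 : ((euclid u : ℝ) : 𝕜) ^ 2 = u 0 * star (u 0) + u 1 * star (u 1) := by
    rw [← ofReal_normSq, ← ofReal_normSq, ← RCLike.ofReal_add, ← euclid_sq]; push_cast; rfl
  rw [frame, Matrix.det_smul, Matrix.det_fin_two]
  simp only [Fintype.card_fin, Matrix.of_apply, Matrix.cons_val', Matrix.cons_val_zero,
    Matrix.cons_val_one]
  field_simp
  rw [h2]; simp; ring

theorem frobSq_of_rows (u v : Fin 2 → 𝕜) :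
    frobSq (Matrix.of ![u, v]) = euclid u ^ 2 + euclid v ^ 2 := by
  rw [euclid_sq, euclid_sq, frobSq]; simp; ring

theorem frame_mulVec_one {u : Fin 2 → 𝕜} (hu : euclid u ≠ 0) (v : Fin 2 → 𝕜) :
    ‖(Matrix.of ![u, v]).det‖ = euclid u * ‖(frame u *ᵥ v) 1‖ := by
  have h : ((euclid u : ℝ) : 𝕜) ≠ 0 := by exact_mod_cast hu
  have : (Matrix.of ![u, v]).det = (euclid u : 𝕜) * (frame u *ᵥ v) 1 := by
    simp [frame, Matrix.det_fin_two, Matrix.mulVec, dotProduct, Fin.sum_univ_two]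
    field_simp
    ring
  rw [this, norm_mul, RCLike.norm_ofReal, abs_of_nonneg (euclid_nonneg _)]

theorem euclid_frame_mulVec {u : Fin 2 → 𝕜} (hu : euclid u ≠ 0) (v : Fin 2 → 𝕜) :
    euclid (frame u *ᵥ v) ^ 2 = euclid v ^ 2 := by
  have h : ((euclid u : ℝ) : 𝕜) ≠ 0 := by exact_mod_cast hu
  have h2 : ((euclid u : ℝ) : 𝕜) ^ 2 = u 0 * star (u 0) + u 1 * star (u 1) := by
    rw [← ofReal_normSq, ← ofReal_normSq, ← RCLike.ofReal_add, ← euclid_sq]; push_cast; rfl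
  have key : ((euclid (frame u *ᵥ v) ^ 2 : ℝ) : 𝕜) = ((euclid v ^ 2 : ℝ) : 𝕜) := by
    rw [euclid_sq, euclid_sq]
    simp only [RCLike.ofReal_add, ofReal_normSq]
    simp [frame, Matrix.mulVec, dotProduct, Fin.sum_univ_two]
    simp only [← RCLike.star_def]
    field_simp
    rw [h2]; ring
  exact_mod_cast key

/-- The discriminant of the squared singular values. -/
noncomputable def discr (X : Matrix (Fin 2) (Fin 2) 𝕜) : ℝ := frobSq X ^ 2 - 4 * ‖X.det‖ ^ 2

/-- Let N = |u|, and let a, b be the moduli of the components of v along u and orthogonal to it. The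
discriminant is ((N - b)² + a²)((N + b)² + a²), and the last factor is at least N². -/
theorem le_discr {u : Fin 2 → 𝕜} (hu : euclid u ≠ 0) (v : Fin 2 → 𝕜) :
    ((euclid u - ‖(frame u *ᵥ v) 1‖) ^ 2 + ‖(frame u *ᵥ v) 0‖ ^ 2) * euclid u ^ 2 ≤
      discr (Matrix.of ![u, v]) := by
  have h1 := euclid_frame_mulVec hu v
  rw [euclid_sq] at h1
  rw [discr, frobSq_of_rows, frame_mulVec_one hu, ← h1]
  set N := euclid u
  have hN : 0 ≤ N := euclid_nonneg _
  set b := ‖(frame u *ᵥ v) 1‖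
  have hb : 0 ≤ b := norm_nonneg _
  set a := ‖(frame u *ᵥ v) 0‖
  have e : (N ^ 2 + (a ^ 2 + b ^ 2)) ^ 2 - 4 * (N * b) ^ 2 =
      ((N - b) ^ 2 + a ^ 2) * ((N + b) ^ 2 + a ^ 2) := by ring
  rw [e]
  apply mul_le_mul_of_nonneg_left _ (by positivity)
  nlinarith [mul_nonneg hN hb, sq_nonneg a]

/-- With p = κ, x is a distance to a sphere and tolerates exponents below 1, while y is a modulus in
𝕜 and tolerates exponents below d. The split into p/4 and 3p/4 respects both bounds for d = 1 and d
= 2; an even split fails for d = 2, where κ/2 = 1. -/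
theorem rpow_sum_sq_le {x y p : ℝ} (hp : 0 < p) :
    ENNReal.ofReal (x ^ 2 + y ^ 2) ^ (-(p / 2)) ≤
      ENNReal.ofReal |x| ^ (-(p / 4)) * ENNReal.ofReal |y| ^ (-(3 * p / 4)) := by
  have hx : ENNReal.ofReal |x| ^ (-(p / 4)) = ENNReal.ofReal (x ^ 2) ^ (-(p / 8)) := by
    rw [← sq_abs, ENNReal.ofReal_pow (abs_nonneg _), ← ENNReal.rpow_natCast, ← ENNReal.rpow_mul]
    congr 1; push_cast; ring
  have hy : ENNReal.ofReal |y| ^ (-(3 * p / 4)) = ENNReal.ofReal (y ^ 2) ^ (-(3 * p / 8)) := by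
    rw [← sq_abs, ENNReal.ofReal_pow (abs_nonneg _), ← ENNReal.rpow_natCast, ← ENNReal.rpow_mul]
    congr 1; push_cast; ring
  rw [hx, hy]
  rcases eq_or_ne (x ^ 2 + y ^ 2) 0 with h0 | h0
  · have hx0 : x ^ 2 = 0 := by nlinarith [sq_nonneg x, sq_nonneg y]
    have hy0 : y ^ 2 = 0 := by nlinarith [sq_nonneg x, sq_nonneg y]
    rw [hx0, hy0, ENNReal.ofReal_zero, ENNReal.zero_rpow_of_neg (by linarith),
      ENNReal.zero_rpow_of_neg (by linarith), ENNReal.top_mul_top]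
    exact le_top
  · have hne : ENNReal.ofReal (x ^ 2 + y ^ 2) ≠ 0 := by
      rw [Ne, ENNReal.ofReal_eq_zero, not_le]; positivity
    have : -(p / 2) = -(p / 8) + -(3 * p / 8) := by ring
    rw [this, ENNReal.rpow_add _ _ hne ENNReal.ofReal_ne_top]
    exact mul_le_mul' (rpow_neg_le_rpow_neg (by linarith) (ENNReal.ofReal_le_ofReal (by
      nlinarith [sq_nonneg y]))) (rpow_neg_le_rpow_neg (by linarith) (ENNReal.ofReal_le_ofReal (by
      nlinarith [sq_nonneg x])))

theorem discr_rpow_le {u : Fin 2 → 𝕜} (hu : euclid u ≠ 0) (v : Fin 2 → 𝕜) {p : ℝ} (hp : 0 < p) :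
    ENNReal.ofReal (discr (Matrix.of ![u, v])) ^ (-(p / 2)) ≤
      ENNReal.ofReal ‖u‖ ^ (-p) * (ENNReal.ofReal ‖(frame u *ᵥ v) 0‖ ^ (-(3 * p / 4)) *
        ENNReal.ofReal |euclid u - ‖(frame u *ᵥ v) 1‖| ^ (-(p / 4))) := by
  have h1 := rpow_neg_le_rpow_neg (a := p / 2) (by linarith)
    (ENNReal.ofReal_le_ofReal (le_discr hu v))
  refine h1.trans ?_
  rw [ENNReal.ofReal_mul (by positivity), ENNReal.mul_rpow_of_ne_top ENNReal.ofReal_ne_top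
    ENNReal.ofReal_ne_top, mul_comm]
  have h2 : ENNReal.ofReal (euclid u ^ 2) ^ (-(p / 2)) ≤ ENNReal.ofReal ‖u‖ ^ (-p) := by
    have : ENNReal.ofReal (euclid u ^ 2) ^ (-(p / 2)) = ENNReal.ofReal (euclid u) ^ (-p) := by
      rw [ENNReal.ofReal_pow (euclid_nonneg _), ← ENNReal.rpow_natCast, ← ENNReal.rpow_mul]
      congr 1; push_cast; ring
    rw [this]
    exact rpow_neg_le_rpow_neg hp.le (ENNReal.ofReal_le_ofReal (norm_le_euclid u))
  refine mul_le_mul' h2 ((rpow_sum_sq_le hp).trans ?_)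
  rw [mul_comm, abs_of_nonneg (norm_nonneg ((frame u *ᵥ v) 0))]

theorem continuous_discr : Continuous (discr : Matrix (Fin 2) (Fin 2) 𝕜 → ℝ) :=
  (continuous_frobSq.pow 2).sub (continuous_norm_det_sq.const_mul 4)

variable [MeasureSpace 𝕜] [BorelSpace 𝕜] [(volume : Measure 𝕜).IsAddHaarMeasure]

theorem lintegral_matrix_eq_rows {f : Matrix (Fin 2) (Fin 2) 𝕜 → ℝ≥0∞} (hf : Measurable f) :
    ∫⁻ X, f X = ∫⁻ u : Fin 2 → 𝕜, ∫⁻ v : Fin 2 → 𝕜, f (Matrix.of ![u, v]) := by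
  have h := (volume_preserving_finTwoArrow (Fin 2 → 𝕜)).symm.lintegral_comp
    (f := fun x : Fin 2 → Fin 2 → 𝕜 => f (Matrix.of x)) hf
  refine h.symm.trans ?_
  exact lintegral_prod _ (hf.comp (MeasurableEquiv.finTwoArrow (α := Fin 2 → 𝕜)).symm.measurable).aemeasurable

theorem lintegral_vector_mul {f g : 𝕜 → ℝ≥0∞} (hf : Measurable f) (hg : Measurable g) :
    ∫⁻ v : Fin 2 → 𝕜, f (v 0) * g (v 1) = (∫⁻ x, f x) * ∫⁻ x, g x := by
  have h := (volume_preserving_finTwoArrow 𝕜).lintegral_comp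
    (f := fun p : 𝕜 × 𝕜 => f p.1 * g p.2) (by fun_prop)
  refine h.trans ?_
  exact lintegral_prod_mul hf.aemeasurable hg.aemeasurable

theorem dimK_le_two : dimK 𝕜 ≤ 2 := by
  rw [dimK]; exact_mod_cast RCLike.finrank_le_two 𝕜

/-- The discriminant is the square of the difference of the squared singular values. It vanishes on
the multiples of unitary matrices, a set of codimension d + 1 > κ. For a fixed first row u, a
unitary change of frame for the second row separates the bound `discr_rpow_le` into an integral near
0 and one near the sphere of radius |u|, and the latter is bounded uniformly in u. -/
theorem lintegral_discr_lt_top :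
    ∫⁻ X in {X : Matrix (Fin 2) (Fin 2) 𝕜 | opNorm X < 1},
      ENNReal.ofReal (discr X) ^ (-(kap 𝕜 / 2)) < ∞ := by
  have hk := one_lt_kap (𝕜 := 𝕜)
  have hd1 := one_le_dimK (𝕜 := 𝕜)
  have hd2 := dimK_le_two (𝕜 := 𝕜)
  have hkap : kap 𝕜 = 3 * dimK 𝕜 / 4 + 1 / 2 := rfl
  have hdim : dimK 𝕜 = Module.finrank ℝ 𝕜 := rfl
  set p := kap 𝕜 with hp
  obtain ⟨B, hB, hB'⟩ := exists_setLIntegral_ball_sub_rpow_le (E := 𝕜) volume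
    (p := p / 4) (by linarith) 2
  have hA := setLIntegral_ball_rpow_lt_top (E := 𝕜) volume (p := 3 * p / 4)
    (by rw [← hdim]; linarith) 2
  have hfin : Module.finrank ℝ (Fin 2 → 𝕜) = 2 * Module.finrank ℝ 𝕜 := by
    rw [Module.finrank_pi_fintype]; simp
  have hC := setLIntegral_ball_rpow_lt_top (E := Fin 2 → 𝕜) volume (p := p)
    (by rw [hfin]; push_cast; rw [← hdim]; linarith) 2
  -- A Frobenius ball contains the operator ball and bounds each row separately, also after rotation
  -- of the second row.
  set S : Set (Matrix (Fin 2) (Fin 2) 𝕜) := {X | frobSq X < 4} with hS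
  have hSm : MeasurableSet S := measurableSet_lt continuous_frobSq.measurable measurable_const
  have hfm : Measurable fun X : Matrix (Fin 2) (Fin 2) 𝕜 =>
      ENNReal.ofReal (discr X) ^ (-(p / 2)) :=
    (continuous_discr.measurable.ennreal_ofReal).pow_const _
  have hsub : {X : Matrix (Fin 2) (Fin 2) 𝕜 | opNorm X < 1} ⊆ S := by
    intro X hX
    have := ((opNorm_lt_one_iff_trace X).1 hX).1
    change frobSq X < 4
    linarith
  refine (lintegral_mono_set hsub).trans_lt ?_
  rw [← lintegral_indicator hSm, lintegral_matrix_eq_rows (hfm.indicator hSm)]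
  set A := ∫⁻ x in Metric.ball (0 : 𝕜) 2, ENNReal.ofReal ‖x‖ ^ (-(3 * p / 4)) with hAdef
  have hinner : ∀ u : Fin 2 → 𝕜, euclid u ≠ 0 →
      ∫⁻ v : Fin 2 → 𝕜, S.indicator (fun X => ENNReal.ofReal (discr X) ^ (-(p / 2)))
        (Matrix.of ![u, v]) ≤
      (Metric.ball (0 : Fin 2 → 𝕜) 2).indicator (fun u => ENNReal.ofReal ‖u‖ ^ (-p)) u *
        (A * B) := by
    intro u hu
    have hN : 0 < euclid u := lt_of_le_of_ne (euclid_nonneg _) (Ne.symm hu)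
    by_cases hu2 : euclid u < 2
    · have humem : u ∈ Metric.ball (0 : Fin 2 → 𝕜) 2 :=
        mem_ball_zero_iff.2 ((norm_le_euclid u).trans_lt hu2)
      rw [Set.indicator_of_mem humem]
      set g0 : 𝕜 → ℝ≥0∞ := (Metric.ball (0 : 𝕜) 2).indicator
        fun x => ENNReal.ofReal ‖x‖ ^ (-(3 * p / 4)) with hg0
      set g1 : 𝕜 → ℝ≥0∞ := (Metric.ball (0 : 𝕜) 2).indicator
        fun x => ENNReal.ofReal |euclid u - ‖x‖| ^ (-(p / 4)) with hg1
      have hg0m : Measurable g0 := Measurable.indicator (by fun_prop) measurableSet_ball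
      have hg1m : Measurable g1 := Measurable.indicator (by fun_prop) measurableSet_ball
      calc _ ≤ ∫⁻ v : Fin 2 → 𝕜, ENNReal.ofReal ‖u‖ ^ (-p) *
              (fun w : Fin 2 → 𝕜 => g0 (w 0) * g1 (w 1)) (frame u *ᵥ v) := by
            apply lintegral_mono
            intro v
            dsimp only
            by_cases hm : Matrix.of ![u, v] ∈ S
            · have hm' : frobSq (Matrix.of ![u, v]) < 4 := hm
              have hv : ‖frame u *ᵥ v‖ < 2 := by
                apply (norm_le_euclid _).trans_lt
                rw [← sq_lt_sq₀ (euclid_nonneg _) (by norm_num)]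
                have := euclid_frame_mulVec hu v
                rw [this]
                rw [frobSq_of_rows] at hm'
                nlinarith
              have h0 : (frame u *ᵥ v) 0 ∈ Metric.ball (0 : 𝕜) 2 :=
                mem_ball_zero_iff.2 ((norm_le_pi_norm _ 0).trans_lt hv)
              have h1 : (frame u *ᵥ v) 1 ∈ Metric.ball (0 : 𝕜) 2 :=
                mem_ball_zero_iff.2 ((norm_le_pi_norm _ 1).trans_lt hv)
              rw [Set.indicator_of_mem hm, hg0, hg1, Set.indicator_of_mem h0,
                Set.indicator_of_mem h1]
              exact discr_rpow_le hu v (by linarith)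
            · rw [Set.indicator_of_notMem hm]; exact zero_le
        _ = ENNReal.ofReal ‖u‖ ^ (-p) * ((∫⁻ x, g0 x) * ∫⁻ x, g1 x) := by
            have hgm : Measurable fun w : Fin 2 → 𝕜 => g0 (w 0) * g1 (w 1) := by fun_prop
            have hgm' : Measurable fun v : Fin 2 → 𝕜 =>
                (fun w : Fin 2 → 𝕜 => g0 (w 0) * g1 (w 1)) (frame u *ᵥ v) :=
              hgm.comp (Continuous.measurable (by fun_prop))
            rw [lintegral_const_mul _ hgm',
              lintegral_comp_mulVec (by rw [det_frame hu, norm_one])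
                (fun w : Fin 2 → 𝕜 => g0 (w 0) * g1 (w 1)), lintegral_vector_mul hg0m hg1m]
        _ ≤ _ := by
            rw [hg0, hg1, lintegral_indicator measurableSet_ball,
              lintegral_indicator measurableSet_ball]
            gcongr
            exact hB' _ ⟨hN, hu2⟩
    · refine le_trans (le_of_eq ?_) (zero_le)
      rw [← lintegral_zero (μ := (volume : Measure (Fin 2 → 𝕜)))]
      apply lintegral_congr
      intro v
      apply Set.indicator_of_notMem
      intro hm
      have hm' : frobSq (Matrix.of ![u, v]) < 4 := hm
      rw [frobSq_of_rows] at hm'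
      push Not at hu2
      nlinarith [sq_nonneg (euclid v)]
  have hae : ∀ᵐ u : Fin 2 → 𝕜, euclid u ≠ 0 := by
    have : ∀ᵐ u : Fin 2 → 𝕜, u ≠ 0 := by
      simp [ae_iff]
    filter_upwards [this] with u hu h
    apply hu
    rw [← norm_eq_zero]
    exact le_antisymm ((norm_le_euclid u).trans h.le) (norm_nonneg _)
  refine (lintegral_mono_ae (hae.mono hinner)).trans_lt ?_
  rw [lintegral_mul_const _ (Measurable.indicator (by fun_prop) measurableSet_ball),
    lintegral_indicator measurableSet_ball]
  exact ENNReal.mul_lt_top hC (ENNReal.mul_lt_top hA hB)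

/-- On the sphere the discriminant is (1 - |det X|²)², and it is homogeneous of degree 4. The volume
integral of its power -κ/2, read in polar coordinates over 1/2 < s < 1, therefore dominates a
positive multiple of the sphere integral. -/
theorem lintegral_coneMeasure_lt_top :
    ∫⁻ X, ENNReal.ofReal (1 - ‖X.det‖ ^ 2) ^ (-kap 𝕜) ∂coneMeasure 𝕜 < ∞ := by
  set K := ∫⁻ X, ENNReal.ofReal (1 - ‖X.det‖ ^ 2) ^ (-kap 𝕜) ∂coneMeasure 𝕜 with hK
  have hk := kap_pos (𝕜 := 𝕜)
  set n := Module.finrank ℝ (Matrix (Fin 2) (Fin 2) 𝕜) - 1 with hn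
  have hSm : MeasurableSet {X : Matrix (Fin 2) (Fin 2) 𝕜 | opNorm X < 1} :=
    measurableSet_lt continuous_opNorm.measurable measurable_const
  have hfm : Measurable fun X : Matrix (Fin 2) (Fin 2) 𝕜 =>
      ENNReal.ofReal (discr X) ^ (-(kap 𝕜 / 2)) :=
    (continuous_discr.measurable.ennreal_ofReal).pow_const _
  have h1 : ENNReal.ofReal ((1 / 2) ^ n / 2) * K ≤
      ∫⁻ X in {X : Matrix (Fin 2) (Fin 2) 𝕜 | opNorm X < 1},
        ENNReal.ofReal (discr X) ^ (-(kap 𝕜 / 2)) := by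
    rw [← lintegral_indicator hSm, lintegral_eq_coneMeasure (hfm.indicator hSm)]
    calc ENNReal.ofReal ((1 / 2) ^ n / 2) * K
        = ∫⁻ s in Set.Ioo (1 / 2 : ℝ) 1, ENNReal.ofReal ((1 / 2) ^ n) * K := by
          rw [setLIntegral_const, Real.volume_Ioo, mul_right_comm,
            ← ENNReal.ofReal_mul (by positivity)]
          congr 2; ring
      _ ≤ ∫⁻ s in Set.Ioo (1 / 2 : ℝ) 1, ENNReal.ofReal (s ^ n) *
          ∫⁻ X, {X : Matrix (Fin 2) (Fin 2) 𝕜 | opNorm X < 1}.indicator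
            (fun X => ENNReal.ofReal (discr X) ^ (-(kap 𝕜 / 2))) (s • X) ∂coneMeasure 𝕜 := by
          refine setLIntegral_mono_ae' measurableSet_Ioo (ae_of_all _ fun s hs => ?_)
          have hs0 : 0 < s := by linarith [hs.1]
          refine mul_le_mul' (ENNReal.ofReal_le_ofReal
            (pow_le_pow_left₀ (by norm_num) hs.1.le n)) (lintegral_mono_ae ?_)
          filter_upwards [ae_coneMeasure] with X hX
          have hm : s • X ∈ {X : Matrix (Fin 2) (Fin 2) 𝕜 | opNorm X < 1} := by
            change opNorm (s • X) < 1
            rw [opNorm_smul, hX, abs_of_pos hs0, mul_one]; exact hs.2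
          rw [Set.indicator_of_mem hm]
          obtain ⟨hF, hle⟩ := frobSq_of_opNorm_eq_one hX
          have e1 : discr (s • X) = s ^ 4 * (1 - ‖X.det‖ ^ 2) ^ 2 := by
            rw [discr, frobSq_smul, norm_det_smul, hF]; ring
          have e2 : ENNReal.ofReal (1 - ‖X.det‖ ^ 2) ^ (-kap 𝕜) =
              ENNReal.ofReal ((1 - ‖X.det‖ ^ 2) ^ 2) ^ (-(kap 𝕜 / 2)) := by
            rw [ENNReal.ofReal_pow (by linarith), ← ENNReal.rpow_natCast, ← ENNReal.rpow_mul]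
            congr 1; push_cast; ring
          rw [e2, e1]
          apply rpow_neg_le_rpow_neg (by linarith)
          apply ENNReal.ofReal_le_ofReal
          have : s ^ 4 ≤ 1 := pow_le_one₀ hs0.le hs.2.le
          nlinarith [sq_nonneg (1 - ‖X.det‖ ^ 2)]
      _ ≤ _ := lintegral_mono_set fun s hs => (by linarith [hs.1] : (0 : ℝ) < s)
  have h2 := h1.trans_lt lintegral_discr_lt_top
  by_contra hc
  rw [not_lt, top_le_iff] at hc
  rw [hc, ENNReal.mul_top] at h2
  · exact lt_irrefl _ h2
  · rw [Ne, ENNReal.ofReal_eq_zero, not_le]; positivity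

end ConeFinite

/-! ### Existence and continuity of the normalized η-limits -/

section EtaLimit

variable {𝕜 : Type*} [RCLike 𝕜] [MeasureSpace 𝕜] [BorelSpace 𝕜]
  [(volume : Measure 𝕜).IsAddHaarMeasure]

theorem tilt_eq_zero_iff {ε : ℝ} (hε : 0 < ε) (h1 : ε ≠ 1) {X : Matrix (Fin 2) (Fin 2) 𝕜} :
    tilt ε X = 0 ↔ ‖X 1 0‖ = ε * ‖X 0 1‖ := by
  have h2 : 1 - ε ^ 2 ≠ 0 := by
    intro h
    have : (1 - ε) * (1 + ε) = 0 := by linarith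
    rcases mul_eq_zero.1 this with h | h
    · exact h1 (by linarith)
    · linarith
  rw [tilt, mul_eq_zero, or_iff_right h2, sub_eq_zero, div_eq_iff (by positivity),
    ← sq_eq_sq₀ (norm_nonneg _) (by positivity)]
  constructor <;> intro h <;> rw [h] <;> ring

/-- The zero set is a cone, so by polar coordinates it is null on the sphere once its volume is
zero. For a fixed first row it confines one entry of the second row to a sphere in 𝕜. -/
theorem ae_tilt_ne_zero {ε : ℝ} (hε : 0 < ε) (h1 : ε ≠ 1) :
    ∀ᵐ X ∂coneMeasure 𝕜, tilt ε X ≠ 0 := by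
  set Z : Set (Matrix (Fin 2) (Fin 2) 𝕜) := {X | tilt ε X = 0} with hZ
  have hZm : MeasurableSet Z := measurableSet_eq_fun (measurable_tilt_right ε) measurable_const
  have hvol : ∫⁻ X : Matrix (Fin 2) (Fin 2) 𝕜, Z.indicator 1 X = 0 := by
    rw [lintegral_matrix_eq_rows (measurable_one.indicator hZm),
      ← lintegral_zero (μ := (volume : Measure (Fin 2 → 𝕜)))]
    apply lintegral_congr
    intro u
    rw [← lintegral_zero (μ := (volume : Measure (Fin 2 → 𝕜)))]
    apply lintegral_congr_ae
    have h0 : (volume : Measure (Fin 2 → 𝕜))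
        ((fun v => v 0) ⁻¹' Metric.sphere (0 : 𝕜) (ε * ‖u 1‖)) = 0 :=
      (Measure.quasiMeasurePreserving_eval (fun _ : Fin 2 => (volume : Measure 𝕜)) 0).preimage_null
        (Measure.addHaar_sphere _ _ _)
    filter_upwards [compl_mem_ae_iff.2 h0] with v hv
    apply Set.indicator_of_notMem
    intro hm
    apply hv
    have := (tilt_eq_zero_iff hε h1).1 (show tilt ε (Matrix.of ![u, v]) = 0 from hm)
    simpa using this
  rw [lintegral_eq_coneMeasure (measurable_one.indicator hZm)] at hvol
  have hscale : ∀ s ∈ Set.Ioi (0 : ℝ), ∫⁻ X, Z.indicator (1 : Matrix (Fin 2) (Fin 2) 𝕜 → ℝ≥0∞) (s • X) ∂coneMeasure 𝕜 =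
      coneMeasure 𝕜 Z := by
    intro s hs
    rw [← lintegral_indicator_one hZm]
    apply lintegral_congr
    intro X
    have : s • X ∈ Z ↔ X ∈ Z := by
      change tilt ε (s • X) = 0 ↔ tilt ε X = 0
      rw [tilt_smul, mul_eq_zero, or_iff_right (pow_ne_zero 2 (ne_of_gt hs))]
    by_cases hX : X ∈ Z
    · rw [Set.indicator_of_mem hX, Set.indicator_of_mem (this.2 hX)]; rfl
    · rw [Set.indicator_of_notMem hX, Set.indicator_of_notMem (fun h => hX (this.1 h))]
  have hpow : Measurable fun s : ℝ =>
      ENNReal.ofReal (s ^ (Module.finrank ℝ (Matrix (Fin 2) (Fin 2) 𝕜) - 1)) := by fun_prop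
  rw [setLIntegral_congr_fun measurableSet_Ioi (fun s hs => by rw [hscale s hs]),
    lintegral_mul_const _ hpow, mul_eq_zero] at hvol
  rcases hvol with h | h
  · exfalso
    rw [lintegral_eq_zero_iff hpow] at h
    have h3 := (ae_restrict_iff' measurableSet_Ioi).1 h
    have h4 : ∀ᵐ s : ℝ, ¬ (0 < s) := by
      filter_upwards [h3] with s hs hpos
      have := hs hpos
      rw [Pi.zero_apply, ENNReal.ofReal_eq_zero, ← not_lt] at this
      exact this (pow_pos hpos _)
    rw [ae_iff] at h4
    simp only [not_not] at h4
    have h5 : volume (Set.Ioi (0 : ℝ)) = 0 := h4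
    rw [Real.volume_Ioi] at h5
    exact ENNReal.top_ne_zero h5
  · exact compl_mem_ae_iff.2 h

theorem cone_rpow_le {a : ℝ} (ha : a ≤ kap 𝕜) (X : Matrix (Fin 2) (Fin 2) 𝕜) :
    ENNReal.ofReal (1 - ‖X.det‖ ^ 2) ^ (-a) ≤ ENNReal.ofReal (1 - ‖X.det‖ ^ 2) ^ (-kap 𝕜) := by
  apply ENNReal.rpow_le_rpow_of_exponent_ge _ (by linarith)
  apply ENNReal.ofReal_le_one.2
  nlinarith [sq_nonneg ‖X.det‖]

/-- A finite integral forces a finite integrand almost everywhere, so the unitary matrices are null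
on the sphere. -/
theorem ae_det_lt_one : ∀ᵐ X ∂coneMeasure 𝕜, 0 < 1 - ‖X.det‖ ^ 2 := by
  have hm : Measurable fun X : Matrix (Fin 2) (Fin 2) 𝕜 =>
      ENNReal.ofReal (1 - ‖X.det‖ ^ 2) ^ (-kap 𝕜) :=
    ((measurable_const.sub continuous_norm_det_sq.measurable).ennreal_ofReal).pow_const _
  filter_upwards [ae_lt_top hm lintegral_coneMeasure_lt_top.ne] with X hX
  by_contra h
  rw [ENNReal.ofReal_eq_zero.2 (not_lt.1 h), ENNReal.zero_rpow_of_neg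
    (by have := kap_pos (𝕜 := 𝕜); linarith)] at hX
  exact lt_irrefl _ hX

theorem tendsto_angular {a ε : ℝ} (ha : 0 ≤ a) (ha' : a ≤ kap 𝕜) (hε : 0 < ε) :
    Tendsto (angular 𝕜 a ε) (𝓝[<] 1) (𝓝 (angularLim 𝕜 a ε)) := by
  unfold angularLim
  refine tendsto_lintegral_filter_of_dominated_convergence
    (fun X => ENNReal.ofReal (1 - ‖X.det‖ ^ 2) ^ (-kap 𝕜))
    (Eventually.of_forall fun s => measurable_angular a ε s) ?_
    lintegral_coneMeasure_lt_top.ne ?_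
  · filter_upwards [Ioo_mem_nhdsLT (show (0 : ℝ) < 1 by norm_num)] with s hs
    refine ae_of_all _ fun X => (Set.indicator_le_self _ _ _).trans (le_trans ?_ (cone_rpow_le ha' X))
    apply rpow_neg_le_rpow_neg ha
    apply ENNReal.ofReal_le_ofReal
    have h1 : 0 ≤ 1 - s ^ 2 := by nlinarith [hs.1, hs.2]
    nlinarith [mul_nonneg h1 (sq_nonneg ‖X.det‖)]
  · have hae : ∀ᵐ X ∂coneMeasure 𝕜, ε ≠ 1 → tilt ε X ≠ 0 := by
      by_cases h1 : ε = 1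
      · exact ae_of_all _ fun X h => absurd h1 h
      · exact (ae_tilt_ne_zero hε h1).mono fun X h _ => h
    filter_upwards [ae_det_lt_one, hae] with X hX ht
    have hc : Continuous fun s : ℝ => ENNReal.ofReal (1 - s ^ 2 * ‖X.det‖ ^ 2) ^ (-a) :=
      ENNReal.continuous_rpow_const.comp (ENNReal.continuous_ofReal.comp (by fun_prop))
    have hc1 : Tendsto (fun s : ℝ => ENNReal.ofReal (1 - s ^ 2 * ‖X.det‖ ^ 2) ^ (-a)) (𝓝[<] 1)
        (𝓝 (ENNReal.ofReal (1 - ‖X.det‖ ^ 2) ^ (-a))) := by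
      have := (hc.tendsto 1).mono_left (nhdsWithin_le_nhds (s := Set.Iio 1))
      simpa using this
    -- For tilt ≤ 0 the inequality holds at every s in (0, 1), because its right side is positive;
    -- for tilt > 0 it fails near s = 1, where the right side tends to 0. Hence the limiting region
    -- is the closed one.
    by_cases hneg : tilt ε X ≤ 0
    · rw [Set.indicator_of_mem (show X ∈ {X | tilt ε X ≤ 0} from hneg)]
      refine hc1.congr' ?_
      filter_upwards [Ioo_mem_nhdsLT (show (0 : ℝ) < 1 by norm_num)] with s hs
      rw [Set.indicator_of_mem]
      change s ^ 2 * tilt ε X < (1 - s ^ 2) * (1 - s ^ 2 * ‖X.det‖ ^ 2)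
      have h1 : 0 < 1 - s ^ 2 := by nlinarith [hs.1, hs.2]
      have h2 : 0 < 1 - s ^ 2 * ‖X.det‖ ^ 2 := by nlinarith [mul_nonneg h1.le (sq_nonneg ‖X.det‖)]
      nlinarith [mul_pos h1 h2, mul_nonneg (sq_nonneg s) (neg_nonneg.2 hneg)]
    · rw [Set.indicator_of_notMem (show X ∉ {X | tilt ε X ≤ 0} from hneg)]
      refine tendsto_const_nhds.congr' ?_
      have hd : Continuous fun s : ℝ => s ^ 2 * tilt ε X -
        (1 - s ^ 2) * (1 - s ^ 2 * ‖X.det‖ ^ 2) := by fun_prop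
      have hd1 := (hd.tendsto 1).eventually (lt_mem_nhds (a := 0) (by simpa using hneg))
      filter_upwards [nhdsWithin_le_nhds hd1] with s hs
      rw [Set.indicator_of_notMem]
      intro hm
      have hm' : s ^ 2 * tilt ε X < (1 - s ^ 2) * (1 - s ^ 2 * ‖X.det‖ ^ 2) := hm
      linarith

theorem angularLim_ne_top {a ε : ℝ} (ha' : a ≤ kap 𝕜) : angularLim 𝕜 a ε ≠ ∞ :=
  ne_top_of_le_ne_top lintegral_coneMeasure_lt_top.ne
    (lintegral_mono fun X => (Set.indicator_le_self _ _ _).trans (cone_rpow_le ha' X))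

theorem one_le_rpow_neg {a x : ℝ} (ha : 0 ≤ a) (hx : x ≤ 1) : 1 ≤ ENNReal.ofReal x ^ (-a) := by
  have := rpow_neg_le_rpow_neg ha (ENNReal.ofReal_le_one.2 hx)
  rwa [ENNReal.one_rpow] at this

theorem angularLim_one_ne_zero {a : ℝ} (ha : 0 ≤ a) : angularLim 𝕜 a 1 ≠ 0 := by
  have h : coneMeasure 𝕜 Set.univ ≤ angularLim 𝕜 a 1 := by
    rw [← lintegral_one]
    refine lintegral_mono fun X => ?_
    rw [Set.indicator_of_mem (show X ∈ {X | tilt 1 X ≤ 0} from (tilt_one X).le)]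
    exact one_le_rpow_neg ha (by nlinarith [sq_nonneg ‖X.det‖])
  exact fun h0 => coneMeasure_univ_ne_zero (le_antisymm (h0 ▸ h) zero_le)

theorem le_angular_one {a s : ℝ} (ha : 0 ≤ a) (hs : s ∈ Set.Ioo (0 : ℝ) 1) :
    coneMeasure 𝕜 Set.univ ≤ angular 𝕜 a 1 s := by
  rw [← lintegral_one]
  refine lintegral_mono_ae ?_
  filter_upwards [ae_det_lt_one] with X hX
  have h1 : 0 < 1 - s ^ 2 := by nlinarith [hs.1, hs.2]
  have h2 : 0 < 1 - s ^ 2 * ‖X.det‖ ^ 2 := by nlinarith [mul_nonneg h1.le (sq_nonneg ‖X.det‖)]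
  rw [Set.indicator_of_mem]
  · exact one_le_rpow_neg ha (by nlinarith [mul_nonneg (sq_nonneg s) (sq_nonneg ‖X.det‖)])
  · change s ^ 2 * tilt 1 X < (1 - s ^ 2) * (1 - s ^ 2 * ‖X.det‖ ^ 2)
    rw [tilt_one, mul_zero]
    positivity

theorem angular_le_top {a ε s : ℝ} (ha : 0 ≤ a) (ha' : a ≤ kap 𝕜) (hs : s ∈ Set.Ioo (0 : ℝ) 1) :
    angular 𝕜 a ε s ≤ ∫⁻ X, ENNReal.ofReal (1 - ‖X.det‖ ^ 2) ^ (-kap 𝕜) ∂coneMeasure 𝕜 :=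
  (angular_le ha ε s hs).trans (lintegral_mono fun X => cone_rpow_le ha' X)

theorem lintegral_radialWeight_ne_zero (a : ℝ) {r : ℝ} (hr : 0 < r) (hr1 : r ≤ 1) :
    ∫⁻ s in Set.Ioo 0 r, radialWeight 𝕜 a s ≠ 0 := by
  rw [Ne, setLIntegral_eq_zero_iff measurableSet_Ioo (measurable_radialWeight a)]
  intro h
  have h4 : volume (Set.Ioo 0 r) = 0 := by
    refine measure_mono_null ?_ (ae_iff.1 h)
    intro s hs
    have hp : 0 < 1 - s ^ 2 := by nlinarith [hs.1, hs.2]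
    simp only [Set.mem_ofPred_eq, Classical.not_imp]
    refine ⟨hs, ?_⟩
    rw [radialWeight, ENNReal.ofReal_rpow_of_pos hp, mul_eq_zero, not_or, ENNReal.ofReal_eq_zero,
      ENNReal.ofReal_eq_zero, not_le, not_le]
    exact ⟨pow_pos hs.1 _, by positivity⟩
  rw [Real.volume_Ioo, ENNReal.ofReal_eq_zero] at h4
  linarith

theorem etaReg_one_ne_zero {δ r : ℝ} (hδ : 0 ≤ δ) (hr : 0 < r) (hr1 : r ≤ 1) :
    etaReg 𝕜 δ r 1 ≠ 0 := by
  have ha : 0 ≤ kap 𝕜 * δ := mul_nonneg kap_pos.le hδ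
  rw [etaReg_eq_lintegral hr1 one_ne_zero]
  have h : (∫⁻ s in Set.Ioo 0 r, radialWeight 𝕜 (kap 𝕜 * δ) s) * coneMeasure 𝕜 Set.univ ≤
      ∫⁻ s in Set.Ioo 0 r, radialWeight 𝕜 (kap 𝕜 * δ) s * angular 𝕜 (kap 𝕜 * δ) 1 s := by
    rw [← lintegral_mul_const _ (measurable_radialWeight _)]
    refine setLIntegral_mono_ae' measurableSet_Ioo (ae_of_all _ fun s hs => ?_)
    exact mul_le_mul_right (le_angular_one ha ⟨hs.1, hs.2.trans_le hr1⟩) _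
  intro h0
  rw [h0, nonpos_iff_eq_zero, mul_eq_zero] at h
  rcases h with h | h
  · exact lintegral_radialWeight_ne_zero _ hr hr1 h
  · exact coneMeasure_univ_ne_zero h

theorem etaReg_le {δ r ε : ℝ} (hδ : 0 ≤ δ) (hδ1 : δ ≤ 1) (hr : r ≤ 1) (hε : ε ≠ 0) :
    etaReg 𝕜 δ r ε ≤ (∫⁻ s in Set.Ioo 0 r, radialWeight 𝕜 (kap 𝕜 * δ) s) *
      ∫⁻ X, ENNReal.ofReal (1 - ‖X.det‖ ^ 2) ^ (-kap 𝕜) ∂coneMeasure 𝕜 := by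
  have ha : 0 ≤ kap 𝕜 * δ := mul_nonneg kap_pos.le hδ
  have ha' : kap 𝕜 * δ ≤ kap 𝕜 := mul_le_of_le_one_right kap_pos.le hδ1
  rw [etaReg_eq_lintegral hr hε, ← lintegral_mul_const _ (measurable_radialWeight _)]
  refine setLIntegral_mono_ae' measurableSet_Ioo (ae_of_all _ fun s hs => ?_)
  exact mul_le_mul_right (angular_le_top ha ha' ⟨hs.1, hs.2.trans_le hr⟩) _

theorem etaReg_ne_top {δ r ε : ℝ} (hδ : 0 ≤ δ) (hδ1 : δ ≤ 1) (hr : r < 1) (hε : ε ≠ 0) :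
    etaReg 𝕜 δ r ε ≠ ∞ :=
  ne_top_of_le_ne_top (ENNReal.mul_ne_top
    (lintegral_radialWeight_ne_top (mul_nonneg kap_pos.le hδ) hr)
    lintegral_coneMeasure_lt_top.ne) (etaReg_le hδ hδ1 hr.le hε)

theorem etaReg_le_one {δ r ε : ℝ} (hr : r ≤ 1) : etaReg 𝕜 δ r ε ≤ etaReg 𝕜 δ r 1 := by
  apply lintegral_mono_set
  intro X hX
  refine ⟨hX.1, ?_⟩
  rw [opNorm_diagV_conj_lt_one_iff one_ne_zero (hX.1.trans_le hr), tilt_one]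
  exact ((opNorm_lt_one_iff X).1 (hX.1.trans_le hr)).2

/-- Dividing both integrals by the same radial mass makes each a weighted average of its angular
part. -/
theorem tendsto_etaReg_div_of_eq_top {δ ε : ℝ} (hδ : 0 ≤ δ) (hδ1 : δ ≤ 1) (hε : 0 < ε)
    (hinf : ∫⁻ s in Set.Ioo (0 : ℝ) 1, radialWeight 𝕜 (kap 𝕜 * δ) s = ∞) :
    Tendsto (fun r => etaReg 𝕜 δ r ε / etaReg 𝕜 δ r 1) (𝓝[<] 1)
      (𝓝 (angularLim 𝕜 (kap 𝕜 * δ) ε / angularLim 𝕜 (kap 𝕜 * δ) 1)) := by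
  have ha : 0 ≤ kap 𝕜 * δ := mul_nonneg kap_pos.le hδ
  have ha' : kap 𝕜 * δ ≤ kap 𝕜 := mul_le_of_le_one_right kap_pos.le hδ1
  have key : ∀ ε : ℝ, 0 < ε → Tendsto
      (fun r => etaReg 𝕜 δ r ε / ∫⁻ s in Set.Ioo 0 r, radialWeight 𝕜 (kap 𝕜 * δ) s) (𝓝[<] 1)
      (𝓝 (angularLim 𝕜 (kap 𝕜 * δ) ε)) := by
    intro ε hε
    refine (tendsto_weighted_average (measurable_radialWeight _)
      (fun r hr => lintegral_radialWeight_ne_top ha hr) hinf lintegral_coneMeasure_lt_top.ne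
      (fun s hs => angular_le_top ha ha' hs) (tendsto_angular ha ha' hε)).congr' ?_
    filter_upwards [self_mem_nhdsWithin] with r hr
    rw [etaReg_eq_lintegral (le_of_lt hr) hε.ne']
  refine (ENNReal.Tendsto.div (key ε hε) (Or.inr (angularLim_one_ne_zero ha)) (key 1 one_pos)
    (Or.inl (angularLim_ne_top ha'))).congr' ?_
  filter_upwards [Ioo_mem_nhdsLT (show (0 : ℝ) < 1 by norm_num)] with r hr
  have h0 := lintegral_radialWeight_ne_zero (𝕜 := 𝕜) (kap 𝕜 * δ) hr.1 hr.2.le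
  have h1 := lintegral_radialWeight_ne_top (𝕜 := 𝕜) ha hr.2
  simp only [ENNReal.div_eq_inv_mul (b := ∫⁻ s in Set.Ioo 0 r, radialWeight 𝕜 (kap 𝕜 * δ) s)]
  exact ENNReal.mul_div_mul_left _ _ (ENNReal.inv_ne_zero.2 h1) (ENNReal.inv_ne_top.2 h0)

theorem exists_tendsto_etaReg_div {δ ε : ℝ} (hδ : 0 ≤ δ) (hδ1 : δ ≤ 1) (hε : 0 < ε) :
    ∃ L, Tendsto (fun r => etaReg 𝕜 δ r ε / etaReg 𝕜 δ r 1) (𝓝[<] 1) (𝓝 L) := by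
  by_cases hinf : ∫⁻ s in Set.Ioo (0 : ℝ) 1, radialWeight 𝕜 (kap 𝕜 * δ) s = ∞
  · exact ⟨_, tendsto_etaReg_div_of_eq_top hδ hδ1 hε hinf⟩
  -- With a weight of finite mass both integrals converge to finite values at r = 1, and the
  -- quotient of the limits is the limit.
  · have key : ∀ ε : ℝ, 0 < ε → Tendsto (fun r => etaReg 𝕜 δ r ε) (𝓝[<] 1)
        (𝓝 (etaReg 𝕜 δ 1 ε)) := by
      intro ε hε
      rw [etaReg_eq_lintegral le_rfl hε.ne']
      refine (tendsto_setLIntegral_Ioo _).congr' ?_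
      filter_upwards [self_mem_nhdsWithin] with r hr
      rw [etaReg_eq_lintegral (le_of_lt hr) hε.ne']
    have hfin : etaReg 𝕜 δ 1 1 ≠ ∞ := by
      have h := etaReg_le (𝕜 := 𝕜) (ε := 1) hδ hδ1 le_rfl one_ne_zero
      exact ne_top_of_le_ne_top (ENNReal.mul_ne_top hinf lintegral_coneMeasure_lt_top.ne) h
    exact ⟨_, ENNReal.Tendsto.div (key ε hε) (Or.inr (etaReg_one_ne_zero hδ one_pos le_rfl))
      (key 1 one_pos) (Or.inl hfin)⟩

theorem tendsto_etaQuot {δ ε : ℝ} (hδ : 0 ≤ δ) (hδ1 : δ ≤ 1) (hε : 0 < ε) :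
    Tendsto (fun r => etaReg 𝕜 δ r ε / etaReg 𝕜 δ r 1) (𝓝[<] 1) (𝓝 (etaQuot 𝕜 δ ε)) :=
  tendsto_nhds_limUnder (exists_tendsto_etaReg_div hδ hδ1 hε)

theorem etaQuot_eq {δ ε : ℝ} (hδ : 1 ≤ kap 𝕜 * δ) (hδ1 : δ ≤ 1) (hε : 0 < ε) :
    etaQuot 𝕜 δ ε = angularLim 𝕜 (kap 𝕜 * δ) ε / angularLim 𝕜 (kap 𝕜 * δ) 1 := by
  have h0 : 0 ≤ δ := by
    by_contra h
    nlinarith [kap_pos (𝕜 := 𝕜)]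
  exact (tendsto_etaReg_div_of_eq_top h0 hδ1 hε (lintegral_radialWeight_eq_top hδ)).limUnder_eq

theorem etaQuot_le_one {δ ε : ℝ} (hδ : 0 ≤ δ) (hδ1 : δ ≤ 1) (hε : 0 < ε) :
    etaQuot 𝕜 δ ε ≤ 1 := by
  refine le_of_tendsto (tendsto_etaQuot hδ hδ1 hε) ?_
  filter_upwards [self_mem_nhdsWithin] with r hr
  exact ENNReal.div_le_of_le_mul (by rw [one_mul]; exact etaReg_le_one (le_of_lt hr))

theorem tendsto_angularLim (ε : ℝ) :
    Tendsto (fun δ => angularLim 𝕜 (kap 𝕜 * δ) ε) (𝓝[<] 1) (𝓝 (angularLim 𝕜 (kap 𝕜 * 1) ε)) := by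
  have hmd : Measurable fun X : Matrix (Fin 2) (Fin 2) 𝕜 => ENNReal.ofReal (1 - ‖X.det‖ ^ 2) :=
    (measurable_const.sub continuous_norm_det_sq.measurable).ennreal_ofReal
  have hms : MeasurableSet {X : Matrix (Fin 2) (Fin 2) 𝕜 | tilt ε X ≤ 0} :=
    measurableSet_le (measurable_tilt_right ε) measurable_const
  refine tendsto_lintegral_filter_of_dominated_convergence
    (fun X => ENNReal.ofReal (1 - ‖X.det‖ ^ 2) ^ (-kap 𝕜))
    (Eventually.of_forall fun δ => (hmd.pow_const _).indicator hms) ?_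
    lintegral_coneMeasure_lt_top.ne ?_
  · filter_upwards [self_mem_nhdsWithin] with δ hδ
    exact ae_of_all _ fun X => (Set.indicator_le_self _ _ _).trans
      (cone_rpow_le (mul_le_of_le_one_right kap_pos.le (le_of_lt hδ)) X)
  · filter_upwards [ae_det_lt_one] with X hX
    by_cases hm : X ∈ {X : Matrix (Fin 2) (Fin 2) 𝕜 | tilt ε X ≤ 0}
    · simp only [Set.indicator_of_mem hm, ENNReal.ofReal_rpow_of_pos hX]
      have hc : Continuous fun δ : ℝ =>
          ENNReal.ofReal ((1 - ‖X.det‖ ^ 2) ^ (-(kap 𝕜 * δ))) :=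
        ENNReal.continuous_ofReal.comp
          (Continuous.rpow continuous_const (by fun_prop) fun _ => Or.inl hX.ne')
      exact (hc.tendsto 1).mono_left nhdsWithin_le_nhds
    · simp only [Set.indicator_of_notMem hm]
      exact tendsto_const_nhds

theorem tendsto_etaQuot_one {ε : ℝ} (hε : 0 < ε) :
    Tendsto (fun δ => etaQuot 𝕜 δ ε) (𝓝[<] 1) (𝓝 (etaQuot 𝕜 1 ε)) := by
  have hk := one_lt_kap (𝕜 := 𝕜)
  rw [etaQuot_eq (by linarith) le_rfl hε]
  refine (ENNReal.Tendsto.div (tendsto_angularLim ε)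
    (Or.inr (angularLim_one_ne_zero (by linarith))) (tendsto_angularLim 1)
    (Or.inl (angularLim_ne_top (by linarith)))).congr' ?_
  -- The explicit ratio is available once κδ ≥ 1, that is for δ ≥ 1/κ.
  have hlt : (kap 𝕜)⁻¹ < 1 := inv_lt_one_of_one_lt₀ hk
  filter_upwards [Ioo_mem_nhdsLT hlt] with δ hδ
  refine (etaQuot_eq ?_ hδ.2.le hε).symm
  have := mul_le_mul_of_nonneg_left hδ.1.le (kap_pos (𝕜 := 𝕜)).le
  rwa [mul_inv_cancel₀ (kap_pos (𝕜 := 𝕜)).ne'] at this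

theorem etaNorm_eq {ε : ℝ} (hε : 0 < ε) : etaNorm 𝕜 ε = etaQuot 𝕜 1 ε :=
  (tendsto_etaQuot_one hε).limUnder_eq

theorem eta_one_eq_top : eta 𝕜 1 = ∞ := by
  have h : eta 𝕜 1 = etaReg 𝕜 1 1 1 := by rw [eta, etaReg, mul_one]
  have hk := one_lt_kap (𝕜 := 𝕜)
  rw [h, etaReg_eq_lintegral le_rfl one_ne_zero, eq_top_iff]
  calc ∞ = (∫⁻ s in Set.Ioo (0 : ℝ) 1, radialWeight 𝕜 (kap 𝕜 * 1) s) *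
        coneMeasure 𝕜 Set.univ := by
        rw [lintegral_radialWeight_eq_top (by linarith), ENNReal.top_mul coneMeasure_univ_ne_zero]
    _ ≤ _ := by
        rw [← lintegral_mul_const _ (measurable_radialWeight _)]
        refine setLIntegral_mono_ae' measurableSet_Ioo (ae_of_all _ fun s hs => ?_)
        exact mul_le_mul_right (le_angular_one (by linarith) hs) _

end EtaLimit

/-! ### Positive square roots of matrices -/

section SquareRoot

variable {𝕜 : Type*} [RCLike 𝕜] {n : Type*} [Fintype n] [DecidableEq n]

theorem spectrum_nonneg {A : Matrix n n 𝕜} (hA : A.PosSemidef) {x : ℝ} (hx : x ∈ spectrum ℝ A) :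
    0 ≤ x := by
  rw [hA.1.spectrum_real_eq_range_eigenvalues] at hx
  obtain ⟨i, rfl⟩ := hx
  exact hA.eigenvalues_nonneg i

theorem cfc_sqrt_mul_cfc_sqrt {A : Matrix n n 𝕜} (hA : A.PosSemidef) :
    cfc Real.sqrt A * cfc Real.sqrt A = A := by
  have h : IsSelfAdjoint A := hA.1.isSelfAdjoint
  rw [← cfc_mul Real.sqrt Real.sqrt A (by fun_prop) (by fun_prop)]
  conv_rhs => rw [← cfc_id ℝ A h]
  exact cfc_congr fun x hx => Real.mul_self_sqrt (spectrum_nonneg hA hx)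

theorem posSemidef_cfc_sqrt {A : Matrix n n 𝕜} (hA : A.PosSemidef) :
    (cfc Real.sqrt A).PosSemidef := by
  rw [hA.1.cfc_eq, Matrix.IsHermitian.cfc, Unitary.conjStarAlgAut_apply]
  refine Matrix.PosSemidef.mul_mul_conjTranspose_same (Matrix.PosSemidef.diagonal ?_) _
  intro i
  simp [Real.sqrt_nonneg]

theorem posDef_cfc_sqrt {A : Matrix n n 𝕜} (hA : A.PosDef) : (cfc Real.sqrt A).PosDef := by
  rw [(posSemidef_cfc_sqrt hA.posSemidef).posDef_iff_isUnit]
  have h : IsUnit (cfc Real.sqrt A * cfc Real.sqrt A) := by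
    rw [cfc_sqrt_mul_cfc_sqrt hA.posSemidef]; exact hA.isUnit
  rw [Matrix.isUnit_iff_isUnit_det, Matrix.det_mul, IsUnit.mul_iff] at h
  exact (Matrix.isUnit_iff_isUnit_det _).2 h.1

theorem cfc_sqrt_mul_self {B : Matrix n n 𝕜} (hB : B.PosSemidef) :
    cfc Real.sqrt (B * B) = B := by
  have h : IsSelfAdjoint B := hB.1.isSelfAdjoint
  have e : B * B = cfc (fun x : ℝ => x * x) B := by
    rw [cfc_mul (fun x : ℝ => x) (fun x : ℝ => x) B (by fun_prop) (by fun_prop)]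
    change B * B = cfc (id : ℝ → ℝ) B * cfc (id : ℝ → ℝ) B
    rw [cfc_id ℝ B h]
  rw [e, ← cfc_comp Real.sqrt (fun x : ℝ => x * x) B h (by fun_prop) (by fun_prop)]
  conv_rhs => rw [← cfc_id ℝ B h]
  exact cfc_congr fun x hx => Real.sqrt_mul_self (spectrum_nonneg hB hx)

theorem cfc_sqrt_unique {A B : Matrix n n 𝕜} (hB : B.PosSemidef) (h : B * B = A) :
    cfc Real.sqrt A = B := h ▸ cfc_sqrt_mul_self hB

end SquareRoot

/-! ### The monotone metric of √x -/

section Petz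

variable {𝕜 : Type*} [RCLike 𝕜] {n : Type*} [Fintype n] [DecidableEq n]

/-- Left and right multiplication commute, so for f = √x the operator collapses to L^{1/2} R^{1/2}.
Each functional calculus is identified through uniqueness of the positive square root. -/
theorem petzOp_sqrt {D : Matrix n n 𝕜} (hD : D.PosDef) :
    petzOp Real.sqrt D = (cfc Real.sqrt D)ᵀ ⊗ₖ cfc Real.sqrt D := by
  set R := cfc Real.sqrt D with hR
  have hRR : R * R = D := cfc_sqrt_mul_cfc_sqrt hD.posSemidef
  have hRp : R.PosDef := posDef_cfc_sqrt hD
  have hRt : Rᵀ.PosDef := hRp.transpose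
  have hdet : IsUnit Rᵀ.det := (Matrix.isUnit_iff_isUnit_det _).1 hRt.isUnit
  have h1 : cfc Real.sqrt (rightMul D) = Rᵀ ⊗ₖ (1 : Matrix n n 𝕜) := by
    apply cfc_sqrt_unique
    · exact hRt.posSemidef.kronecker Matrix.PosSemidef.one
    · rw [← Matrix.mul_kronecker_mul, ← Matrix.transpose_mul, hRR, one_mul, rightMul]
  have h2 : cfc Real.sqrt (leftMul D * (rightMul D)⁻¹) = (Rᵀ)⁻¹ ⊗ₖ R := by
    apply cfc_sqrt_unique
    · exact hRt.inv.posSemidef.kronecker hRp.posSemidef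
    · rw [leftMul, rightMul, Matrix.inv_kronecker, ← Matrix.mul_kronecker_mul,
        ← Matrix.mul_kronecker_mul, hRR, inv_one, one_mul, mul_one, ← Matrix.mul_inv_rev,
        ← Matrix.transpose_mul, hRR]
  rw [petzOp, h1, h2, ← Matrix.mul_kronecker_mul, ← Matrix.mul_kronecker_mul, one_mul, mul_one,
    Matrix.mul_nonsing_inv _ hdet, one_mul]

theorem petzMetric_sqrt {D : Matrix n n 𝕜} (hD : D.PosDef) (X Y : Matrix n n 𝕜) :
    petzMetric Real.sqrt D X Y =
      RCLike.re (X * ((cfc Real.sqrt D)⁻¹ * Y * (cfc Real.sqrt D)⁻¹)).trace := by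
  rw [petzMetric, petzOp_sqrt hD, Matrix.inv_kronecker, Matrix.kronecker_mulVec_vec,
    Matrix.vec_dotProduct_vec, Matrix.transpose_transpose, Matrix.transpose_nonsing_inv,
    Matrix.transpose_transpose]

end Petz

/-! ### Gram determinants on the tangent space -/

section Gram

variable {𝕜 : Type*} [RCLike 𝕜] {n : Type*} [Fintype n] [DecidableEq n]

/-- The Hilbert-Schmidt pairing of matrices. -/
def hsPair (A B : Matrix n n 𝕜) : ℝ := RCLike.re (A * B).trace

theorem hsPair_self {A : Matrix n n 𝕜} (hA : A.IsHermitian) (h : hsPair A A = 0) : A = 0 := by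
  have h1 := (Matrix.posSemidef_conjTranspose_mul_self A).trace_nonneg
  rw [hA.eq] at h1
  have h2 : (A * A).trace = 0 := by
    rw [RCLike.nonneg_iff] at h1
    apply RCLike.ext
    · rw [map_zero]; exact h
    · rw [map_zero]; exact h1.2
  rw [← Matrix.trace_conjTranspose_mul_self_eq_zero_iff (A := A), hA.eq]
  exact h2

theorem hsPair_sum_right {ι : Type*} (s : Finset ι) (A : Matrix n n 𝕜) (c : ι → ℝ)
    (B : ι → Matrix n n 𝕜) : hsPair A (∑ i ∈ s, c i • B i) = ∑ i ∈ s, c i * hsPair A (B i) := by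
  simp only [hsPair, Matrix.mul_sum, Matrix.trace_sum, map_sum, Matrix.mul_smul, Matrix.trace_smul]
  refine Finset.sum_congr rfl fun i _ => ?_
  rw [RCLike.smul_re]

theorem hsPair_sum_left {ι : Type*} (s : Finset ι) (A : Matrix n n 𝕜) (c : ι → ℝ)
    (B : ι → Matrix n n 𝕜) : hsPair (∑ i ∈ s, c i • B i) A = ∑ i ∈ s, c i * hsPair (B i) A := by
  simp only [hsPair, Matrix.sum_mul, Matrix.trace_sum, map_sum, Matrix.smul_mul, Matrix.trace_smul]
  refine Finset.sum_congr rfl fun i _ => ?_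
  rw [RCLike.smul_re]

/-- The Gram matrix of a basis of the tangent space for the Hilbert-Schmidt pairing. -/
def hsGram {ι : Type*} (b : ι → tangent 𝕜 n) : Matrix ι ι ℝ :=
  Matrix.of fun i j => hsPair (b i : Matrix n n 𝕜) (b j)

/-- A kernel vector of the Gram matrix would give a self-adjoint B with Tr B² = 0, hence B = 0. -/
theorem det_hsGram_ne_zero {ι : Type*} [Fintype ι] [DecidableEq ι]
    (b : Module.Basis ι ℝ (tangent 𝕜 n)) : (hsGram b).det ≠ 0 := by
  intro h
  obtain ⟨v, hv, hv0⟩ := Matrix.exists_mulVec_eq_zero_iff.2 h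
  apply hv
  set B : tangent 𝕜 n := ∑ i, v i • b i with hB
  have hBc : (B : Matrix n n 𝕜) = ∑ i, v i • (b i : Matrix n n 𝕜) := by
    rw [hB]; simp
  have h0 : hsPair (B : Matrix n n 𝕜) B = 0 := by
    rw [hBc, hsPair_sum_left]
    apply Finset.sum_eq_zero
    intro i _
    rw [hsPair_sum_right]
    have := congrFun hv0 i
    simp only [Matrix.mulVec, dotProduct, hsGram, Matrix.of_apply, Pi.zero_apply] at this
    rw [Finset.sum_congr rfl fun j _ => mul_comm (v j) _, this, mul_zero]
  have hB0 : B = 0 := Subtype.ext (hsPair_self B.2.1 h0)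
  have := congrArg b.equivFun hB0
  rw [hB, map_zero] at this
  rw [← this]
  ext i
  rw [Module.Basis.equivFun_apply]
  simp [Finsupp.single_apply]

/-- Makes the quotient of Gram determinants in `volDensity` the determinant of an operator, whatever
the basis. -/
theorem det_hsGram_linearMap {ι : Type*} [Fintype ι] [DecidableEq ι]
    (b : Module.Basis ι ℝ (tangent 𝕜 n)) (L : tangent 𝕜 n →ₗ[ℝ] tangent 𝕜 n) :
    (Matrix.of fun i j => hsPair (b i : Matrix n n 𝕜) (L (b j))).det =
      (hsGram b).det * LinearMap.det L := by
  rw [← LinearMap.det_toMatrix b, ← Matrix.det_mul]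
  congr 1
  ext i j
  have h : L (b j) = ∑ k, (LinearMap.toMatrix b b L k j) • b k := by
    conv_lhs => rw [← b.sum_repr (L (b j))]
    simp [LinearMap.toMatrix_apply]
  rw [Matrix.of_apply, h, Matrix.mul_apply, Submodule.coe_sum]
  simp only [Submodule.coe_smul]
  rw [hsPair_sum_right]
  simp only [hsGram, Matrix.of_apply]
  exact Finset.sum_congr rfl fun k _ => mul_comm _ _

end Gram

/-! ### The determinant of A ↦ S A S* on self-adjoint matrices -/

section HermitianConjugation

variable {𝕜 : Type*} [RCLike 𝕜] {n : Type*} [Fintype n] [DecidableEq n]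

/-- The real vector space of self-adjoint matrices. -/
def hermSub (𝕜 : Type*) [RCLike 𝕜] (n : Type*) [Fintype n] [DecidableEq n] :
    Submodule ℝ (Matrix n n 𝕜) where
  carrier := {A | A.IsHermitian}
  zero_mem' := Matrix.isHermitian_zero
  add_mem' := fun hA hB => Matrix.IsHermitian.add hA hB
  smul_mem' := by
    intro c A hA
    change (c • A)ᴴ = c • A
    rw [Matrix.conjTranspose_smul, star_trivial]
    congr 1

/-- The action `A ↦ S A S*` on self-adjoint matrices. -/
def hermConj (S : Matrix n n 𝕜) : hermSub 𝕜 n →ₗ[ℝ] hermSub 𝕜 n where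
  toFun A := ⟨S * A * Sᴴ, Matrix.isHermitian_mul_mul_conjTranspose S A.2⟩
  map_add' A B := Subtype.ext (by simp [mul_add, add_mul])
  map_smul' c A := Subtype.ext (by simp)

theorem hermConj_mul (S T : Matrix n n 𝕜) : hermConj (S * T) = hermConj S ∘ₗ hermConj T := by
  apply LinearMap.ext
  intro A
  apply Subtype.ext
  simp [hermConj, Matrix.mul_assoc]

theorem hermConj_one : hermConj (1 : Matrix n n 𝕜) = LinearMap.id := by
  apply LinearMap.ext
  intro A
  apply Subtype.ext
  simp [hermConj]

/-- Diagonal and upper triangular entries as coordinates on the self-adjoint matrices. -/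
def hermCoord (e : n → ℕ) (he : Function.Injective e) :
    hermSub 𝕜 n ≃ₗ[ℝ] (n → ℝ) × ({p : n × n // e p.1 < e p.2} → 𝕜) where
  toFun A := (fun i => RCLike.re ((A : Matrix n n 𝕜) i i), fun p => (A : Matrix n n 𝕜) p.1.1 p.1.2)
  map_add' A B := by ext <;> simp
  map_smul' c A := by ext <;> simp [RCLike.smul_re]
  invFun x := ⟨Matrix.of fun i j => if h : e i < e j then x.2 ⟨(i, j), h⟩ else
      if h' : e j < e i then star (x.2 ⟨(j, i), h'⟩) else (x.1 i : 𝕜), by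
    ext i j
    rw [Matrix.conjTranspose_apply]
    rcases lt_trichotomy (e i) (e j) with h | h | h
    · simp [h, h.not_gt]
    · simp [he h]
    · simp [h, h.not_gt]⟩
  left_inv A := by
    apply Subtype.ext
    ext i j
    have hA := A.2
    rcases lt_trichotomy (e i) (e j) with h | h | h
    · simp [h]
    · obtain rfl := he h
      simp only [lt_irrefl, dite_false, Matrix.of_apply]
      exact RCLike.conj_eq_iff_re.1 (hA.apply i i)
    · simp only [h.not_gt, h, dite_false, dite_true, Matrix.of_apply]
      exact hA.apply i j
  right_inv x := by
    ext i
    · simp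
    · obtain ⟨⟨a, b⟩, hab⟩ := i
      simp only [Matrix.of_apply]
      rw [dif_pos hab]

/-- Entry (i, j) is multiplied by l_i l_j; a diagonal entry is one real coordinate, an entry above
the diagonal is d of them. The injection e only supplies an order on the indices. -/
theorem det_hermConj_diagonal (e : n → ℕ) (he : Function.Injective e) (l : n → ℝ) :
    LinearMap.det (hermConj (Matrix.diagonal fun i => (l i : 𝕜))) =
      (∏ i, l i ^ 2) * ∏ p : {p : n × n // e p.1 < e p.2},
        (l p.1.1 * l p.1.2) ^ Module.finrank ℝ 𝕜 := by
  set F : (n → ℝ) × ({p : n × n // e p.1 < e p.2} → 𝕜) →ₗ[ℝ] _ :=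
    LinearMap.prodMap
      (LinearMap.pi fun i => ((l i ^ 2) • (LinearMap.id : ℝ →ₗ[ℝ] ℝ)).comp (LinearMap.proj i))
      (LinearMap.pi fun p : {p : n × n // e p.1 < e p.2} =>
        ((l p.1.1 * l p.1.2) • (LinearMap.id : 𝕜 →ₗ[ℝ] 𝕜)).comp (LinearMap.proj p)) with hF
  have hdet : LinearMap.det F = (∏ i, l i ^ 2) * ∏ p : {p : n × n // e p.1 < e p.2},
      (l p.1.1 * l p.1.2) ^ Module.finrank ℝ 𝕜 := by
    rw [hF, LinearMap.det_prodMap, LinearMap.det_pi, LinearMap.det_pi]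
    simp
  have hc : (hermCoord e he).toLinearMap ∘ₗ hermConj (Matrix.diagonal fun i => (l i : 𝕜)) ∘ₗ
      (hermCoord e he).symm.toLinearMap = F := by
    apply LinearMap.ext
    intro x
    obtain ⟨A, rfl⟩ := (hermCoord (𝕜 := 𝕜) e he).surjective x
    simp only [LinearMap.comp_apply, LinearEquiv.coe_coe, LinearEquiv.symm_apply_apply]
    have hentry : ∀ i j, ((hermConj (Matrix.diagonal fun i => (l i : 𝕜)) A : hermSub 𝕜 n) :
        Matrix n n 𝕜) i j = ((l i * l j : ℝ) : 𝕜) * (A : Matrix n n 𝕜) i j := by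
      intro i j
      simp [hermConj, Matrix.diagonal_conjTranspose, Matrix.mul_diagonal, Matrix.diagonal_mul]
      ring
    ext i
    · simp only [hermCoord, LinearEquiv.coe_mk, LinearMap.coe_mk, AddHom.coe_mk, hentry, hF]
      simp [sq]
    · simp only [hermCoord, LinearEquiv.coe_mk, LinearMap.coe_mk, AddHom.coe_mk, hentry, hF]
      simp [RCLike.real_smul_eq_coe_mul]
  rw [← hdet, ← hc]
  exact (LinearMap.det_conj (hermConj (Matrix.diagonal fun i => (l i : 𝕜)))
    (hermCoord (𝕜 := 𝕜) e he)).symm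

theorem det_hermConj_unitary (S : Matrix n n 𝕜) (U : Matrix.unitaryGroup n 𝕜) :
    LinearMap.det (hermConj ((U : Matrix n n 𝕜) * S * star (U : Matrix n n 𝕜))) =
      LinearMap.det (hermConj S) := by
  have h : LinearMap.det (hermConj (U : Matrix n n 𝕜)) *
      LinearMap.det (hermConj (star (U : Matrix n n 𝕜))) = 1 := by
    rw [← LinearMap.det_comp, ← hermConj_mul, Unitary.mul_star_self_of_mem U.2, hermConj_one,
      LinearMap.det_id]
  rw [hermConj_mul, hermConj_mul, LinearMap.det_comp, LinearMap.det_comp, mul_right_comm, h,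
    one_mul]

/-- Unitary conjugation reduces to a diagonal S, and each of the four eigenvalues occurs in three of
the six pairs. -/
theorem det_hermConj_four {S : Matrix (Fin 2 ⊕ Fin 2) (Fin 2 ⊕ Fin 2) 𝕜} (hS : S.IsHermitian) :
    LinearMap.det (hermConj S) = RCLike.re S.det ^ (2 + 3 * Module.finrank ℝ 𝕜) := by
  set e : Fin 2 ⊕ Fin 2 → ℕ := Sum.elim (fun i => (i : ℕ)) (fun i => (i : ℕ) + 2) with he
  have hinj : Function.Injective e := by
    intro a b h
    rcases a with a | a <;> rcases b with b | b <;> fin_cases a <;> fin_cases b <;> simp_all [e]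
  have h1 : LinearMap.det (hermConj S) =
      LinearMap.det (hermConj (Matrix.diagonal fun i => (hS.eigenvalues i : 𝕜))) := by
    conv_lhs => rw [hS.spectral_theorem]
    rw [Unitary.conjStarAlgAut_apply]
    exact det_hermConj_unitary _ _
  have h2 : RCLike.re S.det = ∏ i, hS.eigenvalues i := by
    rw [hS.det_eq_prod_eigenvalues, ← RCLike.ofReal_prod, RCLike.ofReal_re]
  rw [h1, det_hermConj_diagonal e hinj, h2]
  set l := hS.eigenvalues
  have h3 : ∏ p : {p : (Fin 2 ⊕ Fin 2) × (Fin 2 ⊕ Fin 2) // e p.1 < e p.2}, (l p.1.1 * l p.1.2) =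
      (∏ i, l i) ^ 3 := by
    rw [← Finset.prod_subtype (p := fun p : (Fin 2 ⊕ Fin 2) × (Fin 2 ⊕ Fin 2) => e p.1 < e p.2)
      (Finset.univ.filter fun p => e p.1 < e p.2) (by simp) (fun p => l p.1 * l p.2),
      Finset.prod_filter, Fintype.prod_prod_type]
    simp only [Fintype.prod_sum_type, Fin.prod_univ_two, he, Sum.elim_inl, Sum.elim_inr]
    norm_num
    ring
  rw [Finset.prod_pow, Finset.prod_pow, h3]
  ring

end HermitianConjugation

/-! ### The volume density as a power of det ρ -/

section VolumeDensity

variable {𝕜 : Type*} [RCLike 𝕜] {n : Type*} [Fintype n] [DecidableEq n]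

theorem IsHermitian.trace_eq_re {A : Matrix n n 𝕜} (hA : A.IsHermitian) :
    A.trace = (RCLike.re A.trace : 𝕜) := by
  rw [hA.trace_eq_sum_eigenvalues, ← RCLike.ofReal_sum, RCLike.ofReal_re]

theorem IsHermitian.det_eq_re {A : Matrix n n 𝕜} (hA : A.IsHermitian) :
    A.det = (RCLike.re A.det : 𝕜) := by
  rw [hA.det_eq_prod_eigenvalues, ← RCLike.ofReal_prod, RCLike.ofReal_re]

theorem PosDef.re_det_pos {A : Matrix n n 𝕜} (hA : A.PosDef) : 0 < RCLike.re A.det :=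
  (RCLike.pos_iff.1 hA.det_pos).1

/-- A self-adjoint matrix of trace one splits the self-adjoint matrices into its multiples and the
traceless ones. -/
def traceSplit (E : hermSub 𝕜 n) (hE : (E : Matrix n n 𝕜).trace = 1) :
    (ℝ × tangent 𝕜 n) ≃ₗ[ℝ] hermSub 𝕜 n where
  toFun p := ⟨p.1 • (E : Matrix n n 𝕜) + p.2, (hermSub 𝕜 n).add_mem
    ((hermSub 𝕜 n).smul_mem _ E.2) p.2.2.1⟩
  map_add' p q := Subtype.ext (by simp [add_smul]; abel)
  map_smul' c p := Subtype.ext (by simp [mul_smul])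
  invFun B := (RCLike.re (B : Matrix n n 𝕜).trace,
    ⟨(B : Matrix n n 𝕜) - RCLike.re (B : Matrix n n 𝕜).trace • (E : Matrix n n 𝕜),
      (hermSub 𝕜 n).sub_mem B.2 ((hermSub 𝕜 n).smul_mem _ E.2), by
        rw [Matrix.trace_sub, Matrix.trace_smul, hE, IsHermitian.trace_eq_re B.2,
          RCLike.ofReal_re, RCLike.real_smul_eq_coe_mul, mul_one, sub_self]⟩)
  left_inv p := by
    have h : RCLike.re (p.1 • (E : Matrix n n 𝕜) + p.2).trace = p.1 := by
      rw [Matrix.trace_add, Matrix.trace_smul, hE, p.2.2.2]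
      simp [RCLike.smul_re]
    ext1
    · exact h
    · apply Subtype.ext
      simp only [h, add_sub_cancel_left]
  right_inv B := Subtype.ext (by simp)

/-- The compression of `A ↦ S A S*` to the traceless matrices. -/
noncomputable def tangentConj [Nonempty n] (S : Matrix n n 𝕜) : tangent 𝕜 n →ₗ[ℝ] tangent 𝕜 n where
  toFun A := ⟨S * A * Sᴴ - (RCLike.re (S * A * Sᴴ).trace / Fintype.card n : ℝ) • 1, by
    have hH : (S * A * Sᴴ).IsHermitian := Matrix.isHermitian_mul_mul_conjTranspose S A.2.1
    refine ⟨(hermSub 𝕜 n).sub_mem hH ((hermSub 𝕜 n).smul_mem _ Matrix.isHermitian_one), ?_⟩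
    rw [Matrix.trace_sub, Matrix.trace_smul, Matrix.trace_one, IsHermitian.trace_eq_re hH,
      RCLike.ofReal_re, RCLike.real_smul_eq_coe_mul]
    push_cast
    rw [div_mul_cancel₀ _ (by simp), sub_self]⟩
  map_add' A B := Subtype.ext (by
    simp only [Submodule.coe_add, mul_add, add_mul, Matrix.trace_add, map_add, add_div, add_smul]
    abel)
  map_smul' c A := Subtype.ext (by
    simp only [Submodule.coe_smul, Matrix.mul_smul, Matrix.smul_mul, Matrix.trace_smul,
      RCLike.smul_re, RingHom.id_apply, smul_sub, mul_div_assoc, mul_smul])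

/-- The map sends ρ to 1. With complement ℝρ of the traceless matrices at the source and ℝ(1/n) at
the target, it is block triangular with diagonal blocks n and the compression. Replacing 1/n by ρ at
the source is a transvection, of determinant 1. -/
theorem det_tangentConj [Nonempty n] {ρ S : Matrix n n 𝕜} (hρ : ρ.IsHermitian)
    (htr : ρ.trace = 1) (hS : S * ρ * Sᴴ = 1) :
    LinearMap.det (hermConj S) = Fintype.card n * LinearMap.det (tangentConj S) := by
  have hN : (Fintype.card n : ℝ) ≠ 0 := by simp
  set N : ℝ := (Fintype.card n : ℝ) with hNdef
  set E : hermSub 𝕜 n := ⟨(N⁻¹ : ℝ) • 1, (hermSub 𝕜 n).smul_mem _ Matrix.isHermitian_one⟩ with hE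
  have hE1 : (E : Matrix n n 𝕜).trace = 1 := by
    rw [hE, Matrix.trace_smul, Matrix.trace_one, RCLike.real_smul_eq_coe_mul, hNdef]
    push_cast
    exact inv_mul_cancel₀ (by simp)
  set φ := traceSplit E hE1 with hφ
  set v : tangent 𝕜 n := ⟨ρ - E, (hermSub 𝕜 n).sub_mem hρ E.2, by
    rw [Matrix.trace_sub, htr, hE1, sub_self]⟩ with hv
  set ℓ : tangent 𝕜 n →ₗ[ℝ] ℝ :=
    { toFun := fun A => RCLike.re (S * A * Sᴴ).trace / N
      map_add' := fun A B => by
        simp only [Submodule.coe_add, mul_add, add_mul, Matrix.trace_add, map_add, add_div]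
      map_smul' := fun c A => by
        simp only [Submodule.coe_smul, Matrix.mul_smul, Matrix.smul_mul, Matrix.trace_smul,
          RCLike.smul_re, RingHom.id_apply, smul_eq_mul, mul_div_assoc] } with hl
  set K : (ℝ × tangent 𝕜 n) →ₗ[ℝ] (ℝ × tangent 𝕜 n) :=
    φ.symm.toLinearMap ∘ₗ hermConj S ∘ₗ φ.toLinearMap with hK
  have hKdet : LinearMap.det K = LinearMap.det (hermConj S) := by
    have := LinearMap.det_conj (hermConj S) φ.symm
    rwa [LinearEquiv.symm_symm] at this
  -- The transvection on the left moves the complement from E to ρ; the one on the right carries the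
  -- trace part of S A S*, the off-diagonal block.
  have hcomp : K ∘ₗ LinearMap.transvection (LinearMap.fst ℝ ℝ (tangent 𝕜 n)) (0, v) =
      LinearMap.prodMap (N • LinearMap.id) (tangentConj S) ∘ₗ
        LinearMap.transvection (ℓ ∘ₗ LinearMap.snd ℝ ℝ (tangent 𝕜 n)) (1, 0) := by
    apply LinearMap.ext
    rintro ⟨t, A⟩
    have h1 : hermConj S (φ (t, A + t • v)) =
        ⟨t • (1 : Matrix n n 𝕜) + S * A * Sᴴ, (hermSub 𝕜 n).add_mem
          ((hermSub 𝕜 n).smul_mem _ Matrix.isHermitian_one)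
          (Matrix.isHermitian_mul_mul_conjTranspose S A.2.1)⟩ := by
      apply Subtype.ext
      have : ((φ (t, A + t • v) : hermSub 𝕜 n) : Matrix n n 𝕜) = t • ρ + A := by
        simp only [hφ, traceSplit, LinearEquiv.coe_mk, LinearMap.coe_mk, AddHom.coe_mk,
          Submodule.coe_add, Submodule.coe_smul, hv, smul_sub]
        abel
      simp only [hermConj, LinearMap.coe_mk, AddHom.coe_mk, this, mul_add, add_mul,
        Matrix.mul_smul, Matrix.smul_mul, hS]
    have htrace : RCLike.re (t • (1 : Matrix n n 𝕜) + S * A * Sᴴ).trace =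
        N * (t + RCLike.re (S * A * Sᴴ).trace / N) := by
      rw [Matrix.trace_add, Matrix.trace_smul, Matrix.trace_one, map_add, RCLike.smul_re,
        RCLike.natCast_re, ← hNdef]
      field_simp
    have hL : LinearMap.transvection (LinearMap.fst ℝ ℝ (tangent 𝕜 n)) (0, v) (t, A) =
        (t, A + t • v) := by
      rw [LinearMap.transvection.apply]
      exact Prod.ext (by simp) rfl
    have hR : LinearMap.transvection (ℓ ∘ₗ LinearMap.snd ℝ ℝ (tangent 𝕜 n)) (1, 0) (t, A) =
        (t + ℓ A, A) := by
      rw [LinearMap.transvection.apply]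
      exact Prod.ext (by simp) (by simp)
    rw [LinearMap.comp_apply, hL, LinearMap.comp_apply (LinearMap.prodMap _ _), hR, hK,
      LinearMap.comp_apply, LinearMap.comp_apply, LinearEquiv.coe_coe, LinearEquiv.coe_coe, h1]
    apply Prod.ext
    · exact htrace
    · apply Subtype.ext
      change t • (1 : Matrix n n 𝕜) + S * A * Sᴴ -
          RCLike.re (t • (1 : Matrix n n 𝕜) + S * A * Sᴴ).trace • N⁻¹ • (1 : Matrix n n 𝕜) =
        S * A * Sᴴ - (RCLike.re (S * A * Sᴴ).trace / N) • (1 : Matrix n n 𝕜)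
      rw [htrace, smul_smul, mul_comm N, mul_inv_cancel_right₀ hN, add_smul]
      abel
  have hd := congrArg LinearMap.det hcomp
  rw [LinearMap.det_comp, LinearMap.det_comp, LinearMap.transvection.det,
    LinearMap.transvection.det, LinearMap.det_prodMap, hKdet] at hd
  simpa using hd

theorem hsPair_one_right {A : Matrix n n 𝕜} (hA : A.trace = 0) (c : ℝ) :
    hsPair A (c • 1) = 0 := by
  rw [hsPair, Matrix.mul_smul, mul_one, Matrix.trace_smul, hA, smul_zero, map_zero]

theorem hsPair_sub_right (A B C : Matrix n n 𝕜) : hsPair A (B - C) = hsPair A B - hsPair A C := by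
  simp [hsPair, mul_sub, Matrix.trace_sub]

theorem volDensity_sqrt [Nonempty n] {ρ : Matrix n n 𝕜} (hρ : ρ ∈ states 𝕜 n) :
    volDensity Real.sqrt ρ =
      √(LinearMap.det (hermConj (cfc Real.sqrt ρ)⁻¹) / Fintype.card n) := by
  set b := Module.finBasis ℝ (tangent 𝕜 n) with hb
  have hR := posDef_cfc_sqrt hρ.1
  have hRR := cfc_sqrt_mul_cfc_sqrt hρ.1.posSemidef
  set R := cfc Real.sqrt ρ with hRdef
  have hdet : IsUnit R.det := (Matrix.isUnit_iff_isUnit_det _).1 hR.isUnit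
  have hSH : (R⁻¹)ᴴ = R⁻¹ := hR.inv.1
  have h1 : R⁻¹ * ρ * (R⁻¹)ᴴ = 1 := by
    rw [hSH, ← hRR, ← mul_assoc, Matrix.nonsing_inv_mul _ hdet, one_mul,
      Matrix.mul_nonsing_inv _ hdet]
  have h2 := det_tangentConj hρ.1.1 hρ.2 h1
  -- The multiple of 1 subtracted in the compression pairs to zero with traceless matrices.
  have h3 : (Matrix.of fun i j => petzMetric Real.sqrt ρ (b i) (b j)) =
      Matrix.of fun i j => hsPair (b i : Matrix n n 𝕜) (tangentConj R⁻¹ (b j)) := by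
    ext i j
    simp only [Matrix.of_apply]
    rw [petzMetric_sqrt hρ.1]
    change hsPair (b i : Matrix n n 𝕜) (R⁻¹ * b j * R⁻¹) =
      hsPair (b i : Matrix n n 𝕜) (R⁻¹ * b j * (R⁻¹)ᴴ -
        (RCLike.re (R⁻¹ * b j * (R⁻¹)ᴴ).trace / Fintype.card n : ℝ) • 1)
    rw [hsPair_sub_right, hsPair_one_right (b i).2.2, sub_zero, hSH]
  have h4 : (Matrix.of fun i j =>
      RCLike.re ((b i : Matrix n n 𝕜) * (b j : Matrix n n 𝕜)).trace) = hsGram b := rfl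
  have hN : (Fintype.card n : ℝ) ≠ 0 := by simp
  simp only [volDensity]
  rw [h3, h4, det_hsGram_linearMap, mul_div_cancel_left₀ _ (det_hsGram_ne_zero b), h2,
    mul_div_cancel_left₀ _ hN]

/-- The determinant of ρ^{-1/2} enters with exponent 2 + 3d; the square root and the root of ρ give
the exponent (2 + 3d)/4 = κ, and the dimension 4 gives the factor 1/√4. -/
theorem volDensity_four {ρ : Mat4 𝕜} (hρ : ρ ∈ states 𝕜 (Fin 2 ⊕ Fin 2)) :
    volDensity Real.sqrt ρ = 1 / 2 * RCLike.re ρ.det ^ (-kap 𝕜) := by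
  have hR := posDef_cfc_sqrt hρ.1
  have hRR := cfc_sqrt_mul_cfc_sqrt hρ.1.posSemidef
  rw [volDensity_sqrt hρ, det_hermConj_four hR.inv.1]
  set R := cfc Real.sqrt ρ with hRdef
  have hp := PosDef.re_det_pos hR
  set x := RCLike.re R.det with hx
  have hRd : R.det = (x : 𝕜) := IsHermitian.det_eq_re hR.1
  have hρd : RCLike.re ρ.det = x * x := by
    rw [← hRR, Matrix.det_mul, hRd, ← RCLike.ofReal_mul, RCLike.ofReal_re]
  have hSd : RCLike.re (R⁻¹).det = x⁻¹ := by
    rw [Matrix.det_nonsing_inv, Ring.inverse_eq_inv', hRd, ← RCLike.ofReal_inv, RCLike.ofReal_re]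
  rw [hSd, hρd]
  have hcard : (Fintype.card (Fin 2 ⊕ Fin 2) : ℝ) = 2 ^ 2 := by norm_num
  rw [hcard, Real.sqrt_div (by positivity), Real.sqrt_sq (by norm_num)]
  have hpow : √(x⁻¹ ^ (2 + 3 * Module.finrank ℝ 𝕜)) = (x * x) ^ (-kap 𝕜) := by
    rw [Real.sqrt_eq_rpow, ← Real.rpow_natCast, ← Real.rpow_mul (by positivity),
      ← Real.rpow_neg_one x, ← Real.rpow_mul hp.le, ← sq, ← Real.rpow_natCast x,
      ← Real.rpow_mul hp.le]
    congr 1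
    rw [kap, dimK]
    push_cast
    ring
  rw [hpow]
  ring

end VolumeDensity

/-! ### Block matrices, contractions and the flip -/

section Blocks

variable {𝕜 : Type*} [RCLike 𝕜]

open scoped Matrix.Norms.L2Operator in
theorem opNorm_conjTranspose (X : Matrix (Fin 2) (Fin 2) 𝕜) : opNorm Xᴴ = opNorm X := by
  rw [opNorm_eq_norm, opNorm_eq_norm, Matrix.l2_opNorm_conjTranspose]

open scoped Matrix.Norms.L2Operator in
theorem opNorm_unitary_mul_mul {U W : Matrix (Fin 2) (Fin 2) 𝕜}
    (hU : U ∈ unitary (Matrix (Fin 2) (Fin 2) 𝕜)) (hW : W ∈ unitary (Matrix (Fin 2) (Fin 2) 𝕜))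
    (X : Matrix (Fin 2) (Fin 2) 𝕜) : opNorm (U * X * W) = opNorm X := by
  rw [opNorm_eq_norm, opNorm_eq_norm,
    CStarRing.norm_mul_mem_unitary _ hW, CStarRing.norm_mem_unitary_mul _ hU]

theorem msqrt_posDef {D : Matrix (Fin 2) (Fin 2) 𝕜} (hD : D.PosDef) : (msqrt D).PosDef :=
  posDef_cfc_sqrt hD

theorem msqrt_mul_msqrt {D : Matrix (Fin 2) (Fin 2) 𝕜} (hD : D.PosDef) :
    msqrt D * msqrt D = D :=
  cfc_sqrt_mul_cfc_sqrt hD.posSemidef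

theorem isUnit_det_msqrt {D : Matrix (Fin 2) (Fin 2) 𝕜} (hD : D.PosDef) :
    IsUnit (msqrt D).det :=
  (Matrix.isUnit_iff_isUnit_det _).1 (msqrt_posDef hD).isUnit

theorem norm_det_msqrt_sq {D : Matrix (Fin 2) (Fin 2) 𝕜} (hD : D.PosDef) :
    ‖(msqrt D).det‖ ^ 2 = RCLike.re D.det := by
  have h := congrArg Matrix.det (msqrt_mul_msqrt hD)
  rw [Matrix.det_mul, IsHermitian.det_eq_re hD.1] at h
  rw [← norm_pow, sq, h, RCLike.norm_ofReal, abs_of_pos (PosDef.re_det_pos hD)]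

/-- A semidefinite matrix is definite iff its determinant is nonzero, and the determinant of the
block matrix is det A times that of the Schur complement. -/
theorem posDef_fromBlocks_iff_schur {A D C : Matrix (Fin 2) (Fin 2) 𝕜} (hA : A.PosDef) :
    (Matrix.fromBlocks A C Cᴴ D).PosDef ↔ (D - Cᴴ * A⁻¹ * C).PosDef := by
  let := hA.isUnit.invertible
  have h1 := Matrix.PosDef.fromBlocks₁₁ C D hA
  have h2 : (Matrix.fromBlocks A C Cᴴ D).det = A.det * (D - Cᴴ * A⁻¹ * C).det := by
    rw [Matrix.det_fromBlocks₁₁, Matrix.invOf_eq_nonsing_inv]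
  have h3 : A.det ≠ 0 := hA.det_pos.ne'
  constructor
  · intro h
    refine (h1.1 h.posSemidef).posDef_iff_det_ne_zero.2 fun h0 => h.det_pos.ne' ?_
    rw [h2, h0, mul_zero]
  · intro h
    refine (h1.2 h.posSemidef).posDef_iff_det_ne_zero.2 ?_
    rw [h2]
    exact mul_ne_zero h3 h.det_pos.ne'

theorem schur_eq {D₁ D₂ : Matrix (Fin 2) (Fin 2) 𝕜} (h₁ : D₁.PosDef) (h₂ : D₂.PosDef)
    (C : Matrix (Fin 2) (Fin 2) 𝕜) :
    D₂ - Cᴴ * D₁⁻¹ * C = star (msqrt D₂) *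
      (1 - ((msqrt D₁)⁻¹ * C * (msqrt D₂)⁻¹)ᴴ * ((msqrt D₁)⁻¹ * C * (msqrt D₂)⁻¹)) *
      msqrt D₂ := by
  have e₁ := (msqrt_posDef h₁).inv.1.eq
  have e₂ := (msqrt_posDef h₂).inv.1.eq
  have u₂ := isUnit_det_msqrt h₂
  have i₁ : D₁⁻¹ = (msqrt D₁)⁻¹ * (msqrt D₁)⁻¹ := by
    rw [← Matrix.mul_inv_rev, msqrt_mul_msqrt h₁]
  rw [Matrix.star_eq_conjTranspose, (msqrt_posDef h₂).1.eq, mul_sub, sub_mul, mul_one,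
    msqrt_mul_msqrt h₂, Matrix.conjTranspose_mul, Matrix.conjTranspose_mul, e₁, e₂, i₁]
  congr 1
  simp only [mul_assoc]
  rw [Matrix.nonsing_inv_mul _ u₂, mul_one, Matrix.mul_nonsing_inv_cancel_left _ _ u₂]

theorem posDef_fromBlocks_iff {D₁ D₂ : Matrix (Fin 2) (Fin 2) 𝕜} (h₁ : D₁.PosDef)
    (h₂ : D₂.PosDef) (C : Matrix (Fin 2) (Fin 2) 𝕜) :
    (Matrix.fromBlocks D₁ C Cᴴ D₂).PosDef ↔
      opNorm ((msqrt D₁)⁻¹ * C * (msqrt D₂)⁻¹) < 1 := by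
  rw [posDef_fromBlocks_iff_schur h₁, schur_eq h₁ h₂, opNorm_lt_one_iff_posDef,
    Matrix.IsUnit.posDef_star_left_conjugate_iff (msqrt_posDef h₂).isUnit]

theorem re_det_fromBlocks {D₁ D₂ : Matrix (Fin 2) (Fin 2) 𝕜} (h₁ : D₁.PosDef)
    (h₂ : D₂.PosDef) (C : Matrix (Fin 2) (Fin 2) 𝕜) :
    RCLike.re (Matrix.fromBlocks D₁ C Cᴴ D₂).det = RCLike.re D₁.det * RCLike.re D₂.det *
      defect ((msqrt D₁)⁻¹ * C * (msqrt D₂)⁻¹) := by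
  let := h₁.isUnit.invertible
  have h := congrArg Matrix.det (msqrt_mul_msqrt h₂)
  rw [Matrix.det_mul] at h
  rw [Matrix.det_fromBlocks₁₁, Matrix.invOf_eq_nonsing_inv, schur_eq h₁ h₂, Matrix.det_mul,
    Matrix.det_mul, det_one_sub_conjTranspose_mul, ← defect_eq, Matrix.star_eq_conjTranspose,
    (msqrt_posDef h₂).1.eq, mul_right_comm, h, IsHermitian.det_eq_re h₁.1,
    IsHermitian.det_eq_re h₂.1, ← RCLike.ofReal_mul, ← RCLike.ofReal_mul, RCLike.ofReal_re,
    RCLike.ofReal_re, RCLike.ofReal_re]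
  ring

theorem PosDef.toBlocks {D₁ D₂ C C' : Matrix (Fin 2) (Fin 2) 𝕜}
    (h : (Matrix.fromBlocks D₁ C C' D₂).PosDef) : D₁.PosDef ∧ D₂.PosDef := by
  refine ⟨?_, ?_⟩
  · have := h.submatrix (e := Sum.inl) Sum.inl_injective
    convert this using 1
    ext i j; rfl
  · have := h.submatrix (e := Sum.inr) Sum.inr_injective
    convert this using 1
    ext i j; rfl

theorem fromBlocks_mem_states {D₁ D₂ C : Matrix (Fin 2) (Fin 2) 𝕜} (ht : (D₁ + D₂).trace = 1) :
    Matrix.fromBlocks D₁ C Cᴴ D₂ ∈ states 𝕜 (Fin 2 ⊕ Fin 2) ↔ D₁.PosDef ∧ D₂.PosDef ∧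
      opNorm ((msqrt D₁)⁻¹ * C * (msqrt D₂)⁻¹) < 1 := by
  constructor
  · rintro ⟨h, -⟩
    obtain ⟨h₁, h₂⟩ := PosDef.toBlocks h
    exact ⟨h₁, h₂, (posDef_fromBlocks_iff h₁ h₂ C).1 h⟩
  · rintro ⟨h₁, h₂, h⟩
    refine ⟨(posDef_fromBlocks_iff h₁ h₂ C).2 h, ?_⟩
    rw [← ht]
    simp [Matrix.trace, Fintype.sum_sum_type]; abel

theorem fromBlocks_mem_fibre {D D₁ C : Matrix (Fin 2) (Fin 2) 𝕜} (ht : D.trace = 1) :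
    Matrix.fromBlocks D₁ C Cᴴ (D - D₁) ∈ fibre D ↔ D₁.PosDef ∧ (D - D₁).PosDef ∧
      opNorm ((msqrt D₁)⁻¹ * C * (msqrt (D - D₁))⁻¹) < 1 := by
  have h : (D₁ + (D - D₁)).trace = 1 := by rw [add_sub_cancel, ht]
  have h' : ptrace (Matrix.fromBlocks D₁ C Cᴴ (D - D₁)) = D := by
    simp [ptrace]
  rw [← fromBlocks_mem_states h]
  exact and_iff_left h'

/-- The flip is an involution on self-adjoint matrices, so its image can be replaced by its
preimage. -/
theorem mem_sepStates_iff (ρ : Mat4 𝕜) : ρ ∈ sepStates 𝕜 ↔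
    blockFlip ρ ∈ states 𝕜 (Fin 2 ⊕ Fin 2) ∧ ρ ∈ states 𝕜 (Fin 2 ⊕ Fin 2) := by
  have hinv {σ : Mat4 𝕜} (hσ : σ.IsHermitian) : blockFlip (blockFlip σ) = σ := by
    have : σ.toBlocks₁₂ᴴ = σ.toBlocks₂₁ := by
      ext i j
      exact hσ.apply _ _
    simp only [blockFlip, Matrix.toBlocks_fromBlocks₁₁, Matrix.toBlocks_fromBlocks₁₂,
      Matrix.toBlocks_fromBlocks₂₂, Matrix.conjTranspose_conjTranspose]
    rw [this, Matrix.fromBlocks_toBlocks]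
  constructor
  · rintro ⟨⟨σ, hσ, rfl⟩, h⟩
    rw [hinv hσ.1.1]
    exact ⟨hσ, h⟩
  · rintro ⟨h, h'⟩
    exact ⟨⟨_, h, hinv h'.1.1⟩, h'⟩

theorem fromBlocks_mem_sepStates_inter_fibre {D D₁ C : Matrix (Fin 2) (Fin 2) 𝕜}
    (ht : D.trace = 1) :
    Matrix.fromBlocks D₁ C Cᴴ (D - D₁) ∈ sepStates 𝕜 ∩ fibre D ↔
      D₁.PosDef ∧ (D - D₁).PosDef ∧ opNorm ((msqrt D₁)⁻¹ * C * (msqrt (D - D₁))⁻¹) < 1 ∧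
      opNorm ((msqrt D₁)⁻¹ * Cᴴ * (msqrt (D - D₁))⁻¹) < 1 := by
  have h : (D₁ + (D - D₁)).trace = 1 := by rw [add_sub_cancel, ht]
  have h1 := fromBlocks_mem_states (C := C) h
  have h2 := fromBlocks_mem_states (C := Cᴴ) h
  have hflip : blockFlip (Matrix.fromBlocks D₁ C Cᴴ (D - D₁)) =
      Matrix.fromBlocks D₁ Cᴴ Cᴴᴴ (D - D₁) := by
    simp [blockFlip]
  rw [Set.mem_inter_iff, mem_sepStates_iff, hflip, fromBlocks_mem_fibre ht, h1, h2]
  exact ⟨fun h => ⟨h.2.1, h.2.2.1, h.2.2.2, h.1.1.2.2⟩,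
    fun h => ⟨⟨⟨h.1, h.2.1, h.2.2.2⟩, h.1, h.2.1, h.2.2.1⟩, h.1, h.2.1, h.2.2.1⟩⟩

/-- The adjoint has the same norm; it turns Xᴴ into X and collects the outer factors into V = S₂
S₁⁻¹ and (V*)⁻¹. -/
theorem opNorm_flip {S₁ S₂ : Matrix (Fin 2) (Fin 2) 𝕜} (h₁ : S₁.PosDef) (h₂ : S₂.PosDef)
    (X : Matrix (Fin 2) (Fin 2) 𝕜) :
    opNorm (S₁⁻¹ * (S₁ * X * S₂)ᴴ * S₂⁻¹) = opNorm (((S₂ * S₁⁻¹)ᴴ)⁻¹ * X * (S₂ * S₁⁻¹)) := by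
  have u₁ : IsUnit S₁.det := (Matrix.isUnit_iff_isUnit_det _).1 h₁.isUnit
  rw [← opNorm_conjTranspose]
  congr 1
  rw [Matrix.conjTranspose_mul, Matrix.conjTranspose_mul, Matrix.conjTranspose_conjTranspose,
    h₁.inv.1.eq, h₂.inv.1.eq, Matrix.conjTranspose_mul, h₁.inv.1.eq, h₂.1.eq, Matrix.mul_inv_rev,
    Matrix.nonsing_inv_nonsing_inv _ u₁]
  simp only [mul_assoc]

end Blocks

/-! ### Singular value decomposition and reduction to V_ε -/

section SingularValues

variable {𝕜 : Type*} [RCLike 𝕜]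

theorem exists_unitary_diagonal {H : Matrix (Fin 2) (Fin 2) 𝕜} (hH : H.IsHermitian) :
    ∃ U ∈ unitary (Matrix (Fin 2) (Fin 2) 𝕜), ∃ l m : ℝ, m ≤ l ∧
      H = U * Matrix.diagonal ![(l : 𝕜), (m : 𝕜)] * Uᴴ := by
  have h := hH.spectral_theorem
  rw [Unitary.conjStarAlgAut_apply] at h
  rcases le_total (hH.eigenvalues 1) (hH.eigenvalues 0) with hle | hle
  · refine ⟨_, hH.eigenvectorUnitary.2, _, _, hle, h.trans ?_⟩
    rw [← Matrix.star_eq_conjTranspose]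
    congr 3
    ext i; fin_cases i <;> rfl
  · have hP : (!![0, 1; 1, 0] : Matrix (Fin 2) (Fin 2) 𝕜) ∈
        unitary (Matrix (Fin 2) (Fin 2) 𝕜) := by
      rw [Unitary.mem_iff, Matrix.star_eq_conjTranspose]
      constructor <;> ext i j <;> fin_cases i <;> fin_cases j <;>
        simp [Matrix.mul_apply, Fin.sum_univ_two]
    refine ⟨_, mul_mem hH.eigenvectorUnitary.2 hP, _, _, hle, h.trans ?_⟩
    rw [Matrix.conjTranspose_mul, ← Matrix.star_eq_conjTranspose]
    have : (Matrix.diagonal (RCLike.ofReal ∘ hH.eigenvalues) : Matrix (Fin 2) (Fin 2) 𝕜) =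
        !![0, 1; 1, 0] * Matrix.diagonal ![(hH.eigenvalues 1 : 𝕜), (hH.eigenvalues 0 : 𝕜)] *
          (!![0, 1; 1, 0] : Matrix (Fin 2) (Fin 2) 𝕜)ᴴ := by
      ext i j; fin_cases i <;> fin_cases j <;>
        simp [Matrix.mul_apply, Matrix.vecMul, dotProduct, Fin.sum_univ_two]
    rw [this]
    simp only [mul_assoc]
    rfl

theorem svRatio_smul_diagV {c ε : ℝ} (hc : 0 < c) (hε : 0 < ε) (hε1 : ε ≤ 1) :
    svRatio ((c : 𝕜) • diagV 𝕜 ε) = ε := by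
  have hf : frobSq ((c : 𝕜) • diagV 𝕜 ε) = c ^ 2 * (1 + ε ^ 2) := by
    simp [frobSq, diagV, mul_pow]; ring
  have hd : ‖((c : 𝕜) • diagV 𝕜 ε).det‖ ^ 2 = c ^ 4 * ε ^ 2 := by
    simp [diagV, Matrix.det_fin_two, norm_smul, mul_pow]; ring
  have hs : √((c ^ 2 * (1 + ε ^ 2)) ^ 2 - 4 * (c ^ 4 * ε ^ 2)) = c ^ 2 * (1 - ε ^ 2) := by
    rw [← Real.sqrt_sq (mul_nonneg (sq_nonneg c) (by nlinarith : 0 ≤ 1 - ε ^ 2))]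
    congr 1; ring
  rw [svRatio_eq_formula, hf, hd, hs]
  have h1 : (c ^ 2 * (1 + ε ^ 2) - c ^ 2 * (1 - ε ^ 2)) / 2 = (c * ε) ^ 2 := by ring
  have h2 : (c ^ 2 * (1 + ε ^ 2) + c ^ 2 * (1 - ε ^ 2)) / 2 = c ^ 2 := by ring
  rw [h1, h2, Real.sqrt_sq (by positivity), Real.sqrt_sq hc.le]
  field_simp

/-- Diagonalize V V* = U diag(l, m) U* and put c = √l, ε = √(m/l). Then B = U(c V_ε) satisfies B B*
= V V*, so B⁻¹ V is unitary. -/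
theorem exists_svd {V : Matrix (Fin 2) (Fin 2) 𝕜} (hV : V.det ≠ 0) :
    ∃ U ∈ unitary (Matrix (Fin 2) (Fin 2) 𝕜), ∃ W ∈ unitary (Matrix (Fin 2) (Fin 2) 𝕜),
      ∃ c : ℝ, 0 < c ∧ 0 < svRatio V ∧ V = U * ((c : 𝕜) • diagV 𝕜 (svRatio V)) * W := by
  have hVu : IsUnit V := (Matrix.isUnit_iff_isUnit_det _).2 hV.isUnit
  have hH : (V * Vᴴ).PosDef := by
    have := Matrix.PosDef.one (n := Fin 2) (R := 𝕜) |>.mul_mul_conjTranspose_same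
      (B := V) (Matrix.vecMul_injective_of_isUnit hVu)
    rwa [mul_one] at this
  obtain ⟨U, hU, l, m, hml, hUH⟩ := exists_unitary_diagonal hH.1
  have hUU : Uᴴ * U = 1 := (Unitary.mem_iff.1 hU).1
  have hpd : (Matrix.diagonal ![(l : 𝕜), (m : 𝕜)]).PosDef := by
    have hUu : IsUnit U := (Matrix.isUnit_iff_isUnit_det _).2
      (Matrix.isUnit_det_of_left_inverse hUU)
    rw [hUH] at hH
    exact (Matrix.IsUnit.posDef_star_right_conjugate_iff hUu).1 hH
  rw [Matrix.posDef_diagonal_iff] at hpd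
  have hl : 0 < l := by simpa using hpd 0
  have hm : 0 < m := by simpa using hpd 1
  set ε : ℝ := √(m / l) with hε
  have hε0 : 0 < ε := Real.sqrt_pos.2 (by positivity)
  have hε1 : ε ≤ 1 := Real.sqrt_le_one.2 ((div_le_one hl).2 hml)
  set c : ℝ := √l with hc
  have hc0 : 0 < c := Real.sqrt_pos.2 hl
  have hdiag : Matrix.diagonal ![(l : 𝕜), (m : 𝕜)] =
      ((c : 𝕜) • diagV 𝕜 ε) * ((c : 𝕜) • diagV 𝕜 ε)ᴴ := by
    have h1 : l = c * c := (Real.mul_self_sqrt hl.le).symm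
    have h2 : m = c * ε * (c * ε) := by
      have : ε * ε = m / l := Real.mul_self_sqrt (by positivity)
      rw [mul_mul_mul_comm, this, ← h1]; field_simp
    ext i j; fin_cases i <;> fin_cases j
    · simp [diagV, Matrix.mul_apply, Fin.sum_univ_two, RCLike.real_smul_eq_coe_mul]
      exact_mod_cast h1
    · simp [diagV, Matrix.mul_apply, Fin.sum_univ_two]
    · simp [diagV, Matrix.mul_apply, Fin.sum_univ_two]
    · simp [diagV, Matrix.mul_apply, Fin.sum_univ_two, RCLike.real_smul_eq_coe_mul]
      exact_mod_cast h2
  set B : Matrix (Fin 2) (Fin 2) 𝕜 := U * ((c : 𝕜) • diagV 𝕜 ε) with hBdef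
  have hBB : B * Bᴴ = V * Vᴴ := by
    rw [hUH, hdiag, hBdef, Matrix.conjTranspose_mul]
    simp only [mul_assoc]
  have hBu : IsUnit B.det := by
    rw [isUnit_iff_ne_zero]
    intro h0
    have := congrArg Matrix.det hBB
    rw [Matrix.det_mul B, Matrix.det_mul V, h0, zero_mul, Matrix.det_conjTranspose] at this
    exact (mul_ne_zero hV (star_ne_zero.2 hV)) this.symm
  have hsv : svRatio V = ε := by
    rw [← svRatio_smul_diagV (𝕜 := 𝕜) hc0 hε0 hε1]
    have e : (((c : 𝕜) • diagV 𝕜 ε)ᴴ * ((c : 𝕜) • diagV 𝕜 ε)) = Bᴴ * B := by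
      rw [hBdef, Matrix.conjTranspose_mul, Matrix.mul_assoc, ← Matrix.mul_assoc Uᴴ, hUU,
        Matrix.one_mul]
    apply svRatio_eq_of_trace_det
    · rw [e, Matrix.trace_mul_comm, ← hBB, Matrix.trace_mul_comm]
    · rw [e, Matrix.det_mul_comm, ← hBB, Matrix.det_mul_comm]
  have hW : B⁻¹ * V ∈ unitary (Matrix (Fin 2) (Fin 2) 𝕜) := by
    have hBu' : IsUnit Bᴴ.det := by rw [Matrix.det_conjTranspose]; exact hBu.star
    have : (B⁻¹ * V) * star (B⁻¹ * V) = 1 := by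
      rw [Matrix.star_eq_conjTranspose, Matrix.conjTranspose_mul, mul_assoc, ← mul_assoc V, ← hBB,
        Matrix.conjTranspose_nonsing_inv, mul_assoc, Matrix.mul_nonsing_inv _ hBu', mul_one,
        Matrix.nonsing_inv_mul _ hBu]
    exact Unitary.mem_iff.2 ⟨mul_eq_one_comm.1 this, this⟩
  rw [hsv]
  exact ⟨U, hU, _, hW, c, hc0, hε0, (Matrix.mul_nonsing_inv_cancel_left _ _ hBu).symm⟩

/-- The scalar c cancels between the inverse adjoint and the matrix itself; the outer unitary
factors do not change the norm. -/
theorem opNorm_adjoint_inv_mul_mul {c ε : ℝ} (hc : 0 < c) (hε : 0 < ε)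
    {U W : Matrix (Fin 2) (Fin 2) 𝕜} (hU : U ∈ unitary (Matrix (Fin 2) (Fin 2) 𝕜))
    (hW : W ∈ unitary (Matrix (Fin 2) (Fin 2) 𝕜)) (X : Matrix (Fin 2) (Fin 2) 𝕜) :
    opNorm ((U * ((c : 𝕜) • diagV 𝕜 ε) * W)ᴴ⁻¹ * (Wᴴ * X * Uᴴ) *
      (U * ((c : 𝕜) • diagV 𝕜 ε) * W)) = opNorm ((diagV 𝕜 ε)⁻¹ * X * diagV 𝕜 ε) := by
  have hUU : Uᴴ * U = 1 := (Unitary.mem_iff.1 hU).1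
  have hWW : W * Wᴴ = 1 := (Unitary.mem_iff.1 hW).2
  have hc' : (c : 𝕜) ≠ 0 := by exact_mod_cast hc.ne'
  have hdV : IsUnit (diagV 𝕜 ε).det := by
    have : (ε : 𝕜) ≠ 0 := by exact_mod_cast hε.ne'
    simp [diagV, Matrix.det_fin_two, this]
  have hV : ((c : 𝕜) • diagV 𝕜 ε)ᴴ = (c : 𝕜) • diagV 𝕜 ε := by
    ext i j; fin_cases i <;> fin_cases j <;> simp [diagV, RCLike.real_smul_eq_coe_mul]
  have hinv : (U * ((c : 𝕜) • diagV 𝕜 ε) * W)ᴴ⁻¹ = U * ((c : 𝕜)⁻¹ • (diagV 𝕜 ε)⁻¹) * W := by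
    apply Matrix.inv_eq_left_inv
    rw [Matrix.conjTranspose_mul, Matrix.conjTranspose_mul, hV]
    calc U * ((c : 𝕜)⁻¹ • (diagV 𝕜 ε)⁻¹) * W * (Wᴴ * ((c : 𝕜) • diagV 𝕜 ε * Uᴴ))
        = U * ((c : 𝕜)⁻¹ • (diagV 𝕜 ε)⁻¹) * (W * Wᴴ) * ((c : 𝕜) • diagV 𝕜 ε * Uᴴ) := by
          simp only [mul_assoc]
      _ = U * (((c : 𝕜)⁻¹ • (diagV 𝕜 ε)⁻¹) * ((c : 𝕜) • diagV 𝕜 ε)) * Uᴴ := by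
          rw [hWW]; simp only [mul_assoc, mul_one]
      _ = 1 := by
          rw [Matrix.smul_mul, Matrix.mul_smul (diagV 𝕜 ε)⁻¹, smul_smul, inv_mul_cancel₀ hc', one_smul,
            Matrix.nonsing_inv_mul _ hdV, mul_one]
          exact (Unitary.mem_iff.1 hU).2
  rw [hinv, ← opNorm_unitary_mul_mul hU hW ((diagV 𝕜 ε)⁻¹ * X * diagV 𝕜 ε)]
  congr 1
  calc U * ((c : 𝕜)⁻¹ • (diagV 𝕜 ε)⁻¹) * W * (Wᴴ * X * Uᴴ) * (U * ((c : 𝕜) • diagV 𝕜 ε) * W)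
      = U * ((c : 𝕜)⁻¹ • (diagV 𝕜 ε)⁻¹) * (W * Wᴴ) * X * (Uᴴ * U) *
          ((c : 𝕜) • diagV 𝕜 ε) * W := by simp only [mul_assoc]
    _ = U * ((diagV 𝕜 ε)⁻¹ * X * diagV 𝕜 ε) * W := by
      rw [hWW, hUU, mul_one, mul_one, Matrix.mul_smul, Matrix.mul_smul, Matrix.smul_mul,
        Matrix.smul_mul, Matrix.smul_mul, Matrix.smul_mul, smul_smul, mul_inv_cancel₀ hc', one_smul]
      simp only [mul_assoc]

theorem norm_det_of_mem_unitary {U : Matrix (Fin 2) (Fin 2) 𝕜}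
    (hU : U ∈ unitary (Matrix (Fin 2) (Fin 2) 𝕜)) : ‖U.det‖ = 1 := by
  have h := congrArg Matrix.det (Unitary.mem_iff.1 hU).1
  rw [Matrix.star_eq_conjTranspose, det_conjTranspose_mul_self, Matrix.det_one] at h
  have : ‖U.det‖ ^ 2 = 1 := by exact_mod_cast h
  nlinarith [norm_nonneg U.det]

theorem defect_unitary_mul_mul {U W : Matrix (Fin 2) (Fin 2) 𝕜}
    (hU : U ∈ unitary (Matrix (Fin 2) (Fin 2) 𝕜)) (hW : W ∈ unitary (Matrix (Fin 2) (Fin 2) 𝕜))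
    (X : Matrix (Fin 2) (Fin 2) 𝕜) : defect (U * X * W) = defect X := by
  have hWW : W * Wᴴ = 1 := (Unitary.mem_iff.1 hW).2
  have hUU' : U * Uᴴ = 1 := (Unitary.mem_iff.1 hU).2
  have : 1 - U * X * W * (U * X * W)ᴴ = U * (1 - X * Xᴴ) * Uᴴ := by
    simp only [Matrix.conjTranspose_mul, mul_sub, sub_mul, mul_one, hUU', mul_assoc]
    rw [← mul_assoc W Wᴴ, hWW, one_mul]
  rw [defect, defect, this, Matrix.det_mul, Matrix.det_mul, mul_right_comm, ← Matrix.det_mul, hUU',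
    Matrix.det_one, one_mul]

variable [MeasureSpace 𝕜] [BorelSpace 𝕜] [(volume : Measure 𝕜).IsAddHaarMeasure]

theorem measurableSet_conjRegion (V : Matrix (Fin 2) (Fin 2) 𝕜) (r : ℝ) :
    MeasurableSet {X : Matrix (Fin 2) (Fin 2) 𝕜 | opNorm X < r ∧ opNorm (Vᴴ⁻¹ * X * V) < 1} :=
  (measurableSet_lt continuous_opNorm.measurable measurable_const).inter
    (measurableSet_lt (continuous_opNorm.comp
      ((continuous_const.mul continuous_id).mul continuous_const)).measurable measurable_const)

/-- The defining integral of `etaReg` depends on the conjugating matrix only through the ratio of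
its singular values. -/
theorem lintegral_conjRegion {V : Matrix (Fin 2) (Fin 2) 𝕜} (hV : V.det ≠ 0) (δ r : ℝ) :
    ∫⁻ X in {X : Matrix (Fin 2) (Fin 2) 𝕜 | opNorm X < r ∧ opNorm (Vᴴ⁻¹ * X * V) < 1},
      ENNReal.ofReal (defect X ^ (-(kap 𝕜 * δ))) = etaReg 𝕜 δ r (svRatio V) := by
  obtain ⟨U, hU, W, hW, c, hc, hε, hVeq⟩ := exists_svd hV
  have hU' : Uᴴ ∈ unitary (Matrix (Fin 2) (Fin 2) 𝕜) := Unitary.star_mem hU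
  have hW' : Wᴴ ∈ unitary (Matrix (Fin 2) (Fin 2) 𝕜) := Unitary.star_mem hW
  have hdU := norm_det_of_mem_unitary hU'
  have hdW := norm_det_of_mem_unitary hW'
  have hX (X : Matrix (Fin 2) (Fin 2) 𝕜) : opNorm (Vᴴ⁻¹ * (Wᴴ * X * Uᴴ) * V) =
      opNorm ((diagV 𝕜 (svRatio V))⁻¹ * X * diagV 𝕜 (svRatio V)) := by
    have h := opNorm_adjoint_inv_mul_mul hc hε hU hW X
    rwa [← hVeq] at h
  have hms : MeasurableSet {X : Matrix (Fin 2) (Fin 2) 𝕜 | opNorm X < r ∧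
      opNorm ((diagV 𝕜 (svRatio V))⁻¹ * X * diagV 𝕜 (svRatio V)) < 1} :=
    (measurableSet_lt continuous_opNorm.measurable measurable_const).inter
      (measurableSet_lt (continuous_opNorm.comp
        ((continuous_const.mul continuous_id).mul continuous_const)).measurable measurable_const)
  -- The substitution X ↦ W* X U* has Jacobian 1 and preserves the norm and the defect.
  rw [etaReg, ← lintegral_indicator (measurableSet_conjRegion V r), ← lintegral_indicator hms,
    lintegral_conj (A := Wᴴ) (B := Uᴴ) (by intro h; simp [h] at hdW) (by intro h; simp [h] at hdU),
    hdU, hdW, mul_one, one_pow, ENNReal.ofReal_one, one_mul]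
  refine lintegral_congr fun X => ?_
  have h1 := opNorm_unitary_mul_mul hW' hU' X
  have h2 := defect_unitary_mul_mul hW' hU' X
  have hiff : Wᴴ * X * Uᴴ ∈ {X : Matrix (Fin 2) (Fin 2) 𝕜 |
      opNorm X < r ∧ opNorm (Vᴴ⁻¹ * X * V) < 1} ↔ X ∈ {X : Matrix (Fin 2) (Fin 2) 𝕜 |
      opNorm X < r ∧ opNorm ((diagV 𝕜 (svRatio V))⁻¹ * X * diagV 𝕜 (svRatio V)) < 1} := by
    rw [Set.mem_ofPred_eq, Set.mem_ofPred_eq, h1, hX X]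
  by_cases h : X ∈ {X : Matrix (Fin 2) (Fin 2) 𝕜 |
      opNorm X < r ∧ opNorm ((diagV 𝕜 (svRatio V))⁻¹ * X * diagV 𝕜 (svRatio V)) < 1}
  · rw [Set.indicator_of_mem (hiff.2 h), Set.indicator_of_mem h, h2]
  · rw [Set.indicator_of_notMem (fun h' => h (hiff.1 h')), Set.indicator_of_notMem h]

theorem lintegral_ball_eq_etaReg_one {r : ℝ} (hr : r ≤ 1) (δ : ℝ) :
    ∫⁻ X in {X : Matrix (Fin 2) (Fin 2) 𝕜 | opNorm X < r},
      ENNReal.ofReal (defect X ^ (-(kap 𝕜 * δ))) = etaReg 𝕜 δ r 1 := by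
  have h1 : diagV 𝕜 1 = 1 := by
    ext i j; fin_cases i <;> fin_cases j <;> simp [diagV]
  rw [etaReg]
  congr 2
  ext X
  simp only [Set.mem_ofPred_eq, h1, inv_one, one_mul, mul_one]
  exact ⟨fun h => ⟨h, h.trans_le hr⟩, fun h => h.1⟩

end SingularValues

/-! ### Measurability of the matrix square root -/

section SqrtFormula

variable {𝕜 : Type*} [RCLike 𝕜]

/-- A closed formula for the square root of a positive definite `2 × 2` matrix. -/
noncomputable def sqrtFormula (A : Matrix (Fin 2) (Fin 2) 𝕜) : Matrix (Fin 2) (Fin 2) 𝕜 :=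
  (√(RCLike.re A.trace + 2 * √(RCLike.re A.det)))⁻¹ • (A + √(RCLike.re A.det) • 1)

/-- By Cayley–Hamilton, (A + √det A)² = (tr A + 2√det A) A. The closed form is visibly measurable in
A. -/
theorem msqrt_eq_sqrtFormula {A : Matrix (Fin 2) (Fin 2) 𝕜} (hA : A.PosDef) :
    msqrt A = sqrtFormula A := by
  obtain ⟨hH, ht, hd⟩ := posDef_iff_trace_det.1 hA
  have hs : 0 < √(RCLike.re A.det) := Real.sqrt_pos.2 hd
  have hT : 0 < RCLike.re A.trace + 2 * √(RCLike.re A.det) := by positivity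
  refine cfc_sqrt_unique ?_ ?_
  · refine Matrix.PosSemidef.smul (hA.posSemidef.add ?_) (by positivity)
    exact Matrix.PosSemidef.one.smul hs.le
  · have hCH : A * A = RCLike.re A.trace • A - RCLike.re A.det • 1 := by
      ext i j
      have e1 : (RCLike.re A.trace : 𝕜) = A 0 0 + A 1 1 := by
        rw [← IsHermitian.trace_eq_re hH, Matrix.trace_fin_two]
      have e2 : (RCLike.re A.det : 𝕜) = A 0 0 * A 1 1 - A 0 1 * A 1 0 := by
        rw [← IsHermitian.det_eq_re hH, Matrix.det_fin_two]
      simp only [Matrix.mul_apply, Fin.sum_univ_two, Matrix.sub_apply, Matrix.smul_apply,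
        RCLike.real_smul_eq_coe_mul, e1, e2]
      fin_cases i <;> fin_cases j <;> simp <;> ring
    have hsq : √(RCLike.re A.det) * √(RCLike.re A.det) = RCLike.re A.det :=
      Real.mul_self_sqrt hd.le
    have key : (A + √(RCLike.re A.det) • 1) * (A + √(RCLike.re A.det) • 1) =
        (RCLike.re A.trace + 2 * √(RCLike.re A.det)) • A := by
      simp only [add_mul, mul_add, hCH, Matrix.smul_mul, Matrix.mul_smul, one_mul, mul_one,
        smul_smul, hsq, add_smul]
      rw [two_mul, add_smul]
      abel
    rw [sqrtFormula, Matrix.smul_mul, Matrix.mul_smul, key, smul_smul, smul_smul, ← mul_inv,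
      Real.mul_self_sqrt hT.le, inv_mul_cancel₀ hT.ne', one_smul]

variable [MeasureSpace 𝕜] [BorelSpace 𝕜]

instance matrixSecondCountable {m n : Type*} [Fintype m] [Fintype n] :
    SecondCountableTopology (Matrix m n 𝕜) :=
  inferInstanceAs (SecondCountableTopology (m → n → 𝕜))

theorem measurable_sqrtFormula :
    Measurable (sqrtFormula : Matrix (Fin 2) (Fin 2) 𝕜 → Matrix (Fin 2) (Fin 2) 𝕜) := by
  unfold sqrtFormula
  have ht : Measurable fun A : Matrix (Fin 2) (Fin 2) 𝕜 => RCLike.re A.trace :=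
    Continuous.measurable (RCLike.continuous_re.comp continuous_id.matrix_trace)
  have hd : Measurable fun A : Matrix (Fin 2) (Fin 2) 𝕜 => RCLike.re A.det :=
    Continuous.measurable (RCLike.continuous_re.comp continuous_id.matrix_det)
  exact ((ht.add (hd.sqrt.const_mul 2)).sqrt.inv).smul
    (measurable_id.add (hd.sqrt.smul measurable_const))

theorem measurable_matrix_inv :
    Measurable fun A : Matrix (Fin 2) (Fin 2) 𝕜 => A⁻¹ := by
  have : (fun A : Matrix (Fin 2) (Fin 2) 𝕜 => A⁻¹) = fun A => A.det⁻¹ • A.adjugate := by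
    funext A; rw [Matrix.inv_def, Ring.inverse_eq_inv']
  rw [this]
  exact (continuous_id.matrix_det.measurable.inv).smul continuous_id.matrix_adjugate.measurable

end SqrtFormula

/-! ### Fubini on the fibre and the substitution C = D₁^{1/2} X D₂^{1/2} -/

section FibreIntegral

variable {𝕜 : Type*} [RCLike 𝕜]

theorem isHermitian_hermMk (p : ℝ × ℝ × 𝕜) : (hermMk p).IsHermitian := by
  ext i j; fin_cases i <;> fin_cases j <;> simp [hermMk]

theorem continuous_hermMk : Continuous (hermMk : ℝ × ℝ × 𝕜 → Matrix (Fin 2) (Fin 2) 𝕜) := by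
  refine continuous_matrix fun i j => ?_
  fin_cases i <;> fin_cases j <;> simp only [hermMk] <;> dsimp
  · exact RCLike.continuous_ofReal.comp continuous_fst
  · fun_prop
  · exact RCLike.continuous_conj.comp (continuous_snd.comp continuous_snd)
  · exact RCLike.continuous_ofReal.comp (continuous_fst.comp continuous_snd)

/-- The coordinates of a self-adjoint matrix. -/
noncomputable def hermCoe (A : Matrix (Fin 2) (Fin 2) 𝕜) : ℝ × ℝ × 𝕜 :=
  (RCLike.re (A 0 0), RCLike.re (A 1 1), A 0 1)

theorem hermCoe_hermMk (p : ℝ × ℝ × 𝕜) : hermCoe (hermMk p) = p := by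
  simp [hermCoe, hermMk]

theorem hermMk_hermCoe {A : Matrix (Fin 2) (Fin 2) 𝕜} (hA : A.IsHermitian) :
    hermMk (hermCoe A) = A := by
  have h (i : Fin 2) : ((RCLike.re (A i i) : ℝ) : 𝕜) = A i i :=
    RCLike.conj_eq_iff_re.1 (hA.apply i i)
  ext i j; fin_cases i <;> fin_cases j
  · simpa [hermMk, hermCoe] using h 0
  · simp [hermMk, hermCoe]
  · simpa [hermMk, hermCoe] using hA.apply 1 0
  · simpa [hermMk, hermCoe] using h 1

theorem continuous_hermCoe :
    Continuous (hermCoe : Matrix (Fin 2) (Fin 2) 𝕜 → ℝ × ℝ × 𝕜) := by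
  unfold hermCoe; fun_prop

/-- The parametrization of the self-adjoint matrices with partial trace `D`. -/
noncomputable def fibreEmb (D : Matrix (Fin 2) (Fin 2) 𝕜)
    (q : (ℝ × ℝ × 𝕜) × Matrix (Fin 2) (Fin 2) 𝕜) : Mat4 𝕜 :=
  Matrix.fromBlocks (hermMk q.1) q.2 q.2ᴴ (D - hermMk q.1)

theorem continuous_fibreEmb (D : Matrix (Fin 2) (Fin 2) 𝕜) : Continuous (fibreEmb D) := by
  have h := continuous_hermMk (𝕜 := 𝕜).comp
    (continuous_fst (X := ℝ × ℝ × 𝕜) (Y := Matrix (Fin 2) (Fin 2) 𝕜))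
  exact Continuous.matrix_fromBlocks h continuous_snd continuous_snd.matrix_conjTranspose
    (continuous_const.sub h)

theorem fibreEmb_injective (D : Matrix (Fin 2) (Fin 2) 𝕜) : Function.LeftInverse
    (fun ρ : Mat4 𝕜 => (hermCoe ρ.toBlocks₁₁, ρ.toBlocks₁₂)) (fibreEmb D) := by
  rintro ⟨p, C⟩
  simp only [fibreEmb, Matrix.toBlocks_fromBlocks₁₁, Matrix.toBlocks_fromBlocks₁₂, hermCoe_hermMk]

variable [MeasureSpace 𝕜] [BorelSpace 𝕜]

theorem measurableEmbedding_hermMk :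
    MeasurableEmbedding (hermMk : ℝ × ℝ × 𝕜 → Matrix (Fin 2) (Fin 2) 𝕜) :=
  (Function.LeftInverse.isClosedEmbedding hermCoe_hermMk continuous_hermCoe
    continuous_hermMk).measurableEmbedding

theorem measurableEmbedding_fibreEmb (D : Matrix (Fin 2) (Fin 2) 𝕜) :
    MeasurableEmbedding (fibreEmb D) := by
  refine (Function.LeftInverse.isClosedEmbedding (fibreEmb_injective D) ?_
    (continuous_fibreEmb D)).measurableEmbedding
  refine Continuous.prodMk (continuous_hermCoe.comp ?_) ?_
  · exact continuous_id.matrix_submatrix Sum.inl Sum.inl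
  · exact continuous_id.matrix_submatrix Sum.inl Sum.inr

variable [(volume : Measure 𝕜).IsAddHaarMeasure]

theorem fibreVol_eq (D : Matrix (Fin 2) (Fin 2) 𝕜) : fibreVol D =
    ENNReal.ofReal (2 ^ (dimK 𝕜 / 2)) •
      (volume : Measure ((ℝ × ℝ × 𝕜) × Matrix (Fin 2) (Fin 2) 𝕜)).map (fibreEmb D) := by
  have h : ((volume : Measure (ℝ × ℝ × 𝕜)).map hermMk).prod
      (volume : Measure (Matrix (Fin 2) (Fin 2) 𝕜)) =
      (volume : Measure ((ℝ × ℝ × 𝕜) × Matrix (Fin 2) (Fin 2) 𝕜)).map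
        (Prod.map (hermMk (𝕜 := 𝕜)) id) := by
    have := Measure.map_prod_map (volume : Measure (ℝ × ℝ × 𝕜))
      (volume : Measure (Matrix (Fin 2) (Fin 2) 𝕜)) continuous_hermMk.measurable measurable_id
    rwa [Measure.map_id] at this
  have hm : Measurable fun p : Matrix (Fin 2) (Fin 2) 𝕜 × Matrix (Fin 2) (Fin 2) 𝕜 =>
      Matrix.fromBlocks p.1 p.2 p.2ᴴ (D - p.1) :=
    (Continuous.matrix_fromBlocks continuous_fst continuous_snd
      continuous_snd.matrix_conjTranspose (continuous_const.sub continuous_fst)).measurable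
  rw [fibreVol, hermVol, Measure.prod_smul_left, Measure.map_smul, h,
    Measure.map_map hm (continuous_hermMk.measurable.prodMap measurable_id)]
  rfl

/-- The coordinates of the possible blocks `D₁` of the states with partial trace `D`. -/
def blockSet (D : Matrix (Fin 2) (Fin 2) 𝕜) : Set (ℝ × ℝ × 𝕜) :=
  {p | (hermMk p).PosDef ∧ (D - hermMk p).PosDef}

theorem measurableSet_posDef {α : Type*} [MeasurableSpace α] {f : α → Matrix (Fin 2) (Fin 2) 𝕜}
    (hf : Measurable f) (hH : ∀ x, (f x).IsHermitian) : MeasurableSet {x | (f x).PosDef} := by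
  have h : {x | (f x).PosDef} =
      {x | 0 < RCLike.re (f x).trace} ∩ {x | 0 < RCLike.re (f x).det} := by
    ext x
    exact posDef_iff_trace_det.trans (and_iff_right (hH x))
  rw [h]
  exact (measurableSet_lt measurable_const
      ((RCLike.continuous_re.comp continuous_id.matrix_trace).measurable.comp hf)).inter
    (measurableSet_lt measurable_const
      ((RCLike.continuous_re.comp continuous_id.matrix_det).measurable.comp hf))

theorem measurableSet_blockSet {D : Matrix (Fin 2) (Fin 2) 𝕜} (hD : D.IsHermitian) :
    MeasurableSet (blockSet D) :=
  (measurableSet_posDef continuous_hermMk.measurable isHermitian_hermMk).inter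
    (measurableSet_posDef (measurable_const.sub continuous_hermMk.measurable)
      fun p => hD.sub (isHermitian_hermMk p))

/-- The product of the determinants of the diagonal blocks. -/
noncomputable def blockDet (D : Matrix (Fin 2) (Fin 2) 𝕜) (A : Matrix (Fin 2) (Fin 2) 𝕜) : ℝ :=
  RCLike.re A.det * RCLike.re (D - A).det

theorem continuous_blockDet (D : Matrix (Fin 2) (Fin 2) 𝕜) : Continuous (blockDet D) :=
  (RCLike.continuous_re.comp continuous_id.matrix_det).mul
    (RCLike.continuous_re.comp (continuous_const.sub continuous_id).matrix_det)

theorem contr_fibreEmb (D : Matrix (Fin 2) (Fin 2) 𝕜)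
    (q : (ℝ × ℝ × 𝕜) × Matrix (Fin 2) (Fin 2) 𝕜) : contr (fibreEmb D q) =
      (msqrt (hermMk q.1))⁻¹ * q.2 * (msqrt (D - hermMk q.1))⁻¹ := by
  simp only [contr, fibreEmb, Matrix.toBlocks_fromBlocks₁₁, Matrix.toBlocks_fromBlocks₁₂,
    Matrix.toBlocks_fromBlocks₂₂]

/-- The exponents of the defect add up to -κ + κ(1 - δ) = -κδ. -/
theorem volDensity_mul_defect {D A C : Matrix (Fin 2) (Fin 2) 𝕜} {δ : ℝ} (hD : D.trace = 1)
    (h : Matrix.fromBlocks A C Cᴴ (D - A) ∈ fibre D) :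
    volDensity Real.sqrt (Matrix.fromBlocks A C Cᴴ (D - A)) *
      defect ((msqrt A)⁻¹ * C * (msqrt (D - A))⁻¹) ^ (kap 𝕜 * (1 - δ)) =
      1 / 2 * blockDet D A ^ (-kap 𝕜) *
        defect ((msqrt A)⁻¹ * C * (msqrt (D - A))⁻¹) ^ (-(kap 𝕜 * δ)) := by
  obtain ⟨h₁, h₂, h₃⟩ := (fromBlocks_mem_fibre hD).1 h
  have hd := ((opNorm_lt_one_iff _).1 h₃).2
  have hb : 0 < blockDet D A := mul_pos (PosDef.re_det_pos h₁) (PosDef.re_det_pos h₂)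
  rw [volDensity_four h.1, re_det_fromBlocks h₁ h₂, ← blockDet, Real.mul_rpow hb.le hd.le,
    mul_assoc, mul_assoc, ← Real.rpow_add hd, ← mul_assoc]
  congr 2
  ring

/-- Common to all states and to the separable ones: these differ only in the inner X-integral,
abstracted as J. -/
theorem volReg_eq_lintegral {D : Matrix (Fin 2) (Fin 2) 𝕜} (hD : D ∈ states 𝕜 (Fin 2)) {δ r : ℝ}
    {S : Set (Mat4 𝕜)} (hS : S ⊆ fibre D)
    (hm : MeasurableSet {q | fibreEmb D q ∈ S ∧ opNorm (contr (fibreEmb D q)) < r})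
    {J : Matrix (Fin 2) (Fin 2) 𝕜 → ℝ≥0∞}
    (hJ : ∀ A, A.PosDef → (D - A).PosDef →
      ∫⁻ X in {X | Matrix.fromBlocks A (msqrt A * X * msqrt (D - A))
          (msqrt A * X * msqrt (D - A))ᴴ (D - A) ∈ S ∧ opNorm X < r},
        ENNReal.ofReal (defect X ^ (-(kap 𝕜 * δ))) = J A) :
    volReg δ r D S = ENNReal.ofReal (2 ^ (dimK 𝕜 / 2)) * ∫⁻ p in blockSet D,
      ENNReal.ofReal (1 / 2 * blockDet D (hermMk p) ^ ((dimK 𝕜 - 2) / 4)) * J (hermMk p) := by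
  set Ω := {q | fibreEmb D q ∈ S ∧ opNorm (contr (fibreEmb D q)) < r} with hΩ
  have hdet (A : Matrix (Fin 2) (Fin 2) 𝕜) (h₁ : A.PosDef) (h₂ : (D - A).PosDef) :
      0 < blockDet D A := mul_pos (PosDef.re_det_pos h₁) (PosDef.re_det_pos h₂)
  have hfib (q) (hq : q ∈ Ω) : (hermMk q.1).PosDef ∧ (D - hermMk q.1).PosDef := by
    have h := (fromBlocks_mem_fibre hD.2).1 (hS hq.1)
    exact ⟨h.1, h.2.1⟩
  -- A globally measurable substitute for the contraction, equal to it wherever both diagonal blocks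
  -- are positive definite.
  set X : (ℝ × ℝ × 𝕜) × Matrix (Fin 2) (Fin 2) 𝕜 → Matrix (Fin 2) (Fin 2) 𝕜 := fun q =>
    (sqrtFormula (hermMk q.1))⁻¹ * q.2 * (sqrtFormula (D - hermMk q.1))⁻¹ with hX
  have hXm : Measurable X := by
    have h1 : Measurable fun q : (ℝ × ℝ × 𝕜) × Matrix (Fin 2) (Fin 2) 𝕜 => hermMk q.1 :=
      continuous_hermMk.measurable.comp measurable_fst
    exact ((measurable_matrix_inv.comp (measurable_sqrtFormula.comp h1)).mul measurable_snd).mul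
      (measurable_matrix_inv.comp (measurable_sqrtFormula.comp (measurable_const.sub h1)))
  set G : (ℝ × ℝ × 𝕜) × Matrix (Fin 2) (Fin 2) 𝕜 → ℝ≥0∞ := fun q =>
    ENNReal.ofReal (1 / 2 * blockDet D (hermMk q.1) ^ (-kap 𝕜)) *
      ENNReal.ofReal (defect (X q) ^ (-(kap 𝕜 * δ))) with hG
  have hGm : Measurable G := by
    refine Measurable.mul ?_ ((measurable_defect_rpow _).comp hXm)
    exact (((((continuous_blockDet D).comp continuous_hermMk).measurable.comp
      measurable_fst).pow_const _).const_mul _).ennreal_ofReal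
  have h1 : volReg δ r D S = ENNReal.ofReal (2 ^ (dimK 𝕜 / 2)) * ∫⁻ q in Ω, G q := by
    rw [volReg, fibreVol_eq, Measure.restrict_smul, lintegral_smul_measure,
      (measurableEmbedding_fibreEmb D).restrict_map,
      (measurableEmbedding_fibreEmb D).lintegral_map, smul_eq_mul]
    congr 1
    refine setLIntegral_congr_fun hm fun q hq => ?_
    have hq' := hfib q hq
    simp only [hG, hX]
    rw [contr_fibreEmb, ← msqrt_eq_sqrtFormula hq'.1, ← msqrt_eq_sqrtFormula hq'.2,
      ← ENNReal.ofReal_mul (by have := hdet _ hq'.1 hq'.2; positivity)]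
    congr 1
    exact volDensity_mul_defect hD.2 (hS hq.1)
  rw [h1, ← lintegral_indicator hm, Measure.volume_eq_prod,
    lintegral_prod _ (hGm.indicator hm).aemeasurable,
    ← lintegral_indicator (measurableSet_blockSet hD.1.1)]
  congr 1
  refine lintegral_congr fun p => ?_
  by_cases hp : p ∈ blockSet D
  swap
  · rw [Set.indicator_of_notMem hp]
    have hC (C : Matrix (Fin 2) (Fin 2) 𝕜) : (p, C) ∉ Ω := fun h => hp (hfib (p, C) h)
    have h0 (C : Matrix (Fin 2) (Fin 2) 𝕜) : Ω.indicator G (p, C) = 0 :=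
      Set.indicator_of_notMem (hC C) G
    simp only [h0, lintegral_zero]
  obtain ⟨h₁, h₂⟩ := hp
  rw [Set.indicator_of_mem (show p ∈ blockSet D from ⟨h₁, h₂⟩)]
  have u₁ := isUnit_det_msqrt h₁
  have u₂ := isUnit_det_msqrt h₂
  have hpos := hdet _ h₁ h₂
  set A := hermMk p with hA
  have hXeq (Y : Matrix (Fin 2) (Fin 2) 𝕜) : (msqrt A)⁻¹ * (msqrt A * Y * msqrt (D - A)) *
      (msqrt (D - A))⁻¹ = Y := by
    simp only [mul_assoc]
    rw [Matrix.mul_nonsing_inv _ u₂, mul_one, Matrix.nonsing_inv_mul_cancel_left _ _ u₁]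
  have hcont : Measurable fun Y : Matrix (Fin 2) (Fin 2) 𝕜 =>
      (p, msqrt A * Y * msqrt (D - A)) := by
    have hc : Continuous fun Y : Matrix (Fin 2) (Fin 2) 𝕜 => msqrt A * Y * msqrt (D - A) := by
      fun_prop
    exact measurable_const.prodMk hc.measurable
  set T := {X | Matrix.fromBlocks A (msqrt A * X * msqrt (D - A))
      (msqrt A * X * msqrt (D - A))ᴴ (D - A) ∈ S ∧ opNorm X < r} with hT
  have hmem (Y : Matrix (Fin 2) (Fin 2) 𝕜) :
      (p, msqrt A * Y * msqrt (D - A)) ∈ Ω ↔ Y ∈ T := by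
    rw [hΩ, hT, Set.mem_ofPred_eq, Set.mem_ofPred_eq, contr_fibreEmb, ← hA, hXeq]
    rfl
  have hTm : MeasurableSet T := by
    have : T = (fun Y : Matrix (Fin 2) (Fin 2) 𝕜 => (p, msqrt A * Y * msqrt (D - A))) ⁻¹' Ω := by
      ext Y; exact (hmem Y).symm
    rw [this]; exact hcont hm
  have hpt (Y : Matrix (Fin 2) (Fin 2) 𝕜) : Ω.indicator G (p, msqrt A * Y * msqrt (D - A)) =
      ENNReal.ofReal (1 / 2 * blockDet D A ^ (-kap 𝕜)) *
        T.indicator (fun X => ENNReal.ofReal (defect X ^ (-(kap 𝕜 * δ)))) Y := by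
    by_cases hY : Y ∈ T
    · rw [Set.indicator_of_mem ((hmem Y).2 hY), Set.indicator_of_mem hY]
      simp only [hG, hX]
      rw [← hA, ← msqrt_eq_sqrtFormula h₁, ← msqrt_eq_sqrtFormula h₂, hXeq]
    · rw [Set.indicator_of_notMem fun h => hY ((hmem Y).1 h), Set.indicator_of_notMem hY, mul_zero]
  -- The Jacobian contributes the exponent d and the density -κ, with sum d - κ = (d - 2)/4.
  have hconst : (‖(msqrt A).det‖ * ‖(msqrt (D - A)).det‖) ^ (2 * Module.finrank ℝ 𝕜) *
      (1 / 2 * blockDet D A ^ (-kap 𝕜)) = 1 / 2 * blockDet D A ^ ((dimK 𝕜 - 2) / 4) := by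
    rw [pow_mul, mul_pow, norm_det_msqrt_sq h₁, norm_det_msqrt_sq h₂, ← blockDet,
      ← Real.rpow_natCast, mul_left_comm, ← Real.rpow_add hpos]
    congr 2
    rw [kap, dimK]; ring
  rw [lintegral_conj u₁.ne_zero u₂.ne_zero (fun C => Ω.indicator G (p, C)),
    lintegral_congr hpt, lintegral_const_mul _ ((measurable_defect_rpow _).indicator hTm),
    lintegral_indicator hTm, hJ A h₁ h₂, ← mul_assoc, ← ENNReal.ofReal_mul (by positivity), hconst]

end FibreIntegral

/-! ### Volumes of the fibre and of its separable part -/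

section FibreVolumes

variable {𝕜 : Type*} [RCLike 𝕜] [MeasureSpace 𝕜] [BorelSpace 𝕜]
  [(volume : Measure 𝕜).IsAddHaarMeasure]

theorem exists_measurable_contr (D : Matrix (Fin 2) (Fin 2) 𝕜) :
    ∃ X : (ℝ × ℝ × 𝕜) × Matrix (Fin 2) (Fin 2) 𝕜 → Matrix (Fin 2) (Fin 2) 𝕜, Measurable X ∧
      ∀ p ∈ blockSet D, ∀ C, X (p, C) = (msqrt (hermMk p))⁻¹ * C * (msqrt (D - hermMk p))⁻¹ := by
  refine ⟨fun q => (sqrtFormula (hermMk q.1))⁻¹ * q.2 * (sqrtFormula (D - hermMk q.1))⁻¹, ?_,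
    fun p hp C => ?_⟩
  · have h1 : Measurable fun q : (ℝ × ℝ × 𝕜) × Matrix (Fin 2) (Fin 2) 𝕜 => hermMk q.1 :=
      continuous_hermMk.measurable.comp measurable_fst
    exact ((measurable_matrix_inv.comp (measurable_sqrtFormula.comp h1)).mul measurable_snd).mul
      (measurable_matrix_inv.comp (measurable_sqrtFormula.comp (measurable_const.sub h1)))
  · simp only [msqrt_eq_sqrtFormula hp.1, msqrt_eq_sqrtFormula hp.2]

theorem measurableSet_fibre {D : Matrix (Fin 2) (Fin 2) 𝕜} (hD : D ∈ states 𝕜 (Fin 2)) (r : ℝ) :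
    MeasurableSet {q | fibreEmb D q ∈ fibre D ∧ opNorm (contr (fibreEmb D q)) < r} := by
  obtain ⟨X, hXm, hX⟩ := exists_measurable_contr D
  have h : {q | fibreEmb D q ∈ fibre D ∧ opNorm (contr (fibreEmb D q)) < r} =
      (Prod.fst ⁻¹' blockSet D) ∩ ({q | opNorm (X q) < 1} ∩ {q | opNorm (X q) < r}) := by
    ext ⟨p, C⟩
    rw [Set.mem_ofPred_eq, contr_fibreEmb, fibreEmb, fromBlocks_mem_fibre hD.2]
    constructor
    · rintro ⟨⟨h1, h2, h3⟩, h4⟩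
      have hp : p ∈ blockSet D := ⟨h1, h2⟩
      refine ⟨hp, ?_, ?_⟩
      · rw [Set.mem_ofPred_eq, hX p hp C]; exact h3
      · rw [Set.mem_ofPred_eq, hX p hp C]; exact h4
    · rintro ⟨hp, h3, h4⟩
      rw [Set.mem_ofPred_eq, hX p hp C] at h3 h4
      exact ⟨⟨hp.1, hp.2, h3⟩, h4⟩
  have hn := continuous_opNorm.measurable.comp hXm
  rw [h]
  exact (measurable_fst (measurableSet_blockSet hD.1.1)).inter
    ((measurableSet_lt hn measurable_const).inter (measurableSet_lt hn measurable_const))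

theorem measurableSet_sepStates {D : Matrix (Fin 2) (Fin 2) 𝕜} (hD : D ∈ states 𝕜 (Fin 2))
    (r : ℝ) : MeasurableSet {q | fibreEmb D q ∈ sepStates 𝕜 ∩ fibre D ∧
      opNorm (contr (fibreEmb D q)) < r} := by
  obtain ⟨X, hXm, hX⟩ := exists_measurable_contr D
  have hflip : Measurable fun q : (ℝ × ℝ × 𝕜) × Matrix (Fin 2) (Fin 2) 𝕜 => (q.1, q.2ᴴ) :=
    (continuous_fst.prodMk continuous_snd.matrix_conjTranspose).measurable
  have h : {q | fibreEmb D q ∈ sepStates 𝕜 ∩ fibre D ∧ opNorm (contr (fibreEmb D q)) < r} =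
      {q | fibreEmb D q ∈ fibre D ∧ opNorm (contr (fibreEmb D q)) < r} ∩
        {q | opNorm (X (q.1, q.2ᴴ)) < 1} := by
    ext ⟨p, C⟩
    rw [Set.mem_inter_iff, Set.mem_ofPred_eq, Set.mem_ofPred_eq, fibreEmb,
      fromBlocks_mem_sepStates_inter_fibre hD.2, fromBlocks_mem_fibre hD.2]
    constructor
    · rintro ⟨⟨h1, h2, h3, h5⟩, h4⟩
      refine ⟨⟨⟨h1, h2, h3⟩, h4⟩, ?_⟩
      rw [Set.mem_ofPred_eq, hX p ⟨h1, h2⟩]; exact h5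
    · rintro ⟨⟨⟨h1, h2, h3⟩, h4⟩, h5⟩
      rw [Set.mem_ofPred_eq, hX p ⟨h1, h2⟩] at h5
      exact ⟨⟨h1, h2, h3, h5⟩, h4⟩
  rw [h]
  exact (measurableSet_fibre hD r).inter
    (measurableSet_lt (continuous_opNorm.measurable.comp (hXm.comp hflip)) measurable_const)

theorem msqrt_conj_cancel {A B : Matrix (Fin 2) (Fin 2) 𝕜} (hA : A.PosDef) (hB : B.PosDef)
    (X : Matrix (Fin 2) (Fin 2) 𝕜) :
    (msqrt A)⁻¹ * (msqrt A * X * msqrt B) * (msqrt B)⁻¹ = X := by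
  simp only [mul_assoc]
  rw [Matrix.mul_nonsing_inv _ (isUnit_det_msqrt hB), mul_one,
    Matrix.nonsing_inv_mul_cancel_left _ _ (isUnit_det_msqrt hA)]

theorem volReg_fibre {D : Matrix (Fin 2) (Fin 2) 𝕜} (hD : D ∈ states 𝕜 (Fin 2)) (δ : ℝ) {r : ℝ}
    (hr : r ≤ 1) :
    volReg δ r D (fibre D) = ENNReal.ofReal (2 ^ (dimK 𝕜 / 2)) * ∫⁻ p in blockSet D,
      ENNReal.ofReal (1 / 2 * blockDet D (hermMk p) ^ ((dimK 𝕜 - 2) / 4)) * etaReg 𝕜 δ r 1 := by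
  refine volReg_eq_lintegral hD subset_rfl (measurableSet_fibre hD r)
    (J := fun _ => etaReg 𝕜 δ r 1) fun A h₁ h₂ => ?_
  rw [← lintegral_ball_eq_etaReg_one hr]
  congr 2
  ext X
  rw [Set.mem_ofPred_eq, Set.mem_ofPred_eq, fromBlocks_mem_fibre hD.2, msqrt_conj_cancel h₁ h₂]
  exact ⟨fun h => h.2, fun h => ⟨⟨h₁, h₂, h.trans_le hr⟩, h⟩⟩

theorem volReg_sepStates {D : Matrix (Fin 2) (Fin 2) 𝕜} (hD : D ∈ states 𝕜 (Fin 2)) (δ : ℝ)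
    {r : ℝ} (hr : r ≤ 1) :
    volReg δ r D (sepStates 𝕜 ∩ fibre D) =
      ENNReal.ofReal (2 ^ (dimK 𝕜 / 2)) * ∫⁻ p in blockSet D,
        ENNReal.ofReal (1 / 2 * blockDet D (hermMk p) ^ ((dimK 𝕜 - 2) / 4)) *
          etaReg 𝕜 δ r (svRatio (msqrt (D - hermMk p) * (msqrt (hermMk p))⁻¹)) := by
  refine volReg_eq_lintegral hD Set.inter_subset_right (measurableSet_sepStates hD r)
    (J := fun A => etaReg 𝕜 δ r (svRatio (msqrt (D - A) * (msqrt A)⁻¹))) fun A h₁ h₂ => ?_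
  have hV : (msqrt (D - A) * (msqrt A)⁻¹).det ≠ 0 := by
    rw [Matrix.det_mul]
    exact mul_ne_zero (isUnit_det_msqrt h₂).ne_zero
      (Matrix.isUnit_nonsing_inv_det _ (isUnit_det_msqrt h₁)).ne_zero
  rw [← lintegral_conjRegion hV]
  congr 2
  ext X
  rw [Set.mem_ofPred_eq, Set.mem_ofPred_eq, fromBlocks_mem_sepStates_inter_fibre hD.2,
    msqrt_conj_cancel h₁ h₂, opNorm_flip (msqrt_posDef h₁) (msqrt_posDef h₂)]
  exact ⟨fun h => ⟨h.2, h.1.2.2.2⟩, fun h => ⟨⟨h₁, h₂, h.1.trans_le hr, h.2⟩, h.1⟩⟩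

end FibreVolumes

/-! ### Parametrization of D₁ by the operator interval -/

section Substitution

variable {𝕜 : Type*} [RCLike 𝕜]

/-- Half the sum of (1+Y)(1-Y)(1+Y) and (1-Y)(1+Y)(1-Y), both congruent to positive matrices, equals
1 - Y². -/
theorem posDef_one_sub_mul_self {Y : Matrix (Fin 2) (Fin 2) 𝕜} (hY : Y ∈ opInterval 𝕜) :
    (1 - Y * Y).PosDef := by
  have h1 := hY.2.2.conjTranspose_mul_mul_same (B := 1 + Y)
    (Matrix.mulVec_injective_of_isUnit hY.2.1.isUnit)
  have h2 := hY.2.1.conjTranspose_mul_mul_same (B := 1 - Y)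
    (Matrix.mulVec_injective_of_isUnit hY.2.2.isUnit)
  rw [hY.2.1.1.eq] at h1
  rw [hY.2.2.1.eq] at h2
  have h : 1 - Y * Y = (2⁻¹ : ℝ) • ((1 + Y) * (1 - Y) * (1 + Y) + (1 - Y) * (1 + Y) * (1 - Y)) := by
    have : (1 + Y) * (1 - Y) * (1 + Y) + (1 - Y) * (1 + Y) * (1 - Y) = (2 : ℝ) • (1 - Y * Y) := by
      rw [two_smul]; noncomm_ring
    rw [this, smul_smul, inv_mul_cancel₀ two_ne_zero, one_smul]
  rw [h]
  exact (h1.add h2).smul (by norm_num)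

/-- The Cayley transform `(I - Y)(I + Y)⁻¹` of a point of the operator interval is positive. -/
theorem posDef_cayley {Y : Matrix (Fin 2) (Fin 2) 𝕜} (hY : Y ∈ opInterval 𝕜) :
    ((1 - Y) * (1 + Y)⁻¹).PosDef := by
  have hu : IsUnit (1 + Y).det := (Matrix.isUnit_iff_isUnit_det _).1 hY.2.1.isUnit
  have h1 := (posDef_one_sub_mul_self hY).conjTranspose_mul_mul_same (B := (1 + Y)⁻¹)
    (Matrix.mulVec_injective_of_isUnit hY.2.1.inv.isUnit)
  rw [hY.2.1.inv.1.eq] at h1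
  have : 1 - Y * Y = (1 + Y) * (1 - Y) := by noncomm_ring
  rwa [this, Matrix.nonsing_inv_mul_cancel_left _ _ hu] at h1

theorem svRatio_pos {V : Matrix (Fin 2) (Fin 2) 𝕜} (hV : V.det ≠ 0) : 0 < svRatio V := by
  obtain ⟨_, _, _, _, _, _, h, _⟩ := exists_svd hV
  exact h

theorem sigmaY_pos {Y : Matrix (Fin 2) (Fin 2) 𝕜} (hY : Y ∈ opInterval 𝕜) : 0 < sigmaY Y :=
  svRatio_pos (isUnit_det_msqrt (posDef_cayley hY)).ne_zero

/-- The affine parametrization of the possible blocks `D₁` by the operator interval. -/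
noncomputable def blockMk (D Y : Matrix (Fin 2) (Fin 2) 𝕜) : Matrix (Fin 2) (Fin 2) 𝕜 :=
  (2⁻¹ : ℝ) • (msqrt D * (1 + Y) * msqrt D)

theorem sub_blockMk {D : Matrix (Fin 2) (Fin 2) 𝕜} (hD : D.PosDef)
    (Y : Matrix (Fin 2) (Fin 2) 𝕜) :
    D - blockMk D Y = (2⁻¹ : ℝ) • (msqrt D * (1 - Y) * msqrt D) := by
  have h : D = (2⁻¹ : ℝ) • (msqrt D * msqrt D + msqrt D * msqrt D) := by
    rw [← two_smul ℝ, smul_smul, inv_mul_cancel₀ two_ne_zero, one_smul, msqrt_mul_msqrt hD]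
  rw [blockMk]
  nth_rw 1 [h]
  rw [← smul_sub]
  congr 1
  noncomm_ring

theorem posDef_smul_conj_iff {D : Matrix (Fin 2) (Fin 2) 𝕜} (hD : D.PosDef)
    (H : Matrix (Fin 2) (Fin 2) 𝕜) :
    ((2⁻¹ : ℝ) • (msqrt D * H * msqrt D)).PosDef ↔ H.PosDef := by
  have h := Matrix.IsUnit.posDef_star_left_conjugate_iff (x := H) (msqrt_posDef hD).isUnit
  rw [Matrix.star_eq_conjTranspose, (msqrt_posDef hD).1.eq] at h
  rw [← h]
  constructor
  · intro h1
    have := h1.smul (a := (2 : ℝ)) (by norm_num)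
    rwa [smul_smul, mul_inv_cancel₀ two_ne_zero, one_smul] at this
  · intro h1
    exact h1.smul (by norm_num)

theorem blockMk_posDef_iff {D Y : Matrix (Fin 2) (Fin 2) 𝕜} (hD : D.PosDef)
    (hY : Y.IsHermitian) :
    ((blockMk D Y).PosDef ∧ (D - blockMk D Y).PosDef) ↔ Y ∈ opInterval 𝕜 := by
  rw [sub_blockMk hD, blockMk, posDef_smul_conj_iff hD, posDef_smul_conj_iff hD]
  exact (and_iff_right hY).symm

theorem det_smul_conj {D : Matrix (Fin 2) (Fin 2) 𝕜} (hD : D.PosDef)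
    (H : Matrix (Fin 2) (Fin 2) 𝕜) :
    ((2⁻¹ : ℝ) • (msqrt D * H * msqrt D)).det = ((RCLike.re D.det / 4 : ℝ) : 𝕜) * H.det := by
  have h := congrArg Matrix.det (msqrt_mul_msqrt hD)
  rw [Matrix.det_mul, IsHermitian.det_eq_re hD.1] at h
  have hs (A : Matrix (Fin 2) (Fin 2) 𝕜) : (2⁻¹ : ℝ) • A = ((2⁻¹ : ℝ) : 𝕜) • A := by
    ext i j; simp [RCLike.real_smul_eq_coe_mul]
  rw [hs, Matrix.det_smul, Matrix.det_mul, Matrix.det_mul,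
    mul_right_comm _ H.det, h]
  push_cast
  simp only [Fintype.card_fin]
  ring

theorem blockDet_blockMk {D Y : Matrix (Fin 2) (Fin 2) 𝕜} (hD : D.PosDef)
    (hY : Y ∈ opInterval 𝕜) :
    blockDet D (blockMk D Y) = (RCLike.re D.det / 4) ^ 2 * RCLike.re (1 - Y * Y).det := by
  have h : 1 - Y * Y = (1 + Y) * (1 - Y) := by noncomm_ring
  rw [blockDet, sub_blockMk hD, blockMk, det_smul_conj hD, det_smul_conj hD, h, Matrix.det_mul,
    IsHermitian.det_eq_re hY.2.1.1, IsHermitian.det_eq_re hY.2.2.1]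
  simp only [← RCLike.ofReal_mul, RCLike.ofReal_re]
  ring

/-- Here D drops out: V*V = D₁^{-1/2} D₂ D₁^{-1/2} has the trace and determinant of D₂ D₁⁻¹, which
is the conjugate of (1 - Y)(1 + Y)⁻¹ by D^{1/2}. -/
theorem svRatio_msqrt_blockMk {D Y : Matrix (Fin 2) (Fin 2) 𝕜} (hD : D.PosDef)
    (hY : Y ∈ opInterval 𝕜) :
    svRatio (msqrt (D - blockMk D Y) * (msqrt (blockMk D Y))⁻¹) = sigmaY Y := by
  obtain ⟨h₁, h₂⟩ := (blockMk_posDef_iff hD hY.1).2 hY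
  have hM := posDef_cayley hY
  have hu : IsUnit (1 + Y).det := (Matrix.isUnit_iff_isUnit_det _).1 hY.2.1.isUnit
  have uD := isUnit_det_msqrt hD
  have u₁ : IsUnit (blockMk D Y).det := (Matrix.isUnit_iff_isUnit_det _).1 h₁.isUnit
  set M := (1 - Y) * (1 + Y)⁻¹ with hMdef
  have hsim : (D - blockMk D Y) * (blockMk D Y)⁻¹ = msqrt D * M * (msqrt D)⁻¹ := by
    have : D - blockMk D Y = msqrt D * M * (msqrt D)⁻¹ * blockMk D Y := by
      rw [sub_blockMk hD, blockMk, Matrix.mul_smul, hMdef]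
      congr 1
      simp only [mul_assoc]
      rw [Matrix.nonsing_inv_mul_cancel_left _ _ uD, Matrix.nonsing_inv_mul_cancel_left _ _ hu]
    rw [this, Matrix.mul_nonsing_inv_cancel_right _ _ u₁]
  have hL : (msqrt (D - blockMk D Y) * (msqrt (blockMk D Y))⁻¹)ᴴ *
      (msqrt (D - blockMk D Y) * (msqrt (blockMk D Y))⁻¹) =
      (msqrt (blockMk D Y))⁻¹ * (D - blockMk D Y) * (msqrt (blockMk D Y))⁻¹ := by
    rw [Matrix.conjTranspose_mul, (msqrt_posDef h₁).inv.1.eq, (msqrt_posDef h₂).1.eq]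
    nth_rw 3 [← msqrt_mul_msqrt h₂]
    simp only [mul_assoc]
  have hinv : (msqrt (blockMk D Y))⁻¹ * (msqrt (blockMk D Y))⁻¹ = (blockMk D Y)⁻¹ := by
    rw [← Matrix.mul_inv_rev, msqrt_mul_msqrt h₁]
  have hR : (msqrt M)ᴴ * msqrt M = M := by
    rw [(msqrt_posDef hM).1.eq, msqrt_mul_msqrt hM]
  refine svRatio_eq_of_trace_det ?_ ?_
  · rw [hL, hR, Matrix.trace_mul_comm, ← mul_assoc, hinv, Matrix.trace_mul_comm, hsim,
      Matrix.trace_mul_comm, Matrix.nonsing_inv_mul_cancel_left _ _ uD]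
  · rw [hL, hR, Matrix.det_mul_comm, ← mul_assoc, hinv, Matrix.det_mul_comm, hsim,
      Matrix.det_mul_comm, Matrix.nonsing_inv_mul_cancel_left _ _ uD]

/-- The linear part of `blockMk` in coordinates. -/
noncomputable def blockLin (D : Matrix (Fin 2) (Fin 2) 𝕜) :
    (ℝ × ℝ × 𝕜) →ₗ[ℝ] (ℝ × ℝ × 𝕜) where
  toFun p := hermCoe ((2⁻¹ : ℝ) • (msqrt D * hermMk p * msqrt D))
  map_add' p q := by
    have : hermMk (p + q) = hermMk p + hermMk q := by
      ext i j; fin_cases i <;> fin_cases j <;> simp [hermMk]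
    rw [this, mul_add, add_mul, smul_add]
    simp [hermCoe]
  map_smul' c p := by
    have : hermMk (c • p) = c • hermMk p := by
      ext i j; fin_cases i <;> fin_cases j <;> simp [hermMk, RCLike.real_smul_eq_coe_mul]
    rw [this, Matrix.mul_smul, Matrix.smul_mul, smul_comm]
    simp [hermCoe, RCLike.smul_re]

theorem hermMk_blockLin {D : Matrix (Fin 2) (Fin 2) 𝕜} (hD : D.PosDef) (p : ℝ × ℝ × 𝕜) :
    hermMk (blockLin D p) = (2⁻¹ : ℝ) • (msqrt D * hermMk p * msqrt D) := by
  refine hermMk_hermCoe ?_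
  have h := Matrix.isHermitian_mul_mul_conjTranspose (msqrt D) (isHermitian_hermMk p)
  rw [(msqrt_posDef hD).1.eq] at h
  rw [Matrix.IsHermitian, Matrix.conjTranspose_smul, h.eq, star_trivial]

/-- Nonvanishing suffices, because the value only enters a factor that cancels from the fraction. -/
theorem det_blockLin_ne_zero {D : Matrix (Fin 2) (Fin 2) 𝕜} (hD : D.PosDef) :
    LinearMap.det (blockLin D) ≠ 0 := by
  have hu := isUnit_det_msqrt hD
  have hinj : Function.Injective (blockLin D) := by
    rw [injective_iff_map_eq_zero]
    intro p hp
    have h := hermMk_blockLin hD p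
    have h0 : hermMk (0 : ℝ × ℝ × 𝕜) = 0 := by
      ext i j; fin_cases i <;> fin_cases j <;> simp [hermMk]
    rw [hp, h0] at h
    have h1 : msqrt D * hermMk p * msqrt D = 0 :=
      (smul_eq_zero.1 h.symm).resolve_left (by norm_num)
    have h2 : hermMk p = 0 := by
      have := congrArg (fun Z => (msqrt D)⁻¹ * Z * (msqrt D)⁻¹) h1
      simp only [mul_assoc, mul_zero, zero_mul] at this
      rwa [Matrix.mul_nonsing_inv _ hu, mul_one, Matrix.nonsing_inv_mul_cancel_left _ _ hu] at this
    rw [← hermCoe_hermMk p, h2, ← h0, hermCoe_hermMk]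
  exact (LinearMap.isUnit_det _ ((LinearMap.isUnit_iff_ker_eq_bot _).2
    (LinearMap.ker_eq_bot.2 hinj))).ne_zero

theorem hermMk_add_blockLin {D : Matrix (Fin 2) (Fin 2) 𝕜} (hD : D.PosDef) (p : ℝ × ℝ × 𝕜) :
    hermMk (blockLin D p + hermCoe ((2⁻¹ : ℝ) • D)) = blockMk D (hermMk p) := by
  have hadd (p q : ℝ × ℝ × 𝕜) : hermMk (p + q) = hermMk p + hermMk q := by
    ext i j; fin_cases i <;> fin_cases j <;> simp [hermMk]
  have hD' : ((2⁻¹ : ℝ) • D).IsHermitian := by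
    rw [Matrix.IsHermitian, Matrix.conjTranspose_smul, hD.1.eq, star_trivial]
  rw [hadd, hermMk_blockLin hD, hermMk_hermCoe hD', blockMk, mul_add, add_mul, mul_one,
    msqrt_mul_msqrt hD, smul_add, add_comm]

end Substitution

/-! ### The separable fraction as an integral against ν -/

section IntervalIntegral

variable {𝕜 : Type*} [RCLike 𝕜] [MeasureSpace 𝕜] [BorelSpace 𝕜]

theorem measurableSet_opInterval : MeasurableSet (opInterval 𝕜) := by
  have h : opInterval 𝕜 = {Y | Yᴴ = Y} ∩
      (({Y | 0 < RCLike.re (1 + Y).trace} ∩ {Y | 0 < RCLike.re (1 + Y).det}) ∩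
        ({Y | 0 < RCLike.re (1 - Y).trace} ∩ {Y | 0 < RCLike.re (1 - Y).det})) := by
    ext Y
    constructor
    · rintro ⟨h, h1, h2⟩
      exact ⟨h, (posDef_iff_trace_det.1 h1).2, (posDef_iff_trace_det.1 h2).2⟩
    · rintro ⟨h, h1, h2⟩
      exact ⟨h, posDef_iff_trace_det.2 ⟨Matrix.isHermitian_one.add h, h1⟩,
        posDef_iff_trace_det.2 ⟨Matrix.isHermitian_one.sub h, h2⟩⟩
  have hp : Continuous fun Y : Matrix (Fin 2) (Fin 2) 𝕜 => 1 + Y := continuous_const.add continuous_id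
  have hs : Continuous fun Y : Matrix (Fin 2) (Fin 2) 𝕜 => 1 - Y := continuous_const.sub continuous_id
  rw [h]
  refine (isClosed_eq continuous_id.matrix_conjTranspose continuous_id).measurableSet.inter
    (((IsOpen.inter ?_ ?_).inter (IsOpen.inter ?_ ?_)).measurableSet)
  · exact isOpen_lt continuous_const (RCLike.continuous_re.comp hp.matrix_trace)
  · exact isOpen_lt continuous_const (RCLike.continuous_re.comp hp.matrix_det)
  · exact isOpen_lt continuous_const (RCLike.continuous_re.comp hs.matrix_trace)
  · exact isOpen_lt continuous_const (RCLike.continuous_re.comp hs.matrix_det)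

theorem exists_measurable_sigmaY :
    ∃ s : Matrix (Fin 2) (Fin 2) 𝕜 → ℝ, Measurable s ∧ ∀ Y ∈ opInterval 𝕜, sigmaY Y = s Y := by
  have hM : Measurable fun Y : Matrix (Fin 2) (Fin 2) 𝕜 => (1 - Y) * (1 + Y)⁻¹ :=
    (measurable_const.sub measurable_id).mul
      (measurable_matrix_inv.comp (measurable_const.add measurable_id))
  set t : Matrix (Fin 2) (Fin 2) 𝕜 → ℝ := fun Y => RCLike.re ((1 - Y) * (1 + Y)⁻¹).trace with ht
  set d : Matrix (Fin 2) (Fin 2) 𝕜 → ℝ := fun Y => RCLike.re ((1 - Y) * (1 + Y)⁻¹).det with hd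
  have htm : Measurable t :=
    (RCLike.continuous_re.comp continuous_id.matrix_trace).measurable.comp hM
  have hdm : Measurable d :=
    (RCLike.continuous_re.comp continuous_id.matrix_det).measurable.comp hM
  refine ⟨fun Y => √((t Y - √(t Y ^ 2 - 4 * d Y)) / 2) / √((t Y + √(t Y ^ 2 - 4 * d Y)) / 2), ?_,
    fun Y hY => ?_⟩
  · fun_prop
  · have hP := posDef_cayley hY
    have h1 : frobSq (msqrt ((1 - Y) * (1 + Y)⁻¹)) = t Y := by
      have := trace_conjTranspose_mul_self (msqrt ((1 - Y) * (1 + Y)⁻¹))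
      rw [(msqrt_posDef hP).1.eq, msqrt_mul_msqrt hP] at this
      rw [ht]
      simp only [this, RCLike.ofReal_re]
    rw [sigmaY, svRatio_eq_formula, h1, norm_det_msqrt_sq hP]

variable [(volume : Measure 𝕜).IsAddHaarMeasure]

instance coordVolumeIsAddHaar : (volume : Measure (ℝ × ℝ × 𝕜)).IsAddHaarMeasure :=
  have : ((volume : Measure ℝ).prod (volume : Measure 𝕜)).IsAddHaarMeasure :=
    Measure.prod.instIsAddHaarMeasure _ _
  Measure.prod.instIsAddHaarMeasure (volume : Measure ℝ)
    ((volume : Measure ℝ).prod (volume : Measure 𝕜))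

/-- The self-adjoint matrices of the operator interval, in coordinates. -/
def coordInterval (𝕜 : Type*) [RCLike 𝕜] : Set (ℝ × ℝ × 𝕜) := hermMk ⁻¹' opInterval 𝕜

theorem lintegral_blockSet {D : Matrix (Fin 2) (Fin 2) 𝕜} (hD : D.PosDef)
    (g : Matrix (Fin 2) (Fin 2) 𝕜 → ℝ≥0∞) :
    ∫⁻ p in blockSet D, g (hermMk p) = ENNReal.ofReal |LinearMap.det (blockLin D)| *
      ∫⁻ p in coordInterval 𝕜, g (blockMk D (hermMk p)) := by
  have hI : MeasurableSet (coordInterval 𝕜) :=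
    continuous_hermMk.measurable measurableSet_opInterval
  rw [← lintegral_indicator (measurableSet_blockSet hD.1), ← lintegral_indicator hI,
    ← lintegral_add_right_eq_self _ (hermCoe ((2⁻¹ : ℝ) • D)),
    lintegral_comp_linearMap (𝕜 := ℝ) volume (blockLin D) (det_blockLin_ne_zero hD),
    Module.finrank_self, pow_one, Real.norm_eq_abs]
  congr 1
  refine lintegral_congr fun p => ?_
  have hmem : blockLin D p + hermCoe ((2⁻¹ : ℝ) • D) ∈ blockSet D ↔ p ∈ coordInterval 𝕜 := by
    change (_ ∧ _) ↔ hermMk p ∈ opInterval 𝕜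
    rw [hermMk_add_blockLin hD, blockMk_posDef_iff hD (isHermitian_hermMk p)]
  by_cases hp : p ∈ coordInterval 𝕜
  · rw [Set.indicator_of_mem (hmem.2 hp), Set.indicator_of_mem hp, hermMk_add_blockLin hD]
  · rw [Set.indicator_of_notMem (fun h => hp (hmem.1 h)), Set.indicator_of_notMem hp]

theorem measurable_nuDensity : Measurable fun Y : Matrix (Fin 2) (Fin 2) 𝕜 =>
    ENNReal.ofReal (RCLike.re (1 - Y * Y).det ^ ((dimK 𝕜 - 2) / 4)) := by
  have : Continuous fun Y : Matrix (Fin 2) (Fin 2) 𝕜 => RCLike.re (1 - Y * Y).det :=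
    RCLike.continuous_re.comp
      (continuous_const.sub (continuous_id.matrix_mul continuous_id)).matrix_det
  exact (this.measurable.pow_const _).ennreal_ofReal

theorem lintegral_nuRaw (F : Matrix (Fin 2) (Fin 2) 𝕜 → ℝ≥0∞) :
    ∫⁻ Y, F Y ∂nuRaw 𝕜 = ENNReal.ofReal (2 ^ (dimK 𝕜 / 2)) * ∫⁻ p in coordInterval 𝕜,
      ENNReal.ofReal (RCLike.re (1 - hermMk p * hermMk p).det ^ ((dimK 𝕜 - 2) / 4)) *
        F (hermMk p) := by
  rw [nuRaw, lintegral_withDensity_eq_lintegral_mul_non_measurable _ measurable_nuDensity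
    (ae_of_all _ fun _ => ENNReal.ofReal_lt_top), hermVol, Measure.restrict_smul,
    lintegral_smul_measure, measurableEmbedding_hermMk.restrict_map,
    measurableEmbedding_hermMk.lintegral_map, smul_eq_mul]
  rfl

theorem ae_nuRaw_mem_opInterval : ∀ᵐ Y ∂nuRaw 𝕜, Y ∈ opInterval 𝕜 :=
  (withDensity_absolutelyContinuous _ _).ae_le (ae_restrict_mem measurableSet_opInterval)

theorem ae_nu_mem_opInterval : ∀ᵐ Y ∂nu 𝕜, Y ∈ opInterval 𝕜 :=
  Measure.ae_smul_measure ae_nuRaw_mem_opInterval _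

theorem nu_restrict_opInterval : (nu 𝕜).restrict (opInterval 𝕜) = nu 𝕜 :=
  Measure.restrict_eq_self_of_ae_mem ae_nu_mem_opInterval

/-- K collects the Jacobian of the affine map Y ↦ D₁, a power of det D and the factor 1/2. It is the
same for both volumes and independent of δ and r. -/
theorem exists_volReg_eq {D : Matrix (Fin 2) (Fin 2) 𝕜} (hD : D ∈ states 𝕜 (Fin 2)) :
    ∃ K : ℝ≥0∞, K ≠ 0 ∧ K ≠ ∞ ∧ ∀ δ r : ℝ, r ≤ 1 →
      volReg δ r D (fibre D) = K * (etaReg 𝕜 δ r 1 * nuRaw 𝕜 Set.univ) ∧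
      volReg δ r D (sepStates 𝕜 ∩ fibre D) =
        K * ∫⁻ Y, etaReg 𝕜 δ r (sigmaY Y) ∂nuRaw 𝕜 := by
  have hd := PosDef.re_det_pos hD.1
  set e : ℝ := (dimK 𝕜 - 2) / 4 with he
  set k : ℝ≥0∞ := ENNReal.ofReal (1 / 2 * ((RCLike.re D.det / 4) ^ 2) ^ e) with hk
  set L : ℝ≥0∞ := ENNReal.ofReal |LinearMap.det (blockLin D)| with hL
  have key (J : Matrix (Fin 2) (Fin 2) 𝕜 → ℝ≥0∞) (J' : Matrix (Fin 2) (Fin 2) 𝕜 → ℝ≥0∞)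
      (hJ : ∀ Y ∈ opInterval 𝕜, J (blockMk D Y) = J' Y) :
      ENNReal.ofReal (2 ^ (dimK 𝕜 / 2)) * ∫⁻ p in blockSet D,
        ENNReal.ofReal (1 / 2 * blockDet D (hermMk p) ^ e) * J (hermMk p) =
      L * k * ∫⁻ Y, J' Y ∂nuRaw 𝕜 := by
    rw [lintegral_blockSet hD.1 fun A => ENNReal.ofReal (1 / 2 * blockDet D A ^ e) * J A,
      lintegral_nuRaw, mul_left_comm, mul_assoc L, mul_left_comm k,
      ← lintegral_const_mul' k _ ENNReal.ofReal_ne_top]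
    congr 2
    refine setLIntegral_congr_fun (continuous_hermMk.measurable measurableSet_opInterval)
      fun p hp => ?_
    have hp' : hermMk p ∈ opInterval 𝕜 := hp
    have hq := PosDef.re_det_pos (posDef_one_sub_mul_self hp')
    change ENNReal.ofReal (1 / 2 * blockDet D (blockMk D (hermMk p)) ^ e) *
      J (blockMk D (hermMk p)) = _
    rw [hJ _ hp', blockDet_blockMk hD.1 hp', Real.mul_rpow (by positivity) hq.le, ← mul_assoc,
      ENNReal.ofReal_mul (by positivity), mul_assoc]
  refine ⟨L * k, ?_, ENNReal.mul_ne_top ENNReal.ofReal_ne_top ENNReal.ofReal_ne_top,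
    fun δ r hr => ⟨?_, ?_⟩⟩
  · refine mul_ne_zero ?_ ?_
    · simpa [hL] using det_blockLin_ne_zero hD.1
    · rw [hk, Ne, ENNReal.ofReal_eq_zero, not_le]
      positivity
  · rw [volReg_fibre hD δ hr, key (fun _ => etaReg 𝕜 δ r 1) (fun _ => etaReg 𝕜 δ r 1)
      fun _ _ => rfl, lintegral_const]
  · rw [volReg_sepStates hD δ hr]
    exact key (fun A => etaReg 𝕜 δ r (svRatio (msqrt (D - A) * (msqrt A)⁻¹))) _
      fun Y hY => by rw [svRatio_msqrt_blockMk hD.1 hY]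

/-- K cancels. The cutoff 0 < r < 1 makes η_{d,δ,r}(1) positive and finite, so the division passes
under the integral. -/
theorem sepFrac_eq_lintegral {D : Matrix (Fin 2) (Fin 2) 𝕜} (hD : D ∈ states 𝕜 (Fin 2))
    {δ r : ℝ} (hδ : 0 ≤ δ) (hδ1 : δ ≤ 1) (hr : 0 < r) (hr1 : r < 1) :
    sepFrac δ r D = ∫⁻ Y, etaReg 𝕜 δ r (sigmaY Y) / etaReg 𝕜 δ r 1 ∂nu 𝕜 := by
  obtain ⟨K, hK0, hK, h⟩ := exists_volReg_eq hD
  have hE0 : etaReg 𝕜 δ r 1 ≠ 0 := etaReg_one_ne_zero hδ hr hr1.le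
  have hE : etaReg 𝕜 δ r 1 ≠ ∞ := etaReg_ne_top hδ hδ1 hr1 one_ne_zero
  rw [sepFrac, (h δ r hr1.le).1, (h δ r hr1.le).2, ENNReal.mul_div_mul_left _ _ hK0 hK, nu,
    lintegral_smul_measure]
  simp only [div_eq_mul_inv]
  rw [lintegral_mul_const' _ _ (ENNReal.inv_ne_top.2 hE0), smul_eq_mul,
    ENNReal.mul_inv (Or.inl hE0) (Or.inl hE), mul_comm (etaReg 𝕜 δ r 1)⁻¹, mul_left_comm]

end IntervalIntegral

/-! ### ν is a probability measure -/

section NuProbability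

variable {𝕜 : Type*} [RCLike 𝕜]

theorem re_det_one_add_smul_hermMk (s : ℝ) (p : ℝ × ℝ × 𝕜) :
    RCLike.re (1 + s • hermMk p).det =
      (1 + s * p.1) * (1 + s * p.2.1) - s ^ 2 * ‖p.2.2‖ ^ 2 := by
  have h : (1 + s • hermMk p).det =
      (((1 + s * p.1) * (1 + s * p.2.1) - s ^ 2 * ‖p.2.2‖ ^ 2 : ℝ) : 𝕜) := by
    have hz := ofReal_normSq p.2.2
    rw [RCLike.ofReal_sub, RCLike.ofReal_mul (s ^ 2), hz]
    simp [Matrix.det_fin_two, hermMk, RCLike.real_smul_eq_coe_mul]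
    ring
  rw [h, RCLike.ofReal_re]

theorem re_trace_one_add_smul_hermMk (s : ℝ) (p : ℝ × ℝ × 𝕜) :
    RCLike.re (1 + s • hermMk p).trace = (1 + s * p.1) + (1 + s * p.2.1) := by
  simp [Matrix.trace_fin_two, hermMk]
  ring

theorem mem_coordInterval_iff (p : ℝ × ℝ × 𝕜) : p ∈ coordInterval 𝕜 ↔
    ∀ s ∈ ({1, -1} : Set ℝ), 0 < 1 + s * p.1 ∧ 0 < 1 + s * p.2.1 ∧
      0 < (1 + s * p.1) * (1 + s * p.2.1) - ‖p.2.2‖ ^ 2 := by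
  have hpd (s : ℝ) (hs : s ^ 2 = 1) : (1 + s • hermMk p).PosDef ↔ 0 < 1 + s * p.1 ∧
      0 < 1 + s * p.2.1 ∧ 0 < (1 + s * p.1) * (1 + s * p.2.1) - ‖p.2.2‖ ^ 2 := by
    have hH : (1 + s • hermMk p).IsHermitian := by
      rw [Matrix.IsHermitian, Matrix.conjTranspose_add, Matrix.conjTranspose_smul,
        (isHermitian_hermMk p).eq, star_trivial, Matrix.conjTranspose_one]
    rw [posDef_iff_trace_det, re_trace_one_add_smul_hermMk, re_det_one_add_smul_hermMk, hs, one_mul,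
      and_iff_right hH]
    have hz : 0 ≤ ‖p.2.2‖ ^ 2 := by positivity
    constructor
    · rintro ⟨h1, h2⟩
      have h3 : 0 < (1 + s * p.1) * (1 + s * p.2.1) := by linarith
      rcases mul_pos_iff.1 h3 with h | h
      · exact ⟨h.1, h.2, h2⟩
      · linarith [h.1, h.2]
    · rintro ⟨h1, h2, h3⟩
      exact ⟨by linarith, h3⟩
  have h1 := hpd 1 (by norm_num)
  have h2 := hpd (-1) (by norm_num)
  rw [one_smul] at h1
  rw [neg_one_smul, ← sub_eq_add_neg] at h2
  simp only [Set.mem_insert_iff, Set.mem_singleton_iff, forall_eq_or_imp, forall_eq]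
  rw [← h1, ← h2]
  exact and_iff_right (isHermitian_hermMk p)

theorem re_det_one_sub_hermMk_sq (p : ℝ × ℝ × 𝕜) :
    RCLike.re (1 - hermMk p * hermMk p).det =
      ((1 + p.1) * (1 + p.2.1) - ‖p.2.2‖ ^ 2) * ((1 - p.1) * (1 - p.2.1) - ‖p.2.2‖ ^ 2) := by
  have hH : (1 + hermMk p).IsHermitian := Matrix.isHermitian_one.add (isHermitian_hermMk p)
  have hH' : (1 - hermMk p).IsHermitian := Matrix.isHermitian_one.sub (isHermitian_hermMk p)
  have h : 1 - hermMk p * hermMk p = (1 + hermMk p) * (1 - hermMk p) := by noncomm_ring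
  have h1 := re_det_one_add_smul_hermMk 1 p
  have h2 := re_det_one_add_smul_hermMk (-1) p
  rw [one_smul] at h1
  rw [neg_one_smul, ← sub_eq_add_neg] at h2
  rw [h, Matrix.det_mul, IsHermitian.det_eq_re hH, IsHermitian.det_eq_re hH',
    ← RCLike.ofReal_mul, RCLike.ofReal_re, h1, h2]
  ring

theorem isOpen_coordInterval : IsOpen (coordInterval 𝕜) := by
  have h : coordInterval 𝕜 = ⋂ s ∈ ({1, -1} : Set ℝ), {p : ℝ × ℝ × 𝕜 | 0 < 1 + s * p.1} ∩
      ({p | 0 < 1 + s * p.2.1} ∩ {p | 0 < (1 + s * p.1) * (1 + s * p.2.1) - ‖p.2.2‖ ^ 2}) := by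
    ext p
    rw [mem_coordInterval_iff]
    simp only [Set.mem_iInter, Set.mem_inter_iff, Set.mem_ofPred_eq]
  rw [h]
  refine (Set.toFinite _).isOpen_biInter fun s _ => ?_
  exact (isOpen_lt (by fun_prop) (by fun_prop)).inter
    ((isOpen_lt (by fun_prop) (by fun_prop)).inter (isOpen_lt (by fun_prop) (by fun_prop)))

theorem zero_mem_coordInterval : (0 : ℝ × ℝ × 𝕜) ∈ coordInterval 𝕜 := by
  rw [mem_coordInterval_iff]
  simp

/-- An integrable function dominating the inverse square root of `det (I + s Y)`. -/
noncomputable def detDominator (s : ℝ) (p : ℝ × ℝ × 𝕜) : ℝ≥0∞ :=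
  ENNReal.ofReal |p.1 + s| ^ (-(1 / 4) : ℝ) * (ENNReal.ofReal |p.2.1 + s| ^ (-(1 / 4) : ℝ) *
    ENNReal.ofReal |√(|p.1 + s| * |p.2.1 + s|) - ‖p.2.2‖| ^ (-(1 / 2) : ℝ))

/-- With A, B the diagonal entries of 1 + sY and z < √(AB) the modulus of the off-diagonal one, AB -
z² ≥ √(AB)(√(AB) - z). -/
theorem inv_sqrt_det_le_detDominator {s : ℝ} (hs : s ∈ ({1, -1} : Set ℝ)) {p : ℝ × ℝ × 𝕜}
    (hp : p ∈ coordInterval 𝕜) :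
    ENNReal.ofReal ((1 + s * p.1) * (1 + s * p.2.1) - ‖p.2.2‖ ^ 2) ^ (-(1 / 2) : ℝ) ≤
      detDominator s p := by
  obtain ⟨h1, h2, h3⟩ := (mem_coordInterval_iff p).1 hp s hs
  have habs (x : ℝ) (hx : 0 < 1 + s * x) : |x + s| = 1 + s * x := by
    have hs1 : |s| = 1 := by
      rcases hs with rfl | rfl <;> norm_num
    have hs2 : s * s = 1 := by rw [← abs_mul_abs_self, hs1, one_mul]
    have : x + s = s * (1 + s * x) := by
      rw [mul_add, ← mul_assoc, hs2]; ring
    rw [this, abs_mul, hs1, one_mul, abs_of_pos hx]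
  rw [detDominator, habs _ h1, habs _ h2]
  set A := 1 + s * p.1
  set B := 1 + s * p.2.1
  set z := ‖p.2.2‖
  have hz : 0 ≤ z := norm_nonneg _
  have hm0 : 0 < √(A * B) := Real.sqrt_pos.2 (by positivity)
  have hmsq : √(A * B) ^ 2 = A * B := Real.sq_sqrt (by positivity)
  have hzm : z < √(A * B) := by
    rw [← sq_lt_sq₀ hz hm0.le, hmsq]; linarith
  have hle : √(A * B) * (√(A * B) - z) ≤ A * B - z ^ 2 := by nlinarith
  have hpow : ENNReal.ofReal A ^ (-(1 / 4) : ℝ) * ENNReal.ofReal B ^ (-(1 / 4) : ℝ) =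
      ENNReal.ofReal (√(A * B)) ^ (-(1 / 2) : ℝ) := by
    rw [Real.sqrt_eq_rpow, ← ENNReal.ofReal_rpow_of_pos (by positivity), ← ENNReal.rpow_mul,
      ENNReal.ofReal_mul h1.le, ENNReal.mul_rpow_of_ne_top ENNReal.ofReal_ne_top
        ENNReal.ofReal_ne_top]
    norm_num
  rw [← mul_assoc, hpow, abs_of_pos (sub_pos.2 hzm), ← ENNReal.mul_rpow_of_ne_top
    ENNReal.ofReal_ne_top ENNReal.ofReal_ne_top, ← ENNReal.ofReal_mul hm0.le]
  exact rpow_neg_le_rpow_neg (by norm_num) (ENNReal.ofReal_le_ofReal hle)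

/-- For u = det(1 + Y) and v = det(1 - Y) one has uv ≤ 1, and the exponent is at least -1/4. Then
(uv)^{-1/4} ≤ u^{-1/2} + v^{-1/2} separates the two boundary singularities. -/
theorem nuDensity_le {p : ℝ × ℝ × 𝕜} (hp : p ∈ coordInterval 𝕜) :
    ENNReal.ofReal (RCLike.re (1 - hermMk p * hermMk p).det ^ ((dimK 𝕜 - 2) / 4)) ≤
      detDominator 1 p + detDominator (-1) p := by
  have hd := one_le_dimK (𝕜 := 𝕜)
  obtain ⟨h1, h2, h3⟩ := (mem_coordInterval_iff p).1 hp 1 (by simp)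
  obtain ⟨h1', h2', h3'⟩ := (mem_coordInterval_iff p).1 hp (-1) (by simp)
  have e1 := inv_sqrt_det_le_detDominator (s := 1) (by simp) hp
  have e2 := inv_sqrt_det_le_detDominator (s := -1) (by simp) hp
  rw [one_mul, one_mul] at h3 e1
  rw [neg_one_mul, neg_one_mul, ← sub_eq_add_neg, ← sub_eq_add_neg] at h3' e2
  rw [one_mul] at h1 h2
  rw [neg_one_mul, ← sub_eq_add_neg] at h1' h2'
  rw [re_det_one_sub_hermMk_sq]
  set u := (1 + p.1) * (1 + p.2.1) - ‖p.2.2‖ ^ 2 with hu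
  set v := (1 - p.1) * (1 - p.2.1) - ‖p.2.2‖ ^ 2 with hv
  have huv : u * v ≤ 1 := by
    have hz : 0 ≤ ‖p.2.2‖ ^ 2 := by positivity
    calc u * v ≤ ((1 + p.1) * (1 + p.2.1)) * ((1 - p.1) * (1 - p.2.1)) :=
          mul_le_mul (by linarith) (by linarith) h3'.le (by positivity)
      _ = (1 - p.1 ^ 2) * (1 - p.2.1 ^ 2) := by ring
      _ ≤ 1 * 1 := mul_le_mul (by nlinarith) (by nlinarith) (by nlinarith) zero_le_one
      _ = 1 := one_mul 1
  calc ENNReal.ofReal ((u * v) ^ ((dimK 𝕜 - 2) / 4))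
      ≤ ENNReal.ofReal ((u * v) ^ (-(1 / 4) : ℝ)) :=
        ENNReal.ofReal_le_ofReal (Real.rpow_le_rpow_of_exponent_ge (by positivity) huv (by linarith))
    _ ≤ ENNReal.ofReal (u ^ (-(1 / 2) : ℝ) + v ^ (-(1 / 2) : ℝ)) := by
        refine ENNReal.ofReal_le_ofReal ?_
        have hsq (x : ℝ) (hx : 0 < x) : x ^ (-(1 / 2) : ℝ) = (x ^ (-(1 / 4) : ℝ)) ^ 2 := by
          rw [← Real.rpow_natCast, ← Real.rpow_mul hx.le]; norm_num
        rw [Real.mul_rpow h3.le h3'.le, hsq u h3, hsq v h3']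
        nlinarith [sq_nonneg (u ^ (-(1 / 4) : ℝ) - v ^ (-(1 / 4) : ℝ)),
          sq_nonneg (u ^ (-(1 / 4) : ℝ) + v ^ (-(1 / 4) : ℝ))]
    _ = ENNReal.ofReal u ^ (-(1 / 2) : ℝ) + ENNReal.ofReal v ^ (-(1 / 2) : ℝ) := by
        rw [ENNReal.ofReal_add (by positivity) (by positivity), ENNReal.ofReal_rpow_of_pos h3,
          ENNReal.ofReal_rpow_of_pos h3']
    _ ≤ _ := add_le_add e1 e2

theorem coordInterval_subset : coordInterval 𝕜 ⊆
    Metric.ball (0 : ℝ) 1 ×ˢ (Metric.ball (0 : ℝ) 1 ×ˢ Metric.ball (0 : 𝕜) 3) := by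
  intro p hp
  obtain ⟨h1, h2, h3⟩ := (mem_coordInterval_iff p).1 hp 1 (by simp)
  obtain ⟨h1', h2', h3'⟩ := (mem_coordInterval_iff p).1 hp (-1) (by simp)
  refine ⟨?_, ?_, ?_⟩
  · rw [mem_ball_zero_iff, Real.norm_eq_abs, abs_lt]; constructor <;> linarith
  · rw [mem_ball_zero_iff, Real.norm_eq_abs, abs_lt]; constructor <;> linarith
  · rw [mem_ball_zero_iff]
    nlinarith [norm_nonneg p.2.2]

theorem setLIntegral_abs_add_rpow_lt_top {s : ℝ} (hs : |s| = 1) :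
    ∫⁻ a in Metric.ball (0 : ℝ) 1, ENNReal.ofReal |a + s| ^ (-(1 / 4) : ℝ) < ∞ := by
  have h := setLIntegral_ball_rpow_lt_top (volume : Measure ℝ) (p := 1 / 4) (by norm_num) 2
  rw [← lintegral_indicator measurableSet_ball, ← lintegral_add_right_eq_self _ s] at h
  refine lt_of_le_of_lt ?_ h
  rw [← lintegral_indicator measurableSet_ball]
  refine lintegral_mono fun a => ?_
  by_cases ha : a ∈ Metric.ball (0 : ℝ) 1
  · rw [Set.indicator_of_mem ha, Set.indicator_of_mem, Real.norm_eq_abs]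
    rw [mem_ball_zero_iff, Real.norm_eq_abs] at ha ⊢
    linarith [abs_add_le a s]
  · rw [Set.indicator_of_notMem ha]; exact zero_le

variable [MeasureSpace 𝕜] [BorelSpace 𝕜] [(volume : Measure 𝕜).IsAddHaarMeasure]

theorem measurable_detDominator (s : ℝ) :
    Measurable (detDominator s : ℝ × ℝ × 𝕜 → ℝ≥0∞) := by
  unfold detDominator; fun_prop

/-- The integral over the off-diagonal entry is bounded uniformly in the radius √(|a+s||b+s|) < 2;
what remains is a product of one-dimensional integrals with exponent -1/4. -/
theorem setLIntegral_detDominator_lt_top {s : ℝ} (hs : |s| = 1) :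
    ∫⁻ p in Metric.ball (0 : ℝ) 1 ×ˢ (Metric.ball (0 : ℝ) 1 ×ˢ Metric.ball (0 : 𝕜) 3),
      detDominator s p < ∞ := by
  obtain ⟨B, hB, hle⟩ := exists_setLIntegral_ball_sub_rpow_le (volume : Measure 𝕜)
    (p := 1 / 2) (by norm_num) 3
  have hI := setLIntegral_abs_add_rpow_lt_top hs
  set I := ∫⁻ a in Metric.ball (0 : ℝ) 1, ENNReal.ofReal |a + s| ^ (-(1 / 4) : ℝ) with hIdef
  have hbd (x : ℝ) (hx : x ∈ Metric.ball (0 : ℝ) 1) : 0 < |x + s| ∧ |x + s| < 2 := by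
    rw [mem_ball_zero_iff, Real.norm_eq_abs] at hx
    constructor
    · rw [abs_pos]
      intro h0
      have : s = -x := by linarith
      rw [this, abs_neg] at hs
      linarith
    · linarith [abs_add_le x s]
  have hm := measurable_detDominator (𝕜 := 𝕜) s
  rw [Measure.volume_eq_prod, Measure.volume_eq_prod, ← Measure.prod_restrict,
    ← Measure.prod_restrict, lintegral_prod _ hm.aemeasurable]
  calc _ ≤ ∫⁻ a in Metric.ball (0 : ℝ) 1, ENNReal.ofReal |a + s| ^ (-(1 / 4) : ℝ) * (I * B) := by
        refine setLIntegral_mono' measurableSet_ball fun a ha => ?_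
        rw [lintegral_prod (fun y => detDominator s (a, y))
          (hm.comp measurable_prodMk_left).aemeasurable]
        simp only [detDominator]
        calc _ ≤ ∫⁻ b in Metric.ball (0 : ℝ) 1, ENNReal.ofReal |a + s| ^ (-(1 / 4) : ℝ) *
              (ENNReal.ofReal |b + s| ^ (-(1 / 4) : ℝ) * B) := by
              refine setLIntegral_mono' measurableSet_ball fun b hb => ?_
              rw [lintegral_const_mul _ (by fun_prop), lintegral_const_mul _ (by fun_prop)]
              gcongr
              refine hle _ ⟨Real.sqrt_pos.2 (mul_pos (hbd a ha).1 (hbd b hb).1), ?_⟩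
              rw [Real.sqrt_lt' (by norm_num)]
              nlinarith [(hbd a ha).1, (hbd b hb).1, (hbd a ha).2, (hbd b hb).2]
          _ = _ := by
              rw [lintegral_const_mul _ (by fun_prop), lintegral_mul_const _ (by fun_prop)]
    _ = I * (I * B) := by rw [lintegral_mul_const _ (by fun_prop)]
    _ < ∞ := ENNReal.mul_lt_top hI (ENNReal.mul_lt_top hI hB)

theorem nuRaw_univ_eq : nuRaw 𝕜 Set.univ = ENNReal.ofReal (2 ^ (dimK 𝕜 / 2)) *
    ∫⁻ p in coordInterval 𝕜,
      ENNReal.ofReal (RCLike.re (1 - hermMk p * hermMk p).det ^ ((dimK 𝕜 - 2) / 4)) := by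
  have h := lintegral_nuRaw (fun _ : Matrix (Fin 2) (Fin 2) 𝕜 => 1)
  rwa [lintegral_one, lintegral_congr fun p => mul_one _] at h

theorem nuRaw_univ_ne_top : nuRaw 𝕜 Set.univ ≠ ∞ := by
  rw [nuRaw_univ_eq]
  refine ENNReal.mul_ne_top ENNReal.ofReal_ne_top (ne_of_lt ?_)
  calc _ ≤ ∫⁻ p in coordInterval 𝕜, (detDominator 1 p + detDominator (-1) p) :=
        setLIntegral_mono' isOpen_coordInterval.measurableSet fun p hp => nuDensity_le hp
    _ ≤ ∫⁻ p in Metric.ball (0 : ℝ) 1 ×ˢ (Metric.ball (0 : ℝ) 1 ×ˢ Metric.ball (0 : 𝕜) 3),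
        (detDominator 1 p + detDominator (-1) p) := lintegral_mono_set coordInterval_subset
    _ < ∞ := by
        rw [lintegral_add_left (measurable_detDominator 1)]
        exact ENNReal.add_lt_top.2 ⟨setLIntegral_detDominator_lt_top (by norm_num),
          setLIntegral_detDominator_lt_top (by norm_num)⟩

theorem nuRaw_univ_ne_zero : nuRaw 𝕜 Set.univ ≠ 0 := by
  rw [nuRaw_univ_eq]
  refine mul_ne_zero (by rw [Ne, ENNReal.ofReal_eq_zero, not_le]; positivity) (ne_of_gt ?_)
  have hm : Measurable fun p : ℝ × ℝ × 𝕜 =>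
      ENNReal.ofReal (RCLike.re (1 - hermMk p * hermMk p).det ^ ((dimK 𝕜 - 2) / 4)) :=
    measurable_nuDensity.comp continuous_hermMk.measurable
  rw [setLIntegral_pos_iff hm, Set.inter_eq_right.2]
  · exact isOpen_coordInterval.measure_pos _ ⟨0, zero_mem_coordInterval⟩
  · intro p hp
    rw [Function.mem_support, Ne, ENNReal.ofReal_eq_zero, not_le]
    exact Real.rpow_pos_of_pos (PosDef.re_det_pos (posDef_one_sub_mul_self hp)) _

theorem isProbabilityMeasure_nu : IsProbabilityMeasure (nu 𝕜) :=
  ⟨by rw [nu, Measure.smul_apply, smul_eq_mul,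
    ENNReal.inv_mul_cancel nuRaw_univ_ne_zero nuRaw_univ_ne_top]⟩

end NuProbability

/-! ### Passage to the limits r → 1 and δ → 1 -/

section SeparabilityProbability

variable {𝕜 : Type*} [RCLike 𝕜] [MeasureSpace 𝕜] [BorelSpace 𝕜]
  [(volume : Measure 𝕜).IsAddHaarMeasure]

theorem aemeasurable_etaReg_div (δ : ℝ) {r : ℝ} (hr : r ≤ 1) :
    AEMeasurable (fun Y => etaReg 𝕜 δ r (sigmaY Y) / etaReg 𝕜 δ r 1) (nu 𝕜) := by
  obtain ⟨F, hF, hF'⟩ := exists_measurable_etaReg (𝕜 := 𝕜) δ hr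
  obtain ⟨s, hs, hs'⟩ := exists_measurable_sigmaY (𝕜 := 𝕜)
  refine ⟨fun Y => F (s Y) / etaReg 𝕜 δ r 1, (hF.comp hs).div_const _, ?_⟩
  filter_upwards [ae_nu_mem_opInterval] with Y hY
  rw [hF' _ (sigmaY_pos hY), hs' Y hY]

theorem eventually_mem_Ioo_left_one : ∀ᶠ r in 𝓝[<] (1 : ℝ), r ∈ Set.Ioo (0 : ℝ) 1 :=
  Ioo_mem_nhdsLT zero_lt_one

/-- Dominated convergence with the constant bound 1, which is integrable since ν is a probability
measure. -/
theorem tendsto_sepFrac_lintegral {D : Matrix (Fin 2) (Fin 2) 𝕜} (hD : D ∈ states 𝕜 (Fin 2))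
    {δ : ℝ} (hδ : 0 ≤ δ) (hδ1 : δ ≤ 1) :
    Tendsto (fun r => sepFrac δ r D) (𝓝[<] 1) (𝓝 (∫⁻ Y, etaQuot 𝕜 δ (sigmaY Y) ∂nu 𝕜)) := by
  have hp := isProbabilityMeasure_nu (𝕜 := 𝕜)
  have h : Tendsto (fun r => ∫⁻ Y, etaReg 𝕜 δ r (sigmaY Y) / etaReg 𝕜 δ r 1 ∂nu 𝕜) (𝓝[<] 1)
      (𝓝 (∫⁻ Y, etaQuot 𝕜 δ (sigmaY Y) ∂nu 𝕜)) := by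
    refine tendsto_lintegral_filter_of_dominated_convergence' (fun _ => 1) ?_ ?_ (by simp) ?_
    · filter_upwards [eventually_mem_Ioo_left_one] with r hr
      exact aemeasurable_etaReg_div δ hr.2.le
    · filter_upwards [eventually_mem_Ioo_left_one] with r hr
      refine ae_of_all _ fun Y => ENNReal.div_le_of_le_mul ?_
      rw [one_mul]
      exact etaReg_le_one hr.2.le
    · filter_upwards [ae_nu_mem_opInterval] with Y hY
      exact tendsto_etaQuot hδ hδ1 (sigmaY_pos hY)
  refine h.congr' ?_
  filter_upwards [eventually_mem_Ioo_left_one] with r hr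
  exact (sepFrac_eq_lintegral hD hδ hδ1 hr.1 hr.2).symm

theorem sepQuot_eq_lintegral {D : Matrix (Fin 2) (Fin 2) 𝕜} (hD : D ∈ states 𝕜 (Fin 2))
    {δ : ℝ} (hδ : 0 ≤ δ) (hδ1 : δ ≤ 1) :
    sepQuot δ D = ∫⁻ Y, etaQuot 𝕜 δ (sigmaY Y) ∂nu 𝕜 :=
  (tendsto_sepFrac_lintegral hD hδ hδ1).limUnder_eq

/-- Measurability survives along a sequence r → 1; the shift by N keeps every term inside (0, 1). -/
theorem aemeasurable_etaQuot {δ : ℝ} (hδ : 0 ≤ δ) (hδ1 : δ ≤ 1) :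
    AEMeasurable (fun Y => etaQuot 𝕜 δ (sigmaY Y)) (nu 𝕜) := by
  obtain ⟨u, hu⟩ := exists_seq_tendsto (𝓝[<] (1 : ℝ))
  have hu1 : ∀ᶠ n in atTop, u n ∈ Set.Ioo (0 : ℝ) 1 := hu.eventually eventually_mem_Ioo_left_one
  obtain ⟨N, hN⟩ := eventually_atTop.1 hu1
  refine aemeasurable_of_tendsto_metrizable_ae atTop
    (f := fun n Y => etaReg 𝕜 δ (u (n + N)) (sigmaY Y) / etaReg 𝕜 δ (u (n + N)) 1)
    (fun n => aemeasurable_etaReg_div δ (hN _ (Nat.le_add_left N n)).2.le) ?_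
  filter_upwards [ae_nu_mem_opInterval] with Y hY
  exact ((tendsto_etaQuot hδ hδ1 (sigmaY_pos hY)).comp hu).comp (tendsto_add_atTop_nat N)

theorem tendsto_sepQuot {D : Matrix (Fin 2) (Fin 2) 𝕜} (hD : D ∈ states 𝕜 (Fin 2)) :
    Tendsto (fun δ => sepQuot δ D) (𝓝[<] 1) (𝓝 (∫⁻ Y, etaQuot 𝕜 1 (sigmaY Y) ∂nu 𝕜)) := by
  have hp := isProbabilityMeasure_nu (𝕜 := 𝕜)
  have h : Tendsto (fun δ => ∫⁻ Y, etaQuot 𝕜 δ (sigmaY Y) ∂nu 𝕜) (𝓝[<] 1)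
      (𝓝 (∫⁻ Y, etaQuot 𝕜 1 (sigmaY Y) ∂nu 𝕜)) := by
    refine tendsto_lintegral_filter_of_dominated_convergence' (fun _ => 1) ?_ ?_ (by simp) ?_
    · filter_upwards [eventually_mem_Ioo_left_one] with δ hδ
      exact aemeasurable_etaQuot hδ.1.le hδ.2.le
    · filter_upwards [eventually_mem_Ioo_left_one] with δ hδ
      filter_upwards [ae_nu_mem_opInterval] with Y hY
      exact etaQuot_le_one hδ.1.le hδ.2.le (sigmaY_pos hY)
    · filter_upwards [ae_nu_mem_opInterval] with Y hY
      exact tendsto_etaQuot_one (sigmaY_pos hY)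
  refine h.congr' ?_
  filter_upwards [eventually_mem_Ioo_left_one] with δ hδ
  exact (sepQuot_eq_lintegral hD hδ.1.le hδ.2.le).symm

theorem sepProb_eq_lintegral {D : Matrix (Fin 2) (Fin 2) 𝕜} (hD : D ∈ states 𝕜 (Fin 2)) :
    sepProb D = ∫⁻ Y in opInterval 𝕜, etaNorm 𝕜 (sigmaY Y) ∂nu 𝕜 := by
  rw [sepProb, (tendsto_sepQuot hD).limUnder_eq, nu_restrict_opInterval]
  refine lintegral_congr_ae ?_
  filter_upwards [ae_nu_mem_opInterval] with Y hY
  rw [etaNorm_eq (sigmaY_pos hY)]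

end SeparabilityProbability

end SqrtSep

theorem mainTheorem7 {𝕜 : Type*} [RCLike 𝕜] [MeasureSpace 𝕜] [BorelSpace 𝕜]
    [(volume : Measure 𝕜).IsAddHaarMeasure] :
    -- the plain normalization is not available
    SqrtSep.eta 𝕜 1 = ∞ ∧
    -- the limits defining the normalized function exist
    (∀ ε : ℝ, 0 < ε →
      (∀ δ ∈ Set.Ioc (0 : ℝ) 1,
        Tendsto (fun r => SqrtSep.etaReg 𝕜 δ r ε / SqrtSep.etaReg 𝕜 δ r 1) (𝓝[<] 1)
          (𝓝 (SqrtSep.etaQuot 𝕜 δ ε))) ∧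
      Tendsto (fun δ => SqrtSep.etaQuot 𝕜 δ ε) (𝓝[<] 1) (𝓝 (SqrtSep.etaNorm 𝕜 ε))) ∧
    IsProbabilityMeasure (SqrtSep.nu 𝕜) ∧
    (∀ D ∈ SqrtSep.states 𝕜 (Fin 2),
      -- the limits defining the separability probability exist
      (∀ δ ∈ Set.Ioc (0 : ℝ) 1,
        Tendsto (fun r => SqrtSep.sepFrac δ r D) (𝓝[<] 1) (𝓝 (SqrtSep.sepQuot δ D))) ∧
      Tendsto (fun δ => SqrtSep.sepQuot δ D) (𝓝[<] 1) (𝓝 (SqrtSep.sepProb D)) ∧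
      -- exhaustion of the metric volume itself gives the same value
      SqrtSep.sepQuot 1 D = SqrtSep.sepProb D ∧
      -- the integral formula
      SqrtSep.sepProb D =
        ∫⁻ Y in SqrtSep.opInterval 𝕜, SqrtSep.etaNorm 𝕜 (SqrtSep.sigmaY Y) ∂(SqrtSep.nu 𝕜)) ∧
    -- independence of the reduced state
    (∀ D ∈ SqrtSep.states 𝕜 (Fin 2), ∀ D' ∈ SqrtSep.states 𝕜 (Fin 2),
      SqrtSep.sepProb D = SqrtSep.sepProb D') := by
  refine ⟨SqrtSep.eta_one_eq_top, fun ε hε => ⟨fun δ hδ => SqrtSep.tendsto_etaQuot hδ.1.le hδ.2 hε,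
    ?_⟩, SqrtSep.isProbabilityMeasure_nu, fun D hD => ⟨fun δ hδ => ?_, ?_, ?_,
    SqrtSep.sepProb_eq_lintegral hD⟩, fun D hD D' hD' => ?_⟩
  · rw [SqrtSep.etaNorm_eq hε]
    exact SqrtSep.tendsto_etaQuot_one hε
  · rw [SqrtSep.sepQuot_eq_lintegral hD hδ.1.le hδ.2]
    exact SqrtSep.tendsto_sepFrac_lintegral hD hδ.1.le hδ.2
  · rw [SqrtSep.sepProb, (SqrtSep.tendsto_sepQuot hD).limUnder_eq]
    exact SqrtSep.tendsto_sepQuot hD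
  · rw [SqrtSep.sepProb, (SqrtSep.tendsto_sepQuot hD).limUnder_eq,
      SqrtSep.sepQuot_eq_lintegral hD zero_le_one le_rfl]
  · rw [SqrtSep.sepProb_eq_lintegral hD, SqrtSep.sepProb_eq_lintegral hD']
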